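/- Let $\mathbb K$ be a field of characteristic $0$ and $\delta\in\mathbb K$. **Deligne's category.** For finite words $w,w'$ in the letters $\bullet,\circ$, a $(w,w')$-diagram is a perfect matching of the vertices of a bottom row labelled by $w$ and a top row labelled by $w'$ such that an edge joins vertices of different colours if and only if its two vertices lie in the same row. An edge is *propagating* if it joins the two rows. The category $\underline{\mathrm{Re}}\mathrm{p}_0(GL_\delta)$ has these words as objects; $\mathrm{Hom}(w,w')$ is the $\mathbb K$-vector space with basis the $(w,w')$-diagrams; the composite of two diagrams is $\delta^{\ell}$ times the diagram obtained by stacking them, where $\ell$ is the number of closed loops removed. It is a symmetric monoidal $\mathbb K$-linear category under concatenation of words and juxtaposition of diagrams, with the evident crossing diagrams as braiding. $\underline{\mathrm{Re}}\mathrm{p}(GL_\delta)$ is the Karoubi envelope of its additive envelope. **The objects $L(\lambda)$.** A bipartition is a pair $\lambda=(\lambda^\bullet,\lambda^\circ)$ of partitions; put $r=|\lambda^\bullet|$, $s=|\lambda^\circ|$, $w_{r,s}=\bullet^r\circ^s$ and $B_{r,s}=\mathrm{End}(w_{r,s})$. Permutation diagrams embed $\mathbb K[\Sigma_r\times\Sigma_s]$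 in $B_{r,s}$. Let $z_\lambda\in\mathbb K[\Sigma_r\times\Sigma_s]\subset B_{r,s}$ be the product of the primitive idempotents (normalized Young symmetrizers) belonging to $\lambda^\bullet$ and $\lambda^\circ$, and let $J\subset B_{r,s}$ be the span of the diagrams with fewer than $r+s$ propagating edges. Let $e_\lambda$ be a member that is not in $J$ of a decomposition of $z_\lambda$ into mutually orthogonal primitive idempotents of $B_{r,s}$, and let $L(\lambda)=\operatorname{im}e_\lambda\in\underline{\mathrm{Re}}\mathrm{p}(GL_\delta)$ (such $e_\lambda$ exist, and the theorem holds for every choice of them). **The functor.** Let $\mathcal T$ be a tensor category over $\mathbb K$, that is, a rigid symmetric monoidal $\mathbb K$-linear category with bilinear tensor product and $\mathrm{End}(\mathbf 1)=\mathbb K$. Let $V$ be an object of $\mathcal T$ with dual $V^*$ and categorical dimension $\mathrm{ev}_V\circ c_{V,V^*}\circ\mathrm{coev}_V=\delta$, and let $T(r,s)=V^{\otimes r}\otimes (V^*)^{\otimes s}$. Let $F:\underline{\mathrm{Re}}\mathrm{p}(GL_\delta)\to\mathcal T$ be a functor induced by $V$, that is, an additive functor whose restriction to $\underline{\mathrm{Re}}\mathrm{p}_0(GL_\delta)$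 is a $\mathbb K$-linear symmetric (strong) monoidal functor and for which $F(\bullet)\cong V$. **Theorem.** Suppose that for all $p\ge 0$ the $\mathbb K$-algebra map $\mathbb K\Sigma_p\to\mathrm{End}_{\mathcal T}(V^{\otimes p})$ defined by the symmetric braiding is surjective, and that $\mathrm{Hom}_{\mathcal T}(T(r,s),T(r',s'))=0$ whenever $r+s'\ne r'+s$. Then: 1. $F$ is full. 2. The set $\Lambda=\{F(L(\lambda)) : \lambda \text{ a bipartition},\ F(L(\lambda))\neq 0\}$ is a complete set of indecomposable summands of the mixed tensor powers: each member of $\Lambda$ is indecomposable and is a direct summand of some $T(r,s)$, and each nonzero indecomposable direct summand of any $T(r,s)$ is isomorphic to a member of $\Lambda$. Moreover the members of $\Lambda$ are pairwise non-isomorphic: if $F(L(\lambda))$ and $F(L(\mu))$ are nonzero and isomorphic, then $\lambda=\mu$. -/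

import Mathlib

namespace DeligneGL

open Equiv CategoryTheory MonoidalCategory

universe u v w


section Trace
variable {A B C A' B' C' U V : Type}

/-- `A ⊔ (U ⊔ {*}) = (A ⊔ U) ⊔ {*}`. -/
def optOut (A U : Type) : A ⊕ Option U ≃ Option (A ⊕ U) where
  toFun := Sum.elim (fun a => some (Sum.inl a)) (Option.map Sum.inr)
  invFun x := x.elim (Sum.inr none) (Sum.elim Sum.inl (fun u => Sum.inr (some u)))
  left_inv := by rintro (a | _ | u) <;> rfl
  right_inv := by rintro (_ | a | u) <;> rfl

/-- View `e : A ⊔ (U ⊔ {*}) ≃ B ⊔ (U ⊔ {*})` as a system of directed edges, one starting at each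
element of `A ⊔ U ⊔ {*}` and ending at one of `B ⊔ U ⊔ {*}`. `removeMid e` removes the middle vertex `*`:
the edge arriving at `*` is joined to the edge leaving it (nothing is joined when `*` is a loop). -/
noncomputable def removeMid (e : A ⊕ Option U ≃ B ⊕ Option U) : A ⊕ U ≃ B ⊕ U :=
  removeNone ((optOut A U).symm.trans (e.trans (optOut B U)))

open Classical in
/-- `1` if `p` holds, and `0` otherwise. -/
noncomputable def bit (p : Prop) : ℕ := if p then 1 else 0

/-- The number of closed loops that disappear when `*` is removed: `1` if `e` sends `*` to itself. -/
noncomputable def loopAt (e : A ⊕ Option U ≃ B ⊕ Option U) : ℕ :=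
  bit (e (Sum.inr none) = Sum.inr none)

/-- The inclusion `A ⊔ U ⊆ A ⊔ (U ⊔ {*})`. -/
def up : A ⊕ U → A ⊕ Option U := Sum.map id some

theorem up_ne (x : A ⊕ U) : up x ≠ Sum.inr none := by rcases x with a | u <;> simp [up]

theorem up_inj {x y : A ⊕ U} : up x = up y ↔ x = y := by
  rcases x with a | u <;> rcases y with b | v <;> simp [up]

theorem optOut_symm_some (x : A ⊕ U) : (optOut A U).symm (some x) = up x := by
  rcases x with a | u <;> rfl

theorem optOut_symm_none : (optOut A U).symm none = Sum.inr none := rfl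

theorem optOut_up (x : A ⊕ U) : optOut A U (up x) = some x := by
  rcases x with a | u <;> rfl

theorem up_cases (y : A ⊕ Option U) : y = Sum.inr none ∨ ∃ x, y = up x := by
  rcases y with a | _ | u
  · exact Or.inr ⟨Sum.inl a, rfl⟩
  · exact Or.inl rfl
  · exact Or.inr ⟨Sum.inr u, rfl⟩

theorem rm_of_ne (e : A ⊕ Option U ≃ B ⊕ Option U) (x : A ⊕ U) (h : e (up x) ≠ Sum.inr none) :
    up (removeMid e x) = e (up x) := by
  obtain h' | ⟨y, hy⟩ := up_cases (e (up x))
  · exact absurd h' h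
  · have := removeNone_some ((optOut A U).symm.trans (e.trans (optOut B U))) (x := x)
      ⟨y, by simp [optOut_symm_some, hy, optOut_up]⟩
    simp only [trans_apply, optOut_symm_some, hy, optOut_up, Option.some.injEq] at this
    rw [hy]
    exact congrArg up this

theorem rm_of_eq (e : A ⊕ Option U ≃ B ⊕ Option U) (x : A ⊕ U) (h : e (up x) = Sum.inr none) :
    up (removeMid e x) = e (Sum.inr none) := by
  have h1 := removeNone_none ((optOut A U).symm.trans (e.trans (optOut B U))) (x := x)
      (by simp only [trans_apply, optOut_symm_some, h]; rfl)
  simp only [trans_apply, optOut_symm_none] at h1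
  apply (optOut B U).injective
  rw [optOut_up]
  exact h1

theorem up_rm_iff (e : A ⊕ Option U ≃ B ⊕ Option U) (x : A ⊕ U) (y : B ⊕ Option U) :
    up (removeMid e x) = y ↔ (e (up x) = Sum.inr none ∧ e (Sum.inr none) = y) ∨
      (e (up x) ≠ Sum.inr none ∧ e (up x) = y) := by
  by_cases h : e (up x) = Sum.inr none
  · simp [rm_of_eq e x h, h]
  · simp [rm_of_ne e x h, h]

theorem rm_eq_iff (e : A ⊕ Option U ≃ B ⊕ Option U) (x : A ⊕ U) (y : B ⊕ U) :
    removeMid e x = y ↔ (e (up x) = Sum.inr none ∧ e (Sum.inr none) = up y) ∨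
      (¬ e (up x) = Sum.inr none ∧ e (up x) = up y) := by
  rw [← up_inj, up_rm_iff]

/-- Relabelling of the vertices of `e : A ⊔ U ≃ B ⊔ U`. -/
def relabel (f : A ≃ A') (g : B ≃ B') (u : U ≃ V) (e : A ⊕ U ≃ B ⊕ U) : A' ⊕ V ≃ B' ⊕ V :=
  (sumCongr f u).symm.trans (e.trans (sumCongr g u))

theorem rl_apply (f : A ≃ A') (g : B ≃ B') (u : U ≃ V) (e : A ⊕ U ≃ B ⊕ U) (x : A ⊕ U) :
    relabel f g u e (Sum.map f u x) = Sum.map g u (e x) := by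
  rcases x with a | x <;> simp [relabel]

theorem rl_apply' (f : A ≃ A') (g : B ≃ B') (u : U ≃ V) (e : A ⊕ U ≃ B ⊕ U) (x : A' ⊕ V) :
    relabel f g u e x = Sum.map g u (e (Sum.map f.symm u.symm x)) := by
  rcases x with a | x <;> simp [relabel]

theorem rm_rl (f : A ≃ A') (g : B ≃ B') (u : U ≃ V) (e : A ⊕ Option U ≃ B ⊕ Option U) :
    removeMid (relabel f g (optionCongr u) e) = relabel f g u (removeMid e) := by
  ext1 x
  have h1 : ∀ z : B ⊕ U, up (Sum.map g u z) = Sum.map g (optionCongr u) (up z) := by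
    rintro (z | z) <;> simp [up]
  have h2 : ∀ z : A ⊕ U, up (Sum.map f u z) = Sum.map f (optionCongr u) (up z) := by
    rintro (z | z) <;> simp [up]
  have h3 : ∀ z : B ⊕ Option U, Sum.map g (optionCongr u) z = Sum.inr none ↔ z = Sum.inr none := by
    rintro (z | _ | z) <;> simp
  obtain ⟨x, rfl⟩ := (sumCongr f u).surjective x
  rw [← up_inj, up_rm_iff, sumCongr_apply, h2, rl_apply, rl_apply, h1, h3]
  have : relabel f g (optionCongr u) e (Sum.inr none) = Sum.map g (optionCongr u) (e (Sum.inr none)) :=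
    rl_apply f g (optionCongr u) e (Sum.inr none)
  rw [this]
  by_cases h : e (up x) = Sum.inr none
  · simp [rm_of_eq e x h, h]
  · rw [rm_of_ne e x h]; simp only [h, h3, false_and, false_or, ne_eq, not_false_eq_true, true_and]

theorem lp_rl (f : A ≃ A') (g : B ≃ B') (u : U ≃ V) (e : A ⊕ Option U ≃ B ⊕ Option U) :
    loopAt (relabel f g (optionCongr u) e) = loopAt e := by
  have h3 : ∀ z : B ⊕ Option U, Sum.map g (optionCongr u) z = Sum.inr none ↔ z = Sum.inr none := by
    rintro (z | _ | z) <;> simp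
  have : relabel f g (optionCongr u) e (Sum.inr none) = Sum.map g (optionCongr u) (e (Sum.inr none)) :=
    rl_apply f g (optionCongr u) e (Sum.inr none)
  unfold loopAt
  rw [this, h3]

def sw (U : Type) : Option (Option U) ≃ Option (Option U) where
  toFun x := match x with
    | none => some none
    | some none => none
    | some (some u) => some (some u)
  invFun x := match x with
    | none => some none
    | some none => none
    | some (some u) => some (some u)
  left_inv := by rintro (_ | _ | u) <;> rfl
  right_inv := by rintro (_ | _ | u) <;> rfl

theorem rm_rm_sw (e : A ⊕ Option (Option U) ≃ B ⊕ Option (Option U)) :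
    removeMid (removeMid (relabel (Equiv.refl A) (Equiv.refl B) (sw U) e)) = removeMid (removeMid e) ∧
    loopAt (removeMid (relabel (Equiv.refl A) (Equiv.refl B) (sw U) e))
      + loopAt (relabel (Equiv.refl A) (Equiv.refl B) (sw U) e) = loopAt (removeMid e) + loopAt e := by
  generalize he' : relabel (Equiv.refl A) (Equiv.refl B) (sw U) e = e'
  have k0 : ∀ x : A ⊕ U, e' (up (up x)) = Sum.map id (sw U) (e (up (up x))) := by
    intro x
    rw [← he', rl_apply']
    rcases x with x | x <;> rfl
  have k1 : e' (Sum.inr none) = Sum.map id (sw U) (e (Sum.inr (some none))) := by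
    rw [← he', rl_apply']; rfl
  have k2 : e' (Sum.inr (some none)) = Sum.map id (sw U) (e (Sum.inr none)) := by
    rw [← he', rl_apply']; rfl
  have s1 : ∀ z : B ⊕ Option (Option U), Sum.map id (sw U) z = Sum.inr none ↔
      z = Sum.inr (some none) := by
    rintro (z | _ | _ | z) <;> simp [sw]
  have s2 : ∀ z : B ⊕ Option (Option U), Sum.map id (sw U) z = Sum.inr (some none) ↔
      z = Sum.inr none := by
    rintro (z | _ | _ | z) <;> simp [sw]
  have s3 : ∀ z : B ⊕ Option (Option U), z ≠ Sum.inr none → z ≠ Sum.inr (some none) →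
      Sum.map id (sw U) z = z := by
    rintro (z | _ | _ | z) <;> simp [sw]
  have un : (up (Sum.inr none : A ⊕ Option U)) = Sum.inr (some none) := rfl
  have iB : ∀ z : B ⊕ Option U, z = Sum.inr none ↔ up z = Sum.inr (some none) := by
    intro z; rw [← up_inj]; rfl
  have i1 := e.injective.ne (a₁ := Sum.inr none) (a₂ := Sum.inr (some none)) (by simp)
  have q1 := rm_eq_iff e (Sum.inr none) (Sum.inr none)
  have q2 := rm_eq_iff e' (Sum.inr none) (Sum.inr none)
  have ub : (up (Sum.inr none : B ⊕ Option U)) = Sum.inr (some none) := rfl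
  rw [un, ub] at q1 q2
  rw [k1, k2] at q2
  generalize hs : Sum.map id (sw U) = s at k0 k1 k2 s1 s2 s3 q2
  clear hs he'
  constructor
  · ext1 x
    have i2 := e.injective.ne (a₁ := up (up x)) (a₂ := Sum.inr (some none))
      (by rcases x with x | x <;> simp [up])
    have i3 := e.injective.ne (a₁ := up (up x)) (a₂ := Sum.inr none) (up_ne _)
    have k0 := k0 x
    have key : ∀ y : B ⊕ U, removeMid (removeMid e) x = y → removeMid (removeMid e') x = y := by
      intro y
      have hy := up_ne (up y)
      have hy' : up (up y) ≠ Sum.inr (some none) := by rw [← ub, ne_eq, up_inj]; exact up_ne y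
      have a1 := rm_eq_iff (removeMid e) x y
      have a2 := rm_eq_iff (removeMid e') x y
      have b1 := rm_eq_iff e (up x) (up y)
      have b2 := rm_eq_iff e' (up x) (up y)
      have c1 := rm_eq_iff e (up x) (Sum.inr none)
      have c2 := rm_eq_iff e' (up x) (Sum.inr none)
      have d1 := rm_eq_iff e (Sum.inr none) (up y)
      have d2 := rm_eq_iff e' (Sum.inr none) (up y)
      rw [ub] at c1 c2
      rw [un] at d1 d2
      rw [k0, k1] at b2 c2
      rw [k1, k2] at d2
      rw [a1, a2, b1, b2, c1, c2, d1, d2]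
      clear a1 a2 b1 b2 c1 c2 d1 d2 q1 q2 k0 k1 k2
      generalize e (up (up x)) = p at *
      generalize e (Sum.inr none) = q at *
      generalize e (Sum.inr (some none)) = r at *
      generalize up (up y) = t at *
      simp only [s1, s2]
      have p3 := s3 p
      have q3 := s3 q
      have r3 := s3 r
      have r1 := s2 r
      have r2 := s2 q
      clear s3 s1 s2
      grind
    exact key _ rfl
  · unfold loopAt
    rw [k1, q1, q2, s1, s1, s2, s2]
    generalize e (Sum.inr none) = q at *
    generalize e (Sum.inr (some none)) = r at *
    clear s1 s2 s3 k0 k1 k2 q1 q2 iB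
    unfold bit
    grind

theorem rl_rl {A'' B'' W : Type} (f : A ≃ A') (g : B ≃ B') (u : U ≃ V) (f' : A' ≃ A'')
    (g' : B' ≃ B'') (u' : V ≃ W) (e : A ⊕ U ≃ B ⊕ U) :
    relabel f' g' u' (relabel f g u e) = relabel (f.trans f') (g.trans g') (u.trans u') e := by
  ext1 x
  rw [rl_apply', rl_apply', rl_apply', Sum.map_map, Sum.map_map]
  rfl

theorem rl_refl (e : A ⊕ U ≃ B ⊕ U) :
    relabel (Equiv.refl A) (Equiv.refl B) (Equiv.refl U) e = e := by
  ext1 x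
  rw [rl_apply']
  simp

/-- Remove the `n` middle vertices one after the other, counting the closed loops that disappear. -/
noncomputable def contractFin : (n : ℕ) → (A ⊕ Fin n ≃ B ⊕ Fin n) → (A ≃ B) × ℕ
  | 0, e => ((sumEmpty A (Fin 0)).symm.trans (e.trans (sumEmpty B (Fin 0))), 0)
  | n + 1, e =>
    let e' := relabel (Equiv.refl A) (Equiv.refl B) (finSuccEquiv n) e
    ((contractFin n (removeMid e')).1, (contractFin n (removeMid e')).2 + loopAt e')

/-- Relabelling of the source and target of a bijection together with a loop number. -/
def act (f : A ≃ A') (g : B ≃ B') (t : (A ≃ B) × ℕ) : (A' ≃ B') × ℕ :=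
  (f.symm.trans (t.1.trans g), t.2)

theorem trFin_rl (f : A ≃ A') (g : B ≃ B') (n : ℕ) (e : A ⊕ Fin n ≃ B ⊕ Fin n) :
    contractFin n (relabel f g (Equiv.refl _) e) = act f g (contractFin n e) := by
  induction n with
  | zero =>
    refine Prod.ext ?_ rfl
    ext1 x
    simp only [contractFin, act, trans_apply]
    have : (sumEmpty A' (Fin 0)).symm x = Sum.map f (Equiv.refl _) (Sum.inl (f.symm x)) := by simp
    rw [this, rl_apply]
    have h2 : (sumEmpty A (Fin 0)).symm (f.symm x) = Sum.inl (f.symm x) := rfl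
    rw [h2]
    rcases e (Sum.inl (f.symm x)) with y | y
    · rfl
    · exact y.elim0
  | succ n ih =>
    have h : relabel (Equiv.refl A') (Equiv.refl B') (finSuccEquiv n) (relabel f g (Equiv.refl _) e) =
        relabel f g (optionCongr (Equiv.refl _))
          (relabel (Equiv.refl A) (Equiv.refl B) (finSuccEquiv n) e) := by
      rw [rl_rl, rl_rl, optionCongr_refl]; rfl
    simp only [contractFin]
    rw [h, rm_rl, lp_rl, ih]
    rfl

theorem trFin_swap (n : ℕ) (i : Fin n) (e : A ⊕ Fin (n + 1) ≃ B ⊕ Fin (n + 1)) :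
    contractFin (n + 1) (relabel (Equiv.refl A) (Equiv.refl B) (swap i.castSucc i.succ) e) =
      contractFin (n + 1) e := by
  induction n with
  | zero => exact i.elim0
  | succ n ih =>
    refine Fin.cases ?_ (fun j => ?_) i
    · have h : ∀ e : A ⊕ Fin (n + 1 + 1) ≃ B ⊕ Fin (n + 1 + 1),
          relabel (Equiv.refl A) (Equiv.refl B) (finSuccEquiv n)
          (removeMid (relabel (Equiv.refl A) (Equiv.refl B) (finSuccEquiv (n + 1)) e)) =
          removeMid (relabel (Equiv.refl A) (Equiv.refl B)
            ((finSuccEquiv (n + 1)).trans (optionCongr (finSuccEquiv n))) e) := by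
        intro e
        rw [← rm_rl, rl_rl]; rfl
      have h' : ∀ e : A ⊕ Fin (n + 1 + 1) ≃ B ⊕ Fin (n + 1 + 1),
          loopAt (relabel (Equiv.refl A) (Equiv.refl B) (finSuccEquiv (n + 1)) e) =
          loopAt (relabel (Equiv.refl A) (Equiv.refl B)
            ((finSuccEquiv (n + 1)).trans (optionCongr (finSuccEquiv n))) e) := by
        intro e
        rw [← lp_rl (Equiv.refl A) (Equiv.refl B) (finSuccEquiv n), rl_rl]; rfl
      have hs : (swap (0 : Fin (n + 1)).castSucc (0 : Fin (n + 1)).succ).trans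
          ((finSuccEquiv (n + 1)).trans (optionCongr (finSuccEquiv n))) =
          ((finSuccEquiv (n + 1)).trans (optionCongr (finSuccEquiv n))).trans (sw (Fin n)) := by
        ext1 x
        refine Fin.cases ?_ (fun x => Fin.cases ?_ (fun x => ?_) x) x
        · simp [sw, swap_apply_left]
        · have : (0 : Fin (n + 1)).succ = 1 := rfl
          simp only [trans_apply, Fin.castSucc_zero, swap_apply_right]
          rfl
        · simp only [trans_apply, Fin.castSucc_zero]
          rw [swap_apply_of_ne_of_ne (Fin.succ_ne_zero _)
            (fun h => Fin.succ_ne_zero _ (Fin.succ_injective _ h))]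
          rfl
      have key := rm_rm_sw (relabel (Equiv.refl A) (Equiv.refl B)
            ((finSuccEquiv (n + 1)).trans (optionCongr (finSuccEquiv n))) e)
      rw [rl_rl, ← hs] at key
      simp only [contractFin, h, h']
      rw [rl_rl]
      refine Prod.ext ?_ ?_
      · exact congrArg (fun t => (contractFin n t).1) key.1
      · simp only
        rw [add_assoc, key.2, key.1]; exact (add_assoc _ _ _).symm
    · have hs : (swap j.succ.castSucc j.succ.succ).trans (finSuccEquiv (n + 1)) =
          (finSuccEquiv (n + 1)).trans (optionCongr (swap j.castSucc j.succ)) := by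
        ext1 x
        refine Fin.cases ?_ (fun x => ?_) x
        · simp only [trans_apply]
          rw [swap_apply_of_ne_of_ne]
          · rfl
          · rw [← Fin.succ_castSucc]; exact (Fin.succ_ne_zero _).symm
          · exact (Fin.succ_ne_zero _).symm
        · simp only [trans_apply, finSuccEquiv_succ, ← Fin.succ_castSucc]
          rw [(Fin.succ_injective _).swap_apply]
          rfl
      rw [contractFin]
      simp only [rl_rl, hs]
      have h : ∀ e : A ⊕ Fin (n + 1 + 1) ≃ B ⊕ Fin (n + 1 + 1),
          relabel (Equiv.refl A) (Equiv.refl B) ((finSuccEquiv (n + 1)).trans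
            (optionCongr (swap j.castSucc j.succ))) e =
          relabel (Equiv.refl A) (Equiv.refl B) (optionCongr (swap j.castSucc j.succ))
            (relabel (Equiv.refl A) (Equiv.refl B) (finSuccEquiv (n + 1)) e) := by
        intro e; rw [rl_rl]; rfl
      simp only [refl_trans]
      rw [h, rm_rl, lp_rl, ih]
      rfl

theorem trFin_perm (n : ℕ) (p : Perm (Fin n)) (e : A ⊕ Fin n ≃ B ⊕ Fin n) :
    contractFin n (relabel (Equiv.refl A) (Equiv.refl B) p e) = contractFin n e := by
  cases n with
  | zero =>
    have : p = Equiv.refl _ := Subsingleton.elim _ _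
    rw [this, rl_refl]
  | succ n =>
    have hp : p ∈ Submonoid.closure (Set.range fun i : Fin n ↦ swap i.castSucc i.succ) := by
      rw [Equiv.Perm.mclosure_swap_castSucc_succ]; trivial
    induction hp using Submonoid.closure_induction generalizing e with
    | mem x hx => obtain ⟨i, rfl⟩ := hx; exact trFin_swap n i e
    | one => exact congrArg _ (rl_refl e)
    | mul x y _ _ hx hy =>
      have := hx (relabel (Equiv.refl A) (Equiv.refl B) y e)
      rw [rl_rl, hy] at this
      exact this

/-- For `e : A ⊔ U ≃ B ⊔ U`, the bijection `A ≃ B` that follows the edges of `e` through the middle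
vertices `U` until they reach `B`, together with the number of closed loops contained in `U`. -/
noncomputable def contract [Finite U] (e : A ⊕ U ≃ B ⊕ U) : (A ≃ B) × ℕ :=
  contractFin (Nat.card U) (relabel (Equiv.refl A) (Equiv.refl B) (Finite.equivFin U) e)

theorem trFin_eq_tr [Finite U] (n : ℕ) (u : U ≃ Fin n) (e : A ⊕ U ≃ B ⊕ U) :
    contractFin n (relabel (Equiv.refl A) (Equiv.refl B) u e) = contract e := by
  obtain rfl : n = Nat.card U := by simpa using (Nat.card_congr u).symm
  rw [contract, ← trFin_perm _ (u.symm.trans (Finite.equivFin U)), rl_rl]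
  congr 2
  ext x; simp

theorem tr_rl [Finite U] [Finite V] (f : A ≃ A') (g : B ≃ B') (u : U ≃ V) (e : A ⊕ U ≃ B ⊕ U) :
    contract (relabel f g u e) = act f g (contract e) := by
  rw [← trFin_eq_tr _ (u.symm.trans (Finite.equivFin U)), contract, ← trFin_rl, rl_rl, rl_rl]
  congr 2
  ext x; simp

theorem tr_empty [IsEmpty U] (e : A ⊕ U ≃ B ⊕ U) :
    contract e = ((sumEmpty A U).symm.trans (e.trans (sumEmpty B U)), 0) := by
  rw [← trFin_eq_tr 0 (Equiv.equivOfIsEmpty _ _)]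
  refine Prod.ext ?_ rfl
  ext1 x
  simp only [contractFin, trans_apply]
  rw [rl_apply']
  have : Sum.map (Equiv.refl A).symm (Equiv.equivOfIsEmpty U (Fin 0)).symm
    ((sumEmpty A (Fin 0)).symm x) = (sumEmpty A U).symm x := rfl
  rw [this]
  rcases e ((sumEmpty A U).symm x) with y | y
  · rfl
  · exact isEmptyElim y

theorem tr_option [Finite U] (e : A ⊕ Option U ≃ B ⊕ Option U) :
    contract e = ((contract (removeMid e)).1, (contract (removeMid e)).2 + loopAt e) := by
  have h : relabel (Equiv.refl A) (Equiv.refl B) (finSuccEquiv (Nat.card U)) (relabel (Equiv.refl A)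
      (Equiv.refl B) ((optionCongr (Finite.equivFin U)).trans (finSuccEquiv _).symm) e)
      = relabel (Equiv.refl A) (Equiv.refl B) (optionCongr (Finite.equivFin U)) e := by
    rw [rl_rl]; congr 1; ext1 x; simp
  rw [← trFin_eq_tr _ ((optionCongr (Finite.equivFin U)).trans (finSuccEquiv _).symm), contractFin]
  rw [h, rm_rl, lp_rl]
  rfl

/-- Following the edges from `x`, one leaves the middle vertices at `b`. -/
inductive Exit (e : A ⊕ U ≃ B ⊕ U) : A ⊕ U → B → Prop
  | out {x : A ⊕ U} {b : B} (h : e x = Sum.inl b) : Exit e x b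
  | step {x : A ⊕ U} {u : U} {b : B} (h : e x = Sum.inr u) (h' : Exit e (Sum.inr u) b) : Exit e x b

theorem Exit.relabel {e : A ⊕ U ≃ B ⊕ U} {x : A ⊕ U} {b : B} (h : Exit e x b) (u : U ≃ V) :
    Exit (relabel (Equiv.refl A) (Equiv.refl B) u e) (Sum.map id u x) b := by
  induction h with
  | out h => exact Exit.out (by have := rl_apply (Equiv.refl A) (Equiv.refl B) u e; simp only [coe_refl] at this; rw [this, h]; rfl)
  | step h _ ih => exact Exit.step (by have := rl_apply (Equiv.refl A) (Equiv.refl B) u e; simp only [coe_refl] at this; rw [this, h]; rfl) ih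

theorem Exit.removeMid {e : A ⊕ Option U ≃ B ⊕ Option U} {y : A ⊕ Option U} {b : B} (h : Exit e y b) :
    (∀ x, y = up x → Exit (removeMid e) x b) ∧
      (y = Sum.inr none → e y ≠ Sum.inr none ∧
        ∀ x, e (up x) = Sum.inr none → Exit (DeligneGL.removeMid e) x b) := by
  have key : ∀ (x : A ⊕ U) (z : B ⊕ U), up (DeligneGL.removeMid e x) = up z → DeligneGL.removeMid e x = z :=
    fun _ _ h => up_inj.1 h
  induction h with
  | out h =>
    refine ⟨?_, ?_⟩
    · rintro x rfl
      refine Exit.out (key _ _ ?_)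
      rw [rm_of_ne _ _ (by simp [h]), h]; rfl
    · rintro rfl
      refine ⟨by simp [h], fun x hx => Exit.out (key _ _ ?_)⟩
      rw [rm_of_eq _ _ hx, h]; rfl
  | @step y u b h h' ih =>
    refine ⟨?_, ?_⟩
    · rintro x rfl
      cases u with
      | none => exact (ih.2 rfl).2 x h
      | some v =>
        refine Exit.step (key _ _ ?_) (ih.1 (Sum.inr v) rfl)
        rw [rm_of_ne _ _ (by simp [h]), h]; rfl
    · rintro rfl
      cases u with
      | none => exact absurd h (ih.2 rfl).1
      | some v =>
        refine ⟨by simp [h], fun x hx => Exit.step (key _ _ ?_) (ih.1 (Sum.inr v) rfl)⟩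
        rw [rm_of_eq _ _ hx, h]; rfl

theorem tr_of_exit [Finite U] (e : A ⊕ U ≃ B ⊕ U) :
    (∀ a b, Exit e (Sum.inl a) b → (contract e).1 a = b) ∧
      ((∀ u, ∃ b, Exit e (Sum.inr u) b) → (contract e).2 = 0) := by
  revert e
  refine Finite.induction_empty_option (P := fun U => ∀ [Finite U] (e : A ⊕ U ≃ B ⊕ U),
    (∀ a b, Exit e (Sum.inl a) b → (contract e).1 a = b) ∧
      ((∀ u, ∃ b, Exit e (Sum.inr u) b) → (contract e).2 = 0)) ?_ ?_ ?_ U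
  · intro U V u ih _ e
    have : Finite U := Finite.of_equiv V u.symm
    have h := ih (relabel (Equiv.refl A) (Equiv.refl B) u.symm e)
    rw [tr_rl] at h
    refine ⟨fun a b hab => h.1 a b (hab.relabel u.symm), fun hu => h.2 fun v => ?_⟩
    obtain ⟨b, hb⟩ := hu (u v)
    exact ⟨b, by simpa using hb.relabel u.symm⟩
  · intro _ e
    refine ⟨fun a b hab => ?_, fun _ => by rw [tr_empty]⟩
    rw [tr_empty]
    cases hab with
    | out h => simp [sumEmpty, h]
    | step h h' => rename_i u; exact u.elim
  · intro U _ ih _ e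
    rw [tr_option]
    refine ⟨fun a b hab => (ih (DeligneGL.removeMid e)).1 a b (hab.removeMid.1 (Sum.inl a) rfl), fun hu => ?_⟩
    have h1 : loopAt e = 0 := by
      obtain ⟨b, hb⟩ := hu none
      simp [loopAt, bit, (hb.removeMid.2 rfl).1]
    rw [h1, (ih (DeligneGL.removeMid e)).2]
    intro u
    obtain ⟨b, hb⟩ := hu (some u)
    exact ⟨b, hb.removeMid.1 _ rfl⟩

theorem act_refl (t : (A ≃ B) × ℕ) : act (Equiv.refl A) (Equiv.refl B) t = t := rfl

/-- A rearrangement of disjoint unions. -/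
def shuf (A C U : Type) : (A ⊕ C) ⊕ U ≃ (A ⊕ U) ⊕ C where
  toFun := Sum.elim (Sum.elim (fun a => Sum.inl (Sum.inl a)) Sum.inr) (fun u => Sum.inl (Sum.inr u))
  invFun := Sum.elim (Sum.elim (fun a => Sum.inl (Sum.inl a)) Sum.inr) (fun c => Sum.inl (Sum.inr c))
  left_inv := by rintro ((a | c) | u) <;> rfl
  right_inv := by rintro ((a | c) | u) <;> rfl

/-- Adjoin to `e` the edges of a bijection `f` that avoids the middle vertices. -/
def sup (e : A ⊕ U ≃ B ⊕ U) (f : C ≃ C') : (A ⊕ C) ⊕ U ≃ (B ⊕ C') ⊕ U :=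
  (shuf A C U).trans ((sumCongr e f).trans (shuf B C' U).symm)

theorem sup_rl (e : A ⊕ U ≃ B ⊕ U) (f : C ≃ C') (u : U ≃ V) :
    sup (relabel (Equiv.refl A) (Equiv.refl B) u e) f =
      relabel (Equiv.refl _) (Equiv.refl _) u (sup e f) := by
  ext1 x
  rw [rl_apply']
  rcases x with (a | c) | v
  · simp only [sup, trans_apply, shuf, sumCongr_apply, coe_fn_mk, Sum.elim_inl, Sum.map_inl, rl_apply',
      refl_symm, coe_refl, id]
    rcases e (Sum.inl a) with y | y <;> rfl
  · rfl
  · simp only [sup, trans_apply, shuf, sumCongr_apply, coe_fn_mk, Sum.elim_inr, Sum.map_inl, rl_apply',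
      refl_symm, coe_refl, Sum.map_inr]
    rcases e (Sum.inr (u.symm v)) with y | y <;> rfl

theorem rm_sup (e : A ⊕ Option U ≃ B ⊕ Option U) (f : C ≃ C') :
    removeMid (sup e f) = sup (removeMid e) f := by
  have key : ∀ x : A ⊕ Option U, sup e f ((shuf A C _).symm (Sum.inl x)) =
      (shuf B C' _).symm (Sum.inl (e x)) := by intro x; simp [sup]
  have key' : ∀ x : A ⊕ U, sup (removeMid e) f ((shuf A C _).symm (Sum.inl x)) =
      (shuf B C' _).symm (Sum.inl (removeMid e x)) := by intro x; simp [sup]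
  have hu : ∀ x : A ⊕ U, up ((shuf A C _).symm (Sum.inl x)) = (shuf A C _).symm (Sum.inl (up x)) := by
    rintro (x | x) <;> rfl
  have hu' : ∀ x : B ⊕ U, up ((shuf B C' _).symm (Sum.inl x)) = (shuf B C' _).symm (Sum.inl (up x)) := by
    rintro (x | x) <;> rfl
  have hn : (Sum.inr none : (A ⊕ C) ⊕ Option U) = (shuf A C _).symm (Sum.inl (Sum.inr none)) := rfl
  have hn' : (Sum.inr none : (B ⊕ C') ⊕ Option U) = (shuf B C' _).symm (Sum.inl (Sum.inr none)) := rfl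
  ext1 x
  obtain ⟨x, rfl⟩ := (shuf A C _).symm.surjective x
  rcases x with x | c
  · rw [key', rm_eq_iff, hu, hu', hn, hn', key, key]
    simp only [EmbeddingLike.apply_eq_iff_eq, Sum.inl.injEq]
    by_cases h : e (up x) = Sum.inr none
    · exact Or.inl ⟨h, (rm_of_eq e x h).symm⟩
    · exact Or.inr ⟨h, (rm_of_ne e x h).symm⟩
  · rw [rm_eq_iff]
    right
    refine ⟨?_, rfl⟩
    change ¬ (Sum.inl (Sum.inr (f c)) : (B ⊕ C') ⊕ Option U) = _
    simp

theorem lp_sup (e : A ⊕ Option U ≃ B ⊕ Option U) (f : C ≃ C') :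
    loopAt (sup e f) = loopAt e := by
  have hn : (Sum.inr none : (A ⊕ C) ⊕ Option U) = (shuf A C _).symm (Sum.inl (Sum.inr none)) := rfl
  have hn' : (Sum.inr none : (B ⊕ C') ⊕ Option U) = (shuf B C' _).symm (Sum.inl (Sum.inr none)) := rfl
  have key : ∀ x : A ⊕ Option U, sup e f ((shuf A C _).symm (Sum.inl x)) =
      (shuf B C' _).symm (Sum.inl (e x)) := by intro x; simp [sup]
  unfold loopAt
  rw [hn, hn', key, EmbeddingLike.apply_eq_iff_eq, Sum.inl.injEq]

theorem tr_sup [Finite U] (e : A ⊕ U ≃ B ⊕ U) (f : C ≃ C') :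
    contract (sup e f) = (sumCongr (contract e).1 f, (contract e).2) := by
  revert e
  refine Finite.induction_empty_option (P := fun U => ∀ [Finite U] (e : A ⊕ U ≃ B ⊕ U),
    contract (sup e f) = (sumCongr (contract e).1 f, (contract e).2)) ?_ ?_ ?_ U
  · intro U V u ih _ e
    have : Finite U := Finite.of_equiv V u.symm
    have h := ih (relabel (Equiv.refl A) (Equiv.refl B) u.symm e)
    rwa [sup_rl, tr_rl, tr_rl, act_refl, act_refl] at h
  · intro _ e
    rw [tr_empty, tr_empty]
    refine Prod.ext ?_ rfl
    ext1 x
    rcases x with a | c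
    · simp only [sup, shuf, trans_apply, sumCongr_apply, coe_fn_mk, sumEmpty_symm_apply, Sum.elim_inl, Sum.map_inl]
      rcases e (Sum.inl a) with y | y
      · rfl
      · exact y.elim
    · rfl
  · intro U _ ih _ e
    rw [tr_option, tr_option, rm_sup, lp_sup, ih]

/-- Reassociate `A ⊔ (U ⊔ V) ≃ B ⊔ (U ⊔ V)`. -/
def reass (e : A ⊕ (U ⊕ V) ≃ B ⊕ (U ⊕ V)) : (A ⊕ U) ⊕ V ≃ (B ⊕ U) ⊕ V :=
  (sumAssoc A U V).trans (e.trans (sumAssoc B U V).symm)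

theorem reass_apply (e : A ⊕ (U ⊕ V) ≃ B ⊕ (U ⊕ V)) (x : A ⊕ (U ⊕ V)) :
    reass e ((sumAssoc A U V).symm x) = (sumAssoc B U V).symm (e x) := by simp [reass]

theorem reass_rl {U' V' : Type} (e : A ⊕ (U ⊕ V) ≃ B ⊕ (U ⊕ V)) (u : U ≃ U') (v : V ≃ V') :
    reass (relabel (Equiv.refl A) (Equiv.refl B) (sumCongr u v) e) =
      relabel (sumCongr (Equiv.refl A) u) (sumCongr (Equiv.refl B) u) v (reass e) := by
  have h : ∀ x : A ⊕ (U ⊕ V), (sumAssoc A U' V').symm (Sum.map (Equiv.refl A) (sumCongr u v) x) =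
    Sum.map (sumCongr (Equiv.refl A) u) v ((sumAssoc A U V).symm x) := by
    rintro (x | x | x) <;> rfl
  have h' : ∀ x : B ⊕ (U ⊕ V), (sumAssoc B U' V').symm (Sum.map (Equiv.refl B) (sumCongr u v) x) =
    Sum.map (sumCongr (Equiv.refl B) u) v ((sumAssoc B U V).symm x) := by
    rintro (x | x | x) <;> rfl
  ext1 x
  obtain ⟨x, rfl⟩ := (sumAssoc A U' V').symm.surjective x
  obtain ⟨x, rfl⟩ := (sumCongr (Equiv.refl A) (sumCongr u v)).surjective x
  rw [sumCongr_apply, reass_apply, rl_apply, h, h', rl_apply, reass_apply]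

theorem tr_sum [Finite U] [Finite V] (e : A ⊕ (U ⊕ V) ≃ B ⊕ (U ⊕ V)) :
    contract e = ((contract (contract (reass e)).1).1, (contract (contract (reass e)).1).2 + (contract (reass e)).2) := by
  revert e
  refine Finite.induction_empty_option (P := fun V => ∀ [Finite V] (e : A ⊕ (U ⊕ V) ≃ B ⊕ (U ⊕ V)),
    contract e = ((contract (contract (reass e)).1).1, (contract (contract (reass e)).1).2 + (contract (reass e)).2)) ?_ ?_ ?_ V
  · intro V V' v ih _ e
    have : Finite V := Finite.of_equiv V' v.symm
    have h := ih (relabel (Equiv.refl A) (Equiv.refl B) (sumCongr (Equiv.refl U) v.symm) e)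
    rw [reass_rl, sumCongr_refl, sumCongr_refl, tr_rl, tr_rl, act_refl, act_refl] at h
    exact h
  · intro _ e
    rw [tr_empty (reass e)]
    simp only [add_zero]
    have h : (sumEmpty (A ⊕ U) PEmpty).symm.trans ((reass e).trans (sumEmpty (B ⊕ U) PEmpty)) =
        relabel (Equiv.refl A) (Equiv.refl B) (sumEmpty U PEmpty) e := by
      ext1 x
      rw [rl_apply']
      rcases x with x | x
      · simp only [trans_apply, reass, sumEmpty_symm_apply, sumAssoc_apply_inl_inl, Sum.map_inl, refl_symm, coe_refl, id]
        rcases e (Sum.inl x) with y | y | y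
        · rfl
        · rfl
        · exact y.elim
      · simp only [trans_apply, reass, sumEmpty_symm_apply, sumAssoc_apply_inl_inr, Sum.map_inr]
        rcases e (Sum.inr (Sum.inl x)) with y | y | y
        · rfl
        · rfl
        · exact y.elim
    rw [h, tr_rl, act_refl]
  · intro V _ ih _ e
    have a1 : ∀ x : A ⊕ (U ⊕ V), up ((sumAssoc A U V).symm x) =
        (sumAssoc A U (Option V)).symm (Sum.map (Equiv.refl A).symm (optOut U V).symm (up x)) := by
      rintro (x | x | x) <;> rfl
    have a2 : ∀ x : B ⊕ (U ⊕ V), Sum.map (Equiv.refl B) (optOut U V)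
        (sumAssoc B U (Option V) (up ((sumAssoc B U V).symm x))) = up x := by
      rintro (x | x | x) <;> rfl
    have a3 : ∀ (y : B ⊕ (U ⊕ Option V)) (z : (B ⊕ U) ⊕ Option V),
        (sumAssoc B U (Option V)).symm y = z ↔ Sum.map (Equiv.refl B) (optOut U V) y =
          Sum.map (Equiv.refl B) (optOut U V) (sumAssoc B U (Option V) z) := by
      intro y z
      rw [← sumCongr_apply, ← sumCongr_apply, (sumCongr (Equiv.refl B) (optOut U V)).injective.eq_iff, symm_apply_eq]
    have a4 : (Sum.inr none : (A ⊕ U) ⊕ Option V) = (sumAssoc A U (Option V)).symm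
        (Sum.map (Equiv.refl A).symm (optOut U V).symm (Sum.inr none)) := rfl
    have a5 : Sum.map (Equiv.refl B) (optOut U V)
        (sumAssoc B U (Option V) (Sum.inr none)) = Sum.inr none := rfl
    have h1 : removeMid (reass e) = reass (removeMid (relabel (Equiv.refl A) (Equiv.refl B) (optOut U V) e)) := by
      ext1 x
      obtain ⟨x, rfl⟩ := (sumAssoc A U V).symm.surjective x
      rw [reass_apply, rm_eq_iff, a1, reass_apply, a3, a3, a4, reass_apply, a3, a2, a5,
        ← rl_apply', ← rl_apply']
      generalize relabel (Equiv.refl A) (Equiv.refl B) (optOut U V) e = e'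
      by_cases h : e' (up x) = Sum.inr none
      · exact Or.inl ⟨h, (rm_of_eq e' x h).symm⟩
      · exact Or.inr ⟨h, (rm_of_ne e' x h).symm⟩
    have h2 : loopAt (reass e) = loopAt (relabel (Equiv.refl A) (Equiv.refl B) (optOut U V) e) := by
      unfold loopAt
      rw [a4, reass_apply, a3, a5, ← rl_apply']
    rw [tr_option (reass e), h1, h2, ← act_refl (contract e), ← tr_rl _ _ (optOut U V), tr_option, ih]
    simp only [add_assoc]

/-- Interchange of the two middle terms. -/
def mid (A B C D : Type) : (A ⊕ B) ⊕ (C ⊕ D) ≃ (A ⊕ C) ⊕ (B ⊕ D) where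
  toFun := Sum.elim (Sum.elim (fun x => Sum.inl (Sum.inl x)) fun x => Sum.inr (Sum.inl x))
    (Sum.elim (fun x => Sum.inl (Sum.inr x)) fun x => Sum.inr (Sum.inr x))
  invFun := Sum.elim (Sum.elim (fun x => Sum.inl (Sum.inl x)) fun x => Sum.inr (Sum.inl x))
    (Sum.elim (fun x => Sum.inl (Sum.inr x)) fun x => Sum.inr (Sum.inr x))
  left_inv := by rintro ((x | x) | x | x) <;> rfl
  right_inv := by rintro ((x | x) | x | x) <;> rfl

/-- The disjoint union of two systems of edges. -/
def both (e : A ⊕ U ≃ B ⊕ U) (e' : A' ⊕ V ≃ B' ⊕ V) : (A ⊕ A') ⊕ (U ⊕ V) ≃ (B ⊕ B') ⊕ (U ⊕ V) :=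
  (mid A A' U V).trans ((sumCongr e e').trans (mid B B' U V).symm)

theorem tr_both [Finite U] [Finite V] (e : A ⊕ U ≃ B ⊕ U) (e' : A' ⊕ V ≃ B' ⊕ V) :
    contract (both e e') = (sumCongr (contract e).1 (contract e').1, (contract e).2 + (contract e').2) := by
  let f : ∀ X X' : Type, X' ⊕ (X ⊕ U) ≃ (X ⊕ X') ⊕ U := fun X X' =>
    (sumComm X' (X ⊕ U)).trans (shuf X X' U).symm
  have h1 : reass (both e e') = relabel (f A A') (f B B') (Equiv.refl V) (sup e' e) := by
    ext1 x
    obtain ⟨x, rfl⟩ := (sumCongr (f A A') (Equiv.refl V)).surjective x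
    rw [sumCongr_apply, rl_apply]
    rcases x with (x | x | x) | x
    · rcases h : e' (Sum.inl x) with y | y <;> simp [f, reass, both, sup, shuf, mid, h]
    · rcases h : e (Sum.inl x) with y | y <;> simp [f, reass, both, sup, shuf, mid, h]
    · rcases h : e (Sum.inr x) with y | y <;> simp [f, reass, both, sup, shuf, mid, h]
    · rcases h : e' (Sum.inr x) with y | y <;> simp [f, reass, both, sup, shuf, mid, h]
  have h2 : (f A A').symm.trans ((sumCongr (contract e').1 e).trans (f B B')) = sup e (contract e').1 := by
    ext1 x
    rcases x with (x | x) | x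
    · rcases h : e (Sum.inl x) with y | y <;> simp [f, sup, shuf, h]
    · simp [f, sup, shuf]
    · rcases h : e (Sum.inr x) with y | y <;> simp [f, sup, shuf, h]
  rw [tr_sum, h1, tr_rl, tr_sup]
  simp only [act, h2, tr_sup]

end Trace

/-- A finite row of vertices: `P` is the set of black ones, `N` the set of white ones. -/
structure Row where
  P : Type
  N : Type
  [finP : Finite P]
  [finN : Finite N]

attribute [instance] Row.finP Row.finN

/-- Diagrams with bottom row `a` and top row `b`. Such a diagram is a perfect matching of all the
vertices in which an edge joins vertices of different colours if and only if they lie in the same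
row. Equivalently, every edge joins an element of `{black bottom} ⊔ {white top}` to an element of
`{black top} ⊔ {white bottom}`, so the matching is a bijection between these two sets. -/
abbrev Diagram (a b : Row) : Type := a.P ⊕ b.N ≃ b.P ⊕ a.N

variable {a b c d a' b' c' : Row}

/-- A rearrangement of disjoint unions. -/
def exR (A B C D : Type) : (A ⊕ B) ⊕ (C ⊕ D) ≃ (A ⊕ D) ⊕ (C ⊕ B) where
  toFun := Sum.elim (Sum.elim (fun x => Sum.inl (Sum.inl x)) fun x => Sum.inr (Sum.inr x))
    (Sum.elim (fun x => Sum.inr (Sum.inl x)) fun x => Sum.inl (Sum.inr x))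
  invFun := Sum.elim (Sum.elim (fun x => Sum.inl (Sum.inl x)) fun x => Sum.inr (Sum.inr x))
    (Sum.elim (fun x => Sum.inr (Sum.inl x)) fun x => Sum.inl (Sum.inr x))
  left_inv := by rintro ((x | x) | x | x) <;> rfl
  right_inv := by rintro ((x | x) | x | x) <;> rfl

/-- A rearrangement of disjoint unions. -/
def exL (A B C D : Type) : (A ⊕ B) ⊕ (C ⊕ D) ≃ (C ⊕ B) ⊕ (A ⊕ D) where
  toFun := Sum.elim (Sum.elim (fun x => Sum.inr (Sum.inl x)) fun x => Sum.inl (Sum.inr x))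
    (Sum.elim (fun x => Sum.inl (Sum.inl x)) fun x => Sum.inr (Sum.inr x))
  invFun := Sum.elim (Sum.elim (fun x => Sum.inr (Sum.inl x)) fun x => Sum.inl (Sum.inr x))
    (Sum.elim (fun x => Sum.inl (Sum.inl x)) fun x => Sum.inr (Sum.inr x))
  left_inv := by rintro ((x | x) | x | x) <;> rfl
  right_inv := by rintro ((x | x) | x | x) <;> rfl

/-- The diagram `Y` stacked on top of the diagram `X`, the row `b` being the row of middle
vertices. -/
def join (X : Diagram a b) (Y : Diagram b c) : (a.P ⊕ c.N) ⊕ (b.P ⊕ b.N) ≃ (c.P ⊕ a.N) ⊕ (b.P ⊕ b.N) :=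
  (exR a.P c.N b.P b.N).trans ((sumCongr X Y).trans (exL b.P a.N c.P b.N))

/-- The composite diagram obtained by stacking `Y` on top of `X` and restricting to the outer rows,
together with the number of closed loops removed. -/
noncomputable def comp (X : Diagram a b) (Y : Diagram b c) : Diagram a c × ℕ := contract (join X Y)

/-- The diagram whose edges join each bottom vertex to its image under the given bijections. -/
def ofIso (f : a.P ≃ b.P) (g : a.N ≃ b.N) : Diagram a b := sumCongr f g.symm

theorem comp_ofIso (X : Diagram a b) (f : b.P ≃ c.P) (g : b.N ≃ c.N) :
    comp X (ofIso f g) =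
      ((sumCongr (Equiv.refl _) g.symm).trans (X.trans (sumCongr f (Equiv.refl _))), 0) := by
  have hU : ∀ u : b.P, Exit (join X (ofIso f g)) (Sum.inr (Sum.inl u)) (Sum.inl (f u)) :=
    fun u => Exit.out rfl
  have hN : ∀ (n : b.N), Exit (join X (ofIso f g)) (Sum.inr (Sum.inr n))
      (sumCongr f (Equiv.refl _) (X (Sum.inr n))) := by
    intro n
    rcases h : X (Sum.inr n) with y | y
    · exact Exit.step (u := Sum.inl y) (by simp [join, exR, exL, h]) (hU y)
    · exact Exit.out (by simp [join, exR, exL, h])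
  have hl : ∀ x, Exit (join X (ofIso f g)) (Sum.inl x)
      (((sumCongr (Equiv.refl _) g.symm).trans (X.trans (sumCongr f (Equiv.refl _)))) x) := by
    rintro (x | x)
    · rcases h : X (Sum.inl x) with y | y
      · refine Exit.step (u := Sum.inl y) (by simp [join, exR, exL, h]) ?_
        simpa [h] using hU y
      · exact Exit.out (by simp [join, exR, exL, h])
    · refine Exit.step (u := Sum.inr (g.symm x)) (by simp [join, exR, exL, ofIso]) ?_
      simpa using hN (g.symm x)
  refine Prod.ext ?_ ?_
  · ext1 x
    exact (tr_of_exit _).1 _ _ (hl x)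
  · refine (tr_of_exit _).2 ?_
    rintro (u | u)
    · exact ⟨_, hU u⟩
    · exact ⟨_, hN u⟩

theorem ofIso_comp (f : a.P ≃ b.P) (g : a.N ≃ b.N) (X : Diagram b c) :
    comp (ofIso f g) X =
      ((sumCongr f (Equiv.refl _)).trans (X.trans (sumCongr (Equiv.refl _) g.symm)), 0) := by
  have hU : ∀ u : b.N, Exit (join (ofIso f g) X) (Sum.inr (Sum.inr u)) (Sum.inr (g.symm u)) :=
    fun u => Exit.out rfl
  have hN : ∀ (n : b.P), Exit (join (ofIso f g) X) (Sum.inr (Sum.inl n))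
      (sumCongr (Equiv.refl _) g.symm (X (Sum.inl n))) := by
    intro n
    rcases h : X (Sum.inl n) with y | y
    · exact Exit.out (by simp [join, exR, exL, h])
    · exact Exit.step (u := Sum.inr y) (by simp [join, exR, exL, h]) (hU y)
  have hl : ∀ x, Exit (join (ofIso f g) X) (Sum.inl x)
      (((sumCongr f (Equiv.refl _)).trans (X.trans (sumCongr (Equiv.refl _) g.symm))) x) := by
    rintro (x | x)
    · refine Exit.step (u := Sum.inl (f x)) (by simp [join, exR, exL, ofIso]) ?_
      simpa using hN (f x)
    · rcases h : X (Sum.inr x) with y | y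
      · exact Exit.out (by simp [join, exR, exL, h])
      · refine Exit.step (u := Sum.inr y) (by simp [join, exR, exL, h]) ?_
        simpa [h] using hU y
  refine Prod.ext ?_ ?_
  · ext1 x
    exact (tr_of_exit _).1 _ _ (hl x)
  · refine (tr_of_exit _).2 ?_
    rintro (u | u)
    · exact ⟨_, hN u⟩
    · exact ⟨_, hU u⟩

theorem comp_id (X : Diagram a b) : comp X (ofIso (Equiv.refl _) (Equiv.refl _)) = (X, 0) := by
  rw [comp_ofIso]; simp

theorem id_comp (X : Diagram a b) : comp (ofIso (Equiv.refl _) (Equiv.refl _)) X = (X, 0) := by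
  rw [ofIso_comp]; simp

theorem comp_assoc (X : Diagram a b) (Y : Diagram b c) (Z : Diagram c d) :
    (comp (comp X Y).1 Z).1 = (comp X (comp Y Z).1).1 ∧
      (comp (comp X Y).1 Z).2 + (comp X Y).2 = (comp X (comp Y Z).1).2 + (comp Y Z).2 := by
  let E : (a.P ⊕ d.N) ⊕ ((c.P ⊕ c.N) ⊕ (b.P ⊕ b.N)) ≃ (d.P ⊕ a.N) ⊕ ((c.P ⊕ c.N) ⊕ (b.P ⊕ b.N)) :=
    (sumAssoc _ _ _).symm.trans ((relabel (exR a.P d.N c.P c.N).symm (exL c.P a.N d.P c.N) (Equiv.refl _)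
      (sup (join X Y) Z)).trans (sumAssoc _ _ _))
  let E' : (a.P ⊕ d.N) ⊕ ((b.P ⊕ b.N) ⊕ (c.P ⊕ c.N)) ≃ (d.P ⊕ a.N) ⊕ ((b.P ⊕ b.N) ⊕ (c.P ⊕ c.N)) :=
    (sumAssoc _ _ _).symm.trans ((relabel ((sumComm _ _).trans (exR a.P d.N b.P b.N).symm)
      ((sumComm _ _).trans (exL b.P a.N d.P b.N)) (Equiv.refl _) (sup (join Y Z) X)).trans
      (sumAssoc _ _ _))
  have hE : reass E = relabel (exR a.P d.N c.P c.N).symm (exL c.P a.N d.P c.N) (Equiv.refl _)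
      (sup (join X Y) Z) := by
    ext1 x; simp [E, reass]
  have hE' : reass E' = relabel ((sumComm _ _).trans (exR a.P d.N b.P b.N).symm)
      ((sumComm _ _).trans (exL b.P a.N d.P b.N)) (Equiv.refl _) (sup (join Y Z) X) := by
    ext1 x; simp [E', reass]
  have hEE : E' = relabel (Equiv.refl _) (Equiv.refl _) (sumComm _ _) E := by
    ext1 x
    rw [rl_apply']
    rcases x with (x | x) | (x | x) | (x | x)
    · rcases h : X (Sum.inl x) with y | y <;>
        simp [E, E', rl_apply', sup, shuf, join, exR, exL, h]
    · rcases h : Z (Sum.inr x) with y | y <;>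
        simp [E, E', rl_apply', sup, shuf, join, exR, exL, h]
    · rcases h : Y (Sum.inl x) with y | y <;>
        simp [E, E', rl_apply', sup, shuf, join, exR, exL, h]
    · rcases h : X (Sum.inr x) with y | y <;>
        simp [E, E', rl_apply', sup, shuf, join, exR, exL, h]
    · rcases h : Z (Sum.inl x) with y | y <;>
        simp [E, E', rl_apply', sup, shuf, join, exR, exL, h]
    · rcases h : Y (Sum.inr x) with y | y <;>
        simp [E, E', rl_apply', sup, shuf, join, exR, exL, h]
  have t1 := tr_sum E
  have t2 := tr_sum E'
  rw [hEE, tr_rl, act_refl, ← hEE, t1, hE, hE', tr_rl, tr_rl, tr_sup, tr_sup] at t2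
  have j1 : (act (exR a.P d.N c.P c.N).symm (exL c.P a.N d.P c.N)
      (sumCongr (contract (join X Y)).1 Z, (contract (join X Y)).2)).1 = join (comp X Y).1 Z := rfl
  have j2 : (act ((sumComm _ _).trans (exR a.P d.N b.P b.N).symm)
      ((sumComm _ _).trans (exL b.P a.N d.P b.N))
      (sumCongr (contract (join Y Z)).1 X, (contract (join Y Z)).2)).1 = join X (comp Y Z).1 := by
    ext1 x
    rcases x with (x | x) | (x | x) <;> simp [act, join, exR, comp]
  rw [j1, j2] at t2
  exact Prod.ext_iff.1 t2

/-- Two rows next to each other. -/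
abbrev Row.tensor (a b : Row) : Row := ⟨a.P ⊕ b.P, a.N ⊕ b.N⟩

/-- Two diagrams next to each other. -/
def tens (X : Diagram a b) (Y : Diagram a' b') : Diagram (a.tensor a') (b.tensor b') :=
  (mid a.P a'.P b.N b'.N).trans ((sumCongr X Y).trans (mid b.P b'.P a.N a'.N).symm)

theorem tens_comp (X : Diagram a b) (X' : Diagram a' b') (Y : Diagram b c) (Y' : Diagram b' c') :
    comp (tens X X') (tens Y Y') =
      (tens (comp X Y).1 (comp X' Y').1, (comp X Y).2 + (comp X' Y').2) := by
  have h : join (tens X X') (tens Y Y') = relabel (mid a.P a'.P c.N c'.N).symm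
      (mid c.P c'.P a.N a'.N).symm (mid b.P b'.P b.N b'.N).symm (both (join X Y) (join X' Y')) := by
    ext1 x
    rw [rl_apply']
    rcases x with ((x | x) | (x | x)) | ((x | x) | (x | x))
    · rcases h : X (Sum.inl x) with y | y <;> simp [tens, both, join, exR, exL, mid, h]
    · rcases h : X' (Sum.inl x) with y | y <;> simp [tens, both, join, exR, exL, mid, h]
    · rcases h : Y (Sum.inr x) with y | y <;> simp [tens, both, join, exR, exL, mid, h]
    · rcases h : Y' (Sum.inr x) with y | y <;> simp [tens, both, join, exR, exL, mid, h]
    · rcases h : Y (Sum.inl x) with y | y <;> simp [tens, both, join, exR, exL, mid, h]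
    · rcases h : Y' (Sum.inl x) with y | y <;> simp [tens, both, join, exR, exL, mid, h]
    · rcases h : X (Sum.inr x) with y | y <;> simp [tens, both, join, exR, exL, mid, h]
    · rcases h : X' (Sum.inr x) with y | y <;> simp [tens, both, join, exR, exL, mid, h]
  rw [comp, h, tr_rl, tr_both]
  rfl

section Linear

variable {K : Type u} [Field K] (δ : K)

/-- Rows as objects of a `K`-linear symmetric monoidal category with morphisms the linear
combinations of diagrams. It is used to construct the skeleton category `Rep0` below. -/
structure LinRow (δ : K) : Type 1 where
  ob : Row

variable {a b c d a' b' c' : Row}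

/-- The bilinear composition of linear combinations of diagrams: the composite of two diagrams is
`δ ^ ℓ` times the stacked diagram, where `ℓ` is the number of closed loops removed. -/
noncomputable def compL (a b c : Row) :
    (Diagram a b →₀ K) →ₗ[K] (Diagram b c →₀ K) →ₗ[K] (Diagram a c →₀ K) :=
  Finsupp.linearCombination K fun X => Finsupp.linearCombination K fun Y =>
    Finsupp.single (comp X Y).1 (δ ^ (comp X Y).2)

/-- The bilinear extension of `tens`. -/
noncomputable def tensL (a b a' b' : Row) :
    (Diagram a b →₀ K) →ₗ[K] (Diagram a' b' →₀ K) →ₗ[K] (Diagram (a.tensor a') (b.tensor b') →₀ K) :=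
  Finsupp.linearCombination K fun X => Finsupp.linearCombination K fun Y =>
    Finsupp.single (tens X Y) 1

theorem compL_single (X : Diagram a b) (Y : Diagram b c) (x y : K) :
    compL δ a b c (Finsupp.single X x) (Finsupp.single Y y) =
      Finsupp.single (comp X Y).1 (x * y * δ ^ (comp X Y).2) := by
  rw [compL, Finsupp.linearCombination_single, LinearMap.smul_apply,
    Finsupp.linearCombination_single, Finsupp.smul_single, Finsupp.smul_single, smul_eq_mul,
    smul_eq_mul, mul_assoc]

theorem tensL_single (X : Diagram a b) (Y : Diagram a' b') (x y : K) :
    tensL a b a' b' (Finsupp.single X x) (Finsupp.single Y y) =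
      Finsupp.single (tens X Y) (x * y) := by
  rw [tensL, Finsupp.linearCombination_single, LinearMap.smul_apply,
    Finsupp.linearCombination_single, Finsupp.smul_single, Finsupp.smul_single, smul_eq_mul,
    smul_eq_mul, mul_one]

/-- The diagram `ofIso f g` as a linear combination of diagrams. -/
noncomputable def isoL (f : a.P ≃ b.P) (g : a.N ≃ b.N) : Diagram a b →₀ K :=
  Finsupp.single (ofIso f g) 1

theorem compL_assoc (f : Diagram a b →₀ K) (g : Diagram b c →₀ K) (h : Diagram c d →₀ K) :
    compL δ a c d (compL δ a b c f g) h = compL δ a b d f (compL δ b c d g h) := by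
  induction f using Finsupp.induction_linear with
  | zero => simp
  | add f f' hf hf' => simp [hf, hf']
  | single X x =>
    induction g using Finsupp.induction_linear with
    | zero => simp
    | add f f' hf hf' => simp [hf, hf']
    | single Y y =>
      induction h using Finsupp.induction_linear with
      | zero => simp
      | add f f' hf hf' => simp [hf, hf']
      | single Z z =>
        simp only [compL_single]
        rw [(comp_assoc X Y Z).1]
        congr 1
        have := congrArg (δ ^ ·) (comp_assoc X Y Z).2
        simp only [pow_add] at this
        linear_combination (x * y * z) * this

theorem compL_iso (f : Diagram a b →₀ K) (p : b.P ≃ c.P) (n : b.N ≃ c.N) :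
    compL δ a b c f (isoL p n) = Finsupp.mapDomain (fun X =>
      (sumCongr (Equiv.refl _) n.symm).trans (X.trans (sumCongr p (Equiv.refl _)))) f := by
  induction f using Finsupp.induction_linear with
  | zero => simp
  | add f f' hf hf' => simp [hf, hf', Finsupp.mapDomain_add]
  | single X x => simp [isoL, compL_single, comp_ofIso]

theorem iso_compL (f : Diagram b c →₀ K) (p : a.P ≃ b.P) (n : a.N ≃ b.N) :
    compL δ a b c (isoL p n) f = Finsupp.mapDomain (fun X =>
      (sumCongr p (Equiv.refl _)).trans (X.trans (sumCongr (Equiv.refl _) n.symm))) f := by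
  induction f using Finsupp.induction_linear with
  | zero => simp
  | add f f' hf hf' => simp [hf, hf', Finsupp.mapDomain_add]
  | single X x => simp [isoL, compL_single, ofIso_comp]

theorem compL_id (f : Diagram a b →₀ K) :
    compL δ a b b f (isoL (Equiv.refl b.P) (Equiv.refl b.N)) = f := by
  rw [compL_iso]
  refine Eq.trans (congrArg (fun t => Finsupp.mapDomain t f) ?_) Finsupp.mapDomain_id
  funext X
  simp

theorem id_compL (f : Diagram a b →₀ K) :
    compL δ a a b (isoL (Equiv.refl a.P) (Equiv.refl a.N)) f = f := by
  rw [iso_compL]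
  refine Eq.trans (congrArg (fun t => Finsupp.mapDomain t f) ?_) Finsupp.mapDomain_id
  funext X
  simp

noncomputable instance : Category.{u} (LinRow δ) where
  Hom a b := Diagram a.ob b.ob →₀ K
  id a := isoL (Equiv.refl a.ob.P) (Equiv.refl a.ob.N)
  comp f g := compL δ _ _ _ f g
  id_comp f := id_compL δ f
  comp_id f := compL_id δ f
  assoc f g h := compL_assoc δ f g h

noncomputable instance homGroup (a b : LinRow δ) : AddCommGroup (a ⟶ b) :=
  inferInstanceAs (AddCommGroup (Diagram a.ob b.ob →₀ K))

noncomputable instance homModule (a b : LinRow δ) : Module K (a ⟶ b) :=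
  inferInstanceAs (Module K (Diagram a.ob b.ob →₀ K))

theorem compL_add_left (f f' : Diagram a b →₀ K) (g : Diagram b c →₀ K) :
    compL δ a b c (f + f') g = compL δ a b c f g + compL δ a b c f' g := by
  rw [map_add, LinearMap.add_apply]

theorem compL_smul_left (r : K) (f : Diagram a b →₀ K) (g : Diagram b c →₀ K) :
    compL δ a b c (r • f) g = r • compL δ a b c f g := by
  rw [map_smul, LinearMap.smul_apply]

theorem compL_add_right (f : Diagram a b →₀ K) (g g' : Diagram b c →₀ K) :
    compL δ a b c f (g + g') = compL δ a b c f g + compL δ a b c f g' := map_add _ _ _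

theorem compL_smul_right (f : Diagram a b →₀ K) (r : K) (g : Diagram b c →₀ K) :
    compL δ a b c f (r • g) = r • compL δ a b c f g := map_smul _ _ _

noncomputable instance : Preadditive (LinRow δ) where
  add_comp a b c f f' g := by exact compL_add_left (a := a.ob) (b := b.ob) (c := c.ob) δ f f' g
  comp_add a b c f g g' := by exact compL_add_right (a := a.ob) (b := b.ob) (c := c.ob) δ f g g'

noncomputable instance : Linear K (LinRow δ) where
  smul_comp a b c r f g := by exact compL_smul_left (a := a.ob) (b := b.ob) (c := c.ob) δ r f g
  comp_smul a b c f r g := by exact compL_smul_right (a := a.ob) (b := b.ob) (c := c.ob) δ f r g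

theorem iso_comp_iso (p : a.P ≃ b.P) (n : a.N ≃ b.N) (p' : b.P ≃ c.P) (n' : b.N ≃ c.N) :
    compL δ a b c (isoL p n) (isoL p' n') = isoL (p.trans p') (n.trans n') := by
  rw [compL_iso]
  simp only [isoL, Finsupp.mapDomain_single]
  congr 1
  ext1 x
  rcases x with x | x <;> simp [ofIso]

/-- The isomorphism of rows given by colour preserving bijections. -/
noncomputable def isoOf {a b : LinRow δ} (p : a.ob.P ≃ b.ob.P) (n : a.ob.N ≃ b.ob.N) : a ≅ b where
  hom := isoL p n
  inv := isoL p.symm n.symm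
  hom_inv_id := by
    refine (iso_comp_iso δ p n p.symm n.symm).trans ?_
    rw [Equiv.self_trans_symm, Equiv.self_trans_symm]
    rfl
  inv_hom_id := by
    refine (iso_comp_iso δ p.symm n.symm p n).trans ?_
    rw [Equiv.symm_trans_self, Equiv.symm_trans_self]
    rfl

theorem tens_iso (p : a.P ≃ b.P) (n : a.N ≃ b.N) (p' : a'.P ≃ b'.P) (n' : a'.N ≃ b'.N) :
    tensL a b a' b' (isoL p n) (isoL p' n') =
      (isoL (a := a.tensor a') (b := b.tensor b') (sumCongr p p') (sumCongr n n') :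
        Diagram (a.tensor a') (b.tensor b') →₀ K) := by
  simp only [isoL, tensL_single, mul_one]
  congr 1
  ext1 x
  rcases x with (x | x) | (x | x) <;> simp [ofIso, tens, mid]

theorem tensL_comp (f : Diagram a b →₀ K) (f' : Diagram a' b' →₀ K) (g : Diagram b c →₀ K) (g' : Diagram b' c' →₀ K) :
    compL δ _ _ _ (tensL a b a' b' f f') (tensL b c b' c' g g') =
      tensL a c a' c' (compL δ a b c f g) (compL δ a' b' c' f' g') := by
  induction f using Finsupp.induction_linear with
  | zero => simp
  | add f f' hf hf' => simp [hf, hf']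
  | single X x =>
  induction f' using Finsupp.induction_linear with
  | zero => simp
  | add f f' hf hf' => simp [hf, hf']
  | single Y y =>
  induction g using Finsupp.induction_linear with
  | zero => simp
  | add f f' hf hf' => simp [hf, hf']
  | single Z z =>
  induction g' using Finsupp.induction_linear with
  | zero => simp
  | add f f' hf hf' => simp [hf, hf']
  | single W w =>
    simp only [compL_single, tensL_single]
    rw [tens_comp]
    simp only [pow_add]
    congr 1
    ring

theorem tens_id' (a b : Row) : tensL a a b b (isoL (Equiv.refl a.P) (Equiv.refl a.N))
    (isoL (Equiv.refl b.P) (Equiv.refl b.N)) =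
      (isoL (a := a.tensor b) (b := a.tensor b) (Equiv.refl _) (Equiv.refl _) :
        Diagram (a.tensor b) (a.tensor b) →₀ K) := by
  rw [tens_iso, sumCongr_refl, sumCongr_refl]

/-- The empty row. -/
abbrev Row.one : Row := ⟨Empty, Empty⟩

noncomputable instance : MonoidalCategoryStruct (LinRow δ) where
  tensorObj a b := ⟨a.ob.tensor b.ob⟩
  whiskerLeft a b b' f := tensL a.ob a.ob b.ob b'.ob (isoL (Equiv.refl _) (Equiv.refl _)) f
  whiskerRight {a a'} f b := tensL a.ob a'.ob b.ob b.ob f (isoL (Equiv.refl _) (Equiv.refl _))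
  tensorHom {a a' b b'} f g := tensL a.ob a'.ob b.ob b'.ob f g
  tensorUnit := ⟨Row.one⟩
  associator a b c := isoOf δ (sumAssoc _ _ _) (sumAssoc _ _ _)
  leftUnitor a := isoOf δ (emptySum _ _) (emptySum _ _)
  rightUnitor a := isoOf δ (sumEmpty _ _) (sumEmpty _ _)

variable {δ}

theorem nat_assoc (f : Diagram a a' →₀ K) (g : Diagram b b' →₀ K) (h : Diagram c c' →₀ K) :
    compL δ ((a.tensor b).tensor c) ((a'.tensor b').tensor c') (a'.tensor (b'.tensor c'))
      (tensL (a.tensor b) (a'.tensor b') c c' (tensL a a' b b' f g) h)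
      (isoL (sumAssoc _ _ _) (sumAssoc _ _ _)) =
    compL δ ((a.tensor b).tensor c) (a.tensor (b.tensor c)) (a'.tensor (b'.tensor c'))
      (isoL (sumAssoc _ _ _) (sumAssoc _ _ _))
      (tensL a a' (b.tensor c) (b'.tensor c') f (tensL b b' c c' g h)) := by
  rw [compL_iso, iso_compL]
  induction f using Finsupp.induction_linear with
  | zero => simp
  | add f f' hf hf' => simp only [map_add, LinearMap.add_apply, Finsupp.mapDomain_add, hf, hf']
  | single X x =>
  induction g using Finsupp.induction_linear with
  | zero => simp
  | add f f' hf hf' => simp only [map_add, LinearMap.add_apply, Finsupp.mapDomain_add, hf, hf']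
  | single Y y =>
  induction h using Finsupp.induction_linear with
  | zero => simp
  | add f f' hf hf' => simp only [map_add, LinearMap.add_apply, Finsupp.mapDomain_add, hf, hf']
  | single Z z =>
    simp only [tensL_single, Finsupp.mapDomain_single, mul_assoc]
    congr 1
    ext1 x
    rcases x with ((x | x) | x) | (x | x | x)
    · rcases h : X (Sum.inl x) with y | y <;> simp [tens, mid, h]
    · rcases h : Y (Sum.inl x) with y | y <;> simp [tens, mid, h]
    · rcases h : Z (Sum.inl x) with y | y <;> simp [tens, mid, h]
    · rcases h : X (Sum.inr x) with y | y <;> simp [tens, mid, h]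
    · rcases h : Y (Sum.inr x) with y | y <;> simp [tens, mid, h]
    · rcases h : Z (Sum.inr x) with y | y <;> simp [tens, mid, h]

theorem nat_left (f : Diagram a a' →₀ K) :
    compL δ (Row.one.tensor a) (Row.one.tensor a') a'
      (tensL Row.one Row.one a a' (isoL (Equiv.refl _) (Equiv.refl _)) f)
      (isoL (emptySum _ _) (emptySum _ _)) =
    compL δ (Row.one.tensor a) a a' (isoL (emptySum _ _) (emptySum _ _)) f := by
  rw [compL_iso, iso_compL]
  induction f using Finsupp.induction_linear with
  | zero => simp
  | add f f' hf hf' => simp only [map_add, LinearMap.add_apply, Finsupp.mapDomain_add, hf, hf']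
  | single X x =>
    simp only [isoL, tensL_single, Finsupp.mapDomain_single, one_mul]
    congr 1
    ext1 x
    rcases x with (x | x) | x
    · exact x.elim
    · rcases h : X (Sum.inl x) with y | y <;> simp [tens, mid, h]
    · rcases h : X (Sum.inr x) with y | y <;> simp [tens, mid, h]

theorem nat_right (f : Diagram a a' →₀ K) :
    compL δ (a.tensor Row.one) (a'.tensor Row.one) a'
      (tensL a a' Row.one Row.one f (isoL (Equiv.refl _) (Equiv.refl _)))
      (isoL (sumEmpty _ _) (sumEmpty _ _)) =
    compL δ (a.tensor Row.one) a a' (isoL (sumEmpty _ _) (sumEmpty _ _)) f := by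
  rw [compL_iso, iso_compL]
  induction f using Finsupp.induction_linear with
  | zero => simp
  | add f f' hf hf' => simp only [map_add, LinearMap.add_apply, Finsupp.mapDomain_add, hf, hf']
  | single X x =>
    simp only [isoL, tensL_single, Finsupp.mapDomain_single, mul_one]
    congr 1
    ext1 x
    rcases x with (x | x) | x
    · rcases h : X (Sum.inl x) with y | y <;> simp [tens, mid, h]
    · exact x.elim
    · rcases h : X (Sum.inr x) with y | y <;> simp [tens, mid, h]

theorem nat_comm (f : Diagram a a' →₀ K) (g : Diagram b b' →₀ K) :
    compL δ (a.tensor b) (a'.tensor b') (b'.tensor a')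
      (tensL a a' b b' f g) (isoL (sumComm _ _) (sumComm _ _)) =
    compL δ (a.tensor b) (b.tensor a) (b'.tensor a')
      (isoL (sumComm _ _) (sumComm _ _)) (tensL b b' a a' g f) := by
  rw [compL_iso, iso_compL]
  induction f using Finsupp.induction_linear with
  | zero => simp
  | add f f' hf hf' => simp only [map_add, LinearMap.add_apply, Finsupp.mapDomain_add, hf, hf']
  | single X x =>
  induction g using Finsupp.induction_linear with
  | zero => simp
  | add f f' hf hf' => simp only [map_add, LinearMap.add_apply, Finsupp.mapDomain_add, hf, hf']
  | single Y y =>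
    simp only [tensL_single, Finsupp.mapDomain_single, mul_comm]
    congr 1
    ext1 x
    rcases x with (x | x) | (x | x)
    · rcases h : X (Sum.inl x) with y | y <;> simp [tens, mid, h]
    · rcases h : Y (Sum.inl x) with y | y <;> simp [tens, mid, h]
    · rcases h : Y (Sum.inr x) with y | y <;> simp [tens, mid, h]
    · rcases h : X (Sum.inr x) with y | y <;> simp [tens, mid, h]

theorem isoL_congr {p p' : a.P ≃ b.P} {n n' : a.N ≃ b.N} (h : ∀ x, p x = p' x)
    (h' : ∀ x, n x = n' x) : (isoL p n : Diagram a b →₀ K) = isoL p' n' := by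
  rw [Equiv.ext h, Equiv.ext h']

noncomputable instance : MonoidalCategory (LinRow δ) :=
  MonoidalCategory.ofTensorHom
    (id_tensorHom_id := fun a b => tens_id' a.ob b.ob)
    (id_tensorHom := fun _ _ _ _ => rfl)
    (tensorHom_id := fun _ _ => rfl)
    (tensorHom_comp_tensorHom := fun f f' g g' => tensL_comp δ f f' g g')
    (associator_naturality := fun f g h => nat_assoc f g h)
    (leftUnitor_naturality := fun f => nat_left f)
    (rightUnitor_naturality := fun f => nat_right f)
    (pentagon := fun a b c d => by
      refine (congrArg₂ (fun s t => compL δ _ _ _ s (compL δ _ _ _ (isoL _ _) t))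
        (tens_iso _ _ _ _) (tens_iso _ _ _ _)).trans ?_
      refine (congrArg (fun s => compL δ _ _ _ _ s) (iso_comp_iso δ _ _ _ _)).trans ?_
      refine (iso_comp_iso δ _ _ _ _).trans (Eq.trans ?_ (iso_comp_iso δ _ _ _ _).symm)
      exact isoL_congr (by rintro (((x | x) | x) | x) <;> rfl)
        (by rintro (((x | x) | x) | x) <;> rfl))
    (triangle := fun a b => by
      refine (congrArg (fun s => compL δ _ _ _ _ s) (tens_iso _ _ _ _)).trans ?_
      refine (iso_comp_iso δ _ _ _ _).trans (Eq.trans ?_ (tens_iso _ _ _ _).symm)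
      exact isoL_congr (by rintro ((x | x) | x) <;> first | rfl | exact x.elim)
        (by rintro ((x | x) | x) <;> first | rfl | exact x.elim))

noncomputable instance : BraidedCategory (LinRow δ) where
  braiding a b := isoOf δ (sumComm _ _) (sumComm _ _)
  braiding_naturality_right a _ _ f := nat_comm (isoL (Equiv.refl a.ob.P) (Equiv.refl a.ob.N)) f
  braiding_naturality_left f b := nat_comm f (isoL (Equiv.refl b.ob.P) (Equiv.refl b.ob.N))
  hexagon_forward a b c := by
    refine (congrArg (fun s => compL δ _ _ _ _ s) (iso_comp_iso δ _ _ _ _)).trans ?_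
    refine (iso_comp_iso δ _ _ _ _).trans (Eq.trans ?_ (congrArg₂
      (fun s t => compL δ _ _ _ s (compL δ _ _ _ (isoL _ _) t))
        (tens_iso _ _ _ _) (tens_iso _ _ _ _)).symm)
    refine Eq.trans ?_ (congrArg (fun s => compL δ _ _ _ _ s) (iso_comp_iso δ _ _ _ _)).symm
    refine Eq.trans ?_ (iso_comp_iso δ _ _ _ _).symm
    exact isoL_congr (by rintro ((x | x) | x) <;> rfl) (by rintro ((x | x) | x) <;> rfl)
  hexagon_reverse a b c := by
    refine (congrArg (fun s => compL δ _ _ _ _ s) (iso_comp_iso δ _ _ _ _)).trans ?_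
    refine (iso_comp_iso δ _ _ _ _).trans (Eq.trans ?_ (congrArg₂
      (fun s t => compL δ _ _ _ s (compL δ _ _ _ (isoL _ _) t))
        (tens_iso _ _ _ _) (tens_iso _ _ _ _)).symm)
    refine Eq.trans ?_ (congrArg (fun s => compL δ _ _ _ _ s) (iso_comp_iso δ _ _ _ _)).symm
    refine Eq.trans ?_ (iso_comp_iso δ _ _ _ _).symm
    exact isoL_congr (by rintro (x | x | x) <;> rfl) (by rintro (x | x | x) <;> rfl)

noncomputable instance : SymmetricCategory (LinRow δ) where
  symmetry a b := by
    refine (iso_comp_iso δ _ _ _ _).trans ?_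
    exact isoL_congr (by rintro (x | x) <;> rfl) (by rintro (x | x) <;> rfl)

end Linear

/-- The two letters `•` (black) and `∘` (white). -/
inductive Letter
  | black
  | white

/-- The positions of the word `w` that carry the letter `c`. -/
abbrev Pos (w : List Letter) (c : Letter) : Type := {i : ℕ // w[i]? = some c}

instance (w : List Letter) (c : Letter) : Finite (Pos w c) :=
  Finite.of_injective (β := Fin w.length)
    (fun i => ⟨i.1, (List.getElem?_eq_some_iff.1 i.2).1⟩)
    fun _ _ h => Subtype.ext (congrArg Fin.val h)

/-- The row of vertices of a word. -/
abbrev wordRow (w : List Letter) : Row := ⟨Pos w .black, Pos w .white⟩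

/-- The positions of a concatenation. -/
def posAppend (u w : List Letter) (c : Letter) : Pos u c ⊕ Pos w c ≃ Pos (u ++ w) c where
  toFun := Sum.elim
    (fun i => ⟨i.1, by
      rw [List.getElem?_append_left (List.getElem?_eq_some_iff.1 i.2).1]; exact i.2⟩)
    (fun i => ⟨u.length + i.1, by
      rw [List.getElem?_append_right (Nat.le_add_right _ _), Nat.add_sub_cancel_left]
      exact i.2⟩)
  invFun i := if h : i.1 < u.length then
      Sum.inl ⟨i.1, (List.getElem?_append_left h).symm.trans i.2⟩
    else Sum.inr ⟨i.1 - u.length, (List.getElem?_append_right (not_lt.1 h)).symm.trans i.2⟩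
  left_inv := by
    rintro (⟨i, hi⟩ | ⟨i, hi⟩)
    · have := (List.getElem?_eq_some_iff.1 hi).1
      simp [this]
    · simp
  right_inv := by
    rintro ⟨i, hi⟩
    by_cases h : i < u.length
    · simp [h]
    · simp only [h, dite_false, Sum.elim_inr]
      exact Subtype.ext (by simp only; omega)

/-- The empty word has no positions. -/
def posNil (c : Letter) : Empty ≃ Pos [] c where
  toFun := Empty.elim
  invFun i := by simpa using i.2
  left_inv i := i.elim
  right_inv i := by simpa using i.2

variable {K : Type u} [Field K] (δ : K)

/-- The skeleton category: objects are the words in `•` and `∘`, the space of morphisms `w ⟶ w'` has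
as basis the diagrams with bottom row `w` and top row `w'`, composition is stacking with closed loops
evaluated to `δ`. The tensor product is concatenation of words and juxtaposition of diagrams, and the
symmetric braiding is the diagram that crosses two words. -/
structure Rep0 (δ : K) : Type where
  word : List Letter

namespace Rep0

variable {δ}

noncomputable instance : Category.{u} (Rep0 δ) where
  Hom w w' := Diagram (wordRow w.word) (wordRow w'.word) →₀ K
  id w := isoL (Equiv.refl _) (Equiv.refl _)
  comp f g := compL δ _ _ _ f g
  id_comp f := id_compL δ f
  comp_id f := compL_id δ f
  assoc f g h := compL_assoc δ f g h

noncomputable instance homGroup (a b : Rep0 δ) : AddCommGroup (a ⟶ b) :=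
  inferInstanceAs (AddCommGroup (Diagram (wordRow a.word) (wordRow b.word) →₀ K))

noncomputable instance homModule (a b : Rep0 δ) : Module K (a ⟶ b) :=
  inferInstanceAs (Module K (Diagram (wordRow a.word) (wordRow b.word) →₀ K))

noncomputable instance : Preadditive (Rep0 δ) where
  add_comp a b c f f' g := by
    exact compL_add_left (a := wordRow a.word) (b := wordRow b.word) (c := wordRow c.word) δ f f' g
  comp_add a b c f g g' := by
    exact compL_add_right (a := wordRow a.word) (b := wordRow b.word) (c := wordRow c.word) δ f g g'

noncomputable instance : Linear K (Rep0 δ) where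
  smul_comp a b c r f g := by
    exact compL_smul_left (a := wordRow a.word) (b := wordRow b.word) (c := wordRow c.word) δ r f g
  comp_smul a b c f r g := by
    exact compL_smul_right (a := wordRow a.word) (b := wordRow b.word) (c := wordRow c.word) δ f r g

/-- A word regarded as a row of vertices; this is the identity on morphisms. -/
def toLinRow : Rep0 δ ⥤ LinRow δ where
  obj w := ⟨wordRow w.word⟩
  map f := f

instance : (toLinRow (δ := δ)).Full where
  map_surjective f := ⟨f, rfl⟩

instance : (toLinRow (δ := δ)).Faithful where
  map_injective h := h

/-- The row of a concatenation consists of the two rows next to each other. -/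
noncomputable def toLinRowTensor (a b : Rep0 δ) :
    toLinRow.obj a ⊗ toLinRow.obj b ≅ toLinRow.obj ⟨a.word ++ b.word⟩ :=
  isoOf δ (posAppend _ _ _) (posAppend _ _ _)

/-- The row of the empty word is empty. -/
noncomputable def toLinRowUnit : 𝟙_ (LinRow δ) ≅ toLinRow.obj ⟨[]⟩ :=
  isoOf δ (posNil _) (posNil _)

noncomputable instance : MonoidalCategoryStruct (Rep0 δ) where
  tensorObj a b := ⟨a.word ++ b.word⟩
  whiskerLeft a b b' f :=
    toLinRow.preimage ((toLinRowTensor a b).inv ≫ (toLinRow.obj a ◁ toLinRow.map f) ≫ (toLinRowTensor a b').hom)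
  whiskerRight {a a'} f b :=
    toLinRow.preimage ((toLinRowTensor a b).inv ≫ (toLinRow.map f ▷ toLinRow.obj b) ≫ (toLinRowTensor a' b).hom)
  tensorHom {a a' b b'} f g :=
    toLinRow.preimage ((toLinRowTensor a b).inv ≫ (toLinRow.map f ⊗ₘ toLinRow.map g) ≫ (toLinRowTensor a' b').hom)
  tensorUnit := ⟨[]⟩
  associator a b c := toLinRow.preimageIso
    (((toLinRowTensor ⟨a.word ++ b.word⟩ c).symm ≪≫ ((toLinRowTensor a b).symm ⊗ᵢ .refl _)) ≪≫
      α_ (toLinRow.obj a) (toLinRow.obj b) (toLinRow.obj c) ≪≫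
      ((.refl _ ⊗ᵢ toLinRowTensor b c) ≪≫ toLinRowTensor a ⟨b.word ++ c.word⟩))
  leftUnitor a := toLinRow.preimageIso
    (((toLinRowTensor ⟨[]⟩ a).symm ≪≫ (toLinRowUnit.symm ⊗ᵢ .refl _)) ≪≫ λ_ (toLinRow.obj a))
  rightUnitor a := toLinRow.preimageIso
    (((toLinRowTensor a ⟨[]⟩).symm ≪≫ (.refl _ ⊗ᵢ toLinRowUnit.symm)) ≪≫ ρ_ (toLinRow.obj a))

/-- `toLinRow` preserves all the structure. -/
noncomputable def inducingData : Monoidal.InducingFunctorData (toLinRow (δ := δ)) where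
  μIso := toLinRowTensor
  εIso := toLinRowUnit
  whiskerLeft_eq _ _ _ _ := toLinRow.map_preimage _
  whiskerRight_eq _ _ := toLinRow.map_preimage _
  tensorHom_eq _ _ := toLinRow.map_preimage _
  associator_eq _ _ _ := toLinRow.map_preimage _
  leftUnitor_eq _ := toLinRow.map_preimage _
  rightUnitor_eq _ := toLinRow.map_preimage _

noncomputable instance : MonoidalCategory (Rep0 δ) := Monoidal.induced toLinRow inducingData

noncomputable instance : (toLinRow (δ := δ)).Monoidal := Monoidal.fromInducedMonoidal toLinRow inducingData

noncomputable instance : SymmetricCategory (Rep0 δ) := SymmetricCategory.ofFullyFaithful toLinRow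

end Rep0

/-- Deligne's category `Rep(GL_δ)`: the Karoubi envelope of the additive envelope of the skeleton
category. -/
abbrev RepGL (δ : K) : Type (max 1 u) := Idempotents.Karoubi (Mat_ (Rep0 δ))

/-- The inclusion of the skeleton category in `Rep(GL_δ)`. -/
noncomputable abbrev RepGL.incl (δ : K) : Rep0 δ ⥤ RepGL δ :=
  Mat_.embedding (Rep0 δ) ⋙ Idempotents.toKaroubi _

/-- The image in `Rep(GL_δ)` of an idempotent of the skeleton category. -/
noncomputable def RepGL.image {δ : K} {w : Rep0 δ} (e : w ⟶ w) (he : e ≫ e = e) : RepGL δ where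
  X := (Mat_.embedding (Rep0 δ)).obj w
  p := (Mat_.embedding (Rep0 δ)).map e
  idem := by rw [← Functor.map_comp, he]

/-- The word `•⋯•∘⋯∘` with `r` black and `s` white letters. -/
def mixedWord (r s : ℕ) : List Letter :=
  List.replicate r Letter.black ++ List.replicate s Letter.white

theorem mixedWord_black (r s i : ℕ) : (mixedWord r s)[i]? = some Letter.black ↔ i < r := by
  simp only [mixedWord, List.getElem?_append, List.getElem?_replicate, List.length_replicate]
  split_ifs <;> simp [*]

theorem mixedWord_white (r s i : ℕ) :
    (mixedWord r s)[i]? = some Letter.white ↔ r ≤ i ∧ i < r + s := by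
  simp only [mixedWord, List.getElem?_append, List.getElem?_replicate, List.length_replicate]
  split_ifs <;> simp <;> omega

/-- The black positions of `mixedWord r s`, numbered from left to right. -/
def blackPos (r s : ℕ) : Fin r ≃ Pos (mixedWord r s) Letter.black where
  toFun i := ⟨i.1, (mixedWord_black r s i).2 i.2⟩
  invFun i := ⟨i.1, (mixedWord_black r s i).1 i.2⟩
  left_inv _ := rfl
  right_inv _ := rfl

/-- The white positions of `mixedWord r s`, numbered from left to right. -/
def whitePos (r s : ℕ) : Fin s ≃ Pos (mixedWord r s) Letter.white where
  toFun i := ⟨r + i.1, (mixedWord_white r s _).2 (by omega)⟩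
  invFun i := ⟨i.1 - r, by have := (mixedWord_white r s i).1 i.2; omega⟩
  left_inv i := by simp
  right_inv i := by
    have := (mixedWord_white r s i).1 i.2
    exact Subtype.ext (by simp only; omega)

/-- The Young symmetrizer of `μ`: the sum of `sign q • (p * q)` over the permutations `p` of the cells
that preserve the rows and the permutations `q` that preserve the columns. -/
noncomputable def youngElement (K : Type u) [Field K] (μ : YoungDiagram) :
    MonoidAlgebra K (Perm μ.cells) :=
  open Classical in
  ∑ p : {p : Perm μ.cells // ∀ x, (p x).1.1 = x.1.1},
    ∑ q : {q : Perm μ.cells // ∀ x, (q x).1.2 = x.1.2},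
      MonoidAlgebra.single (p.1 * q.1) ((Perm.sign q.1 : ℤ) : K)

/-- The primitive idempotent of the group algebra that corresponds to `μ`: the Young symmetrizer `c`
divided by the number `n` with `c * c = n • c`, which is the coefficient of `1` in `c * c` since the
coefficient of `1` in `c` is `1`. -/
noncomputable def youngIdem (K : Type u) [Field K] (μ : YoungDiagram) :
    MonoidAlgebra K (Perm μ.cells) :=
  ((youngElement K μ * youngElement K μ).coeff 1)⁻¹ • youngElement K μ

/-- Bipartitions `(λ•, λ∘)`. -/
abbrev Bipartition : Type := YoungDiagram × YoungDiagram

/-- The word `mixedWord r s` as an object of the skeleton category. -/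
abbrev mixedObj (δ : K) (r s : ℕ) : Rep0 δ := ⟨mixedWord r s⟩

/-- The diagram `σ• ⊗ τ∘`, with the cells of the two Young diagrams numbered in some fixed way. -/
noncomputable def permDiagram (l : Bipartition) (σ : Perm l.1.cells) (τ : Perm l.2.cells) :
    Diagram (wordRow (mixedWord l.1.card l.2.card)) (wordRow (mixedWord l.1.card l.2.card)) :=
  ofIso ((l.1.cells.equivFin.trans (blackPos _ _)).permCongr σ)
    ((l.2.cells.equivFin.trans (whitePos _ _)).permCongr τ)

/-- The idempotent `z_λ` of the walled Brauer algebra: the tensor product of the idempotents of the two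
partitions, under `σ ⊗ τ ↦ σ• ⊗ τ∘`. -/
noncomputable def zIdem (δ : K) (l : Bipartition) : End (mixedObj δ l.1.card l.2.card) :=
  open Classical in
  ∑ σ : Perm l.1.cells, ∑ τ : Perm l.2.cells,
    (Finsupp.single (permDiagram l σ τ) ((youngIdem K l.1).coeff σ * (youngIdem K l.2).coeff τ) :
      Diagram (wordRow _) (wordRow _) →₀ K)

/-- The number of edges of a diagram that join the bottom row to the top row. -/
noncomputable def propagating {a b : Row} (X : Diagram a b) : ℕ :=
  Nat.card {x : a.P // (X (Sum.inl x)).isLeft} + Nat.card {x : a.N // (X.symm (Sum.inr x)).isRight}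

/-- The span `J` of the diagrams with less than `r + s` propagating edges, which is the kernel of the
projection of the walled Brauer algebra onto the group algebra of `Σ_r × Σ_s`. -/
noncomputable def nonPropagating (δ : K) (r s : ℕ) : Submodule K (End (mixedObj δ r s)) :=
  Submodule.span K {f | ∃ X : Diagram (wordRow (mixedWord r s)) (wordRow (mixedWord r s)),
    propagating X < r + s ∧ f = (Finsupp.single X 1 : _ →₀ K)}

/-- Primitive idempotents: nonzero idempotents that are not the sum of two nonzero orthogonal
idempotents. -/
structure IsPrimitive {A : Type*} [Ring A] (e : A) : Prop where
  ne_zero : e ≠ 0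
  idem : e * e = e
  indecomposable : ∀ f g : A, f * f = f → g * g = g → f * g = 0 → g * f = 0 → e = f + g →
    f = 0 ∨ g = 0

/-- `e` is a choice of the idempotent `e_λ`: a member of a decomposition of `z_λ` into mutually
orthogonal primitive idempotents that does not vanish modulo `J`. -/
structure IsELambda (δ : K) (l : Bipartition) (e : End (mixedObj δ l.1.card l.2.card)) : Prop where
  primitive : IsPrimitive e
  exists_decomposition : ∃ (k : ℕ) (f : Fin k → End (mixedObj δ l.1.card l.2.card)),
    (∀ i, IsPrimitive (f i)) ∧ (∀ i j, i ≠ j → f i * f j = 0) ∧ ∑ i, f i = zIdem δ l ∧ ∃ i, f i = e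
  not_mem : e ∉ nonPropagating δ l.1.card l.2.card

/-- `X` is a choice of the object `L(λ)`, that is, isomorphic to the image of a choice of `e_λ`. -/
def IsL (δ : K) (l : Bipartition) (X : RepGL δ) : Prop :=
  ∃ (e : End (mixedObj δ l.1.card l.2.card)) (he : IsELambda δ l e),
    Nonempty (X ≅ RepGL.image e he.primitive.idem)

section Target

variable {T : Type w} [Category.{v} T]

/-- A biproduct decomposition `X = X₁ ⊕ X₂`. -/
structure Biprod [Preadditive T] (X X₁ X₂ : T) where
  i₁ : X₁ ⟶ X
  i₂ : X₂ ⟶ X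
  p₁ : X ⟶ X₁
  p₂ : X ⟶ X₂
  i₁_p₁ : i₁ ≫ p₁ = 𝟙 X₁
  i₂_p₂ : i₂ ≫ p₂ = 𝟙 X₂
  i₁_p₂ : i₁ ≫ p₂ = 0
  i₂_p₁ : i₂ ≫ p₁ = 0
  total : p₁ ≫ i₁ + p₂ ≫ i₂ = 𝟙 X

/-- In each biproduct decomposition of `X` one of the two associated idempotents is zero. This includes
the zero object. -/
def IsIndecomposable [Preadditive T] (X : T) : Prop :=
  ∀ (X₁ X₂ : T) (B : Biprod X X₁ X₂), B.p₁ ≫ B.i₁ = 0 ∨ B.p₂ ≫ B.i₂ = 0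

/-- `W` is a direct summand of `X`. -/
def IsSummand [Preadditive T] (W X : T) : Prop := ∃ W' : T, Nonempty (Biprod X W W')

variable [MonoidalCategory T]

/-- The tensor power `V ⊗ (V ⊗ ⋯ (V ⊗ 𝟙))`. -/
def tpow (V : T) : ℕ → T
  | 0 => 𝟙_ T
  | n + 1 => V ⊗ tpow V n

/-- The mixed tensor power `T(r, s)`, where `Vd` is a dual of `V`. -/
def mixedPow (V Vd : T) (r s : ℕ) : T := tpow V r ⊗ tpow Vd s

/-- The symmetric braiding of `V ⊗ V` applied to the tensor factors number `i` and `i + 1` (counted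
from `0`) of `tpow V n`; the identity if there are no such factors. -/
def braidAt [BraidedCategory T] (V : T) : (n i : ℕ) → (tpow V n ⟶ tpow V n)
  | n + 2, 0 => (α_ V V (tpow V n)).inv ≫ (β_ V V).hom ▷ tpow V n ≫ (α_ V V (tpow V n)).hom
  | n + 1, i + 1 => V ◁ braidAt V n i
  | n, _ => 𝟙 (tpow V n)

/-- `ρ` is the action of the symmetric group on the tensor power `tpow V p` defined by the symmetric
braiding: the transposition of `i` and `i + 1` acts as the braiding of the factors `i` and `i + 1`.
As these transpositions generate the group, `ρ` is unique. -/
def IsBraidAction [SymmetricCategory T] [Preadditive T] [Linear K T] (V : T) (p : ℕ)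
    (ρ : MonoidAlgebra K (Perm (Fin p)) →ₐ[K] End (tpow V p)) : Prop :=
  ∀ (i : ℕ) (hi : i + 1 < p),
    ρ (MonoidAlgebra.of K _ (swap ⟨i, by omega⟩ ⟨i + 1, hi⟩)) = braidAt V p i

end Target

end DeligneGL

open DeligneGL CategoryTheory MonoidalCategory

/-!
# Mixed tensor powers and Deligne's category

**Fullness.** A functor on `RepGL δ` is full once it is full on words (`full_of_full_incl`), because every
object is a retract of a finite sum of words. The letters `•` and `∘` are dual to each other
(`Rep0.exactPairing`), and a monoidal functor respects the bijection between `Hom(∘ ⊗ a, b)` and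
`Hom(a, • ⊗ b)`; so white letters can be moved across until only powers of `•` are left
(`map_surjective_words`). Between different powers of `V` there are no morphisms, and the endomorphisms
of `tpow V p` are generated by braidings of neighbouring factors, which lift (`map_surjective_replicate`).

**The objects `L(λ)`.** Classical facts on Young symmetrizers `y`, namely `y x y ∈ K y`, `y_ν x y_μ = 0` for
different diagrams in one of the two orders, and the fact that the `y_μ` generate the group algebra as
an ideal, carry over to the idempotents `z_λ` of the walled Brauer algebra modulo the ideal `J` of diagrams
with few propagating edges (`zIdem_comp_comp`, `zIdem_comp_comp_mem`, `id_mem_span_zIdem`). Hence a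
decomposition of `z_λ` into primitive idempotents has exactly one member outside `J`. Elements of `J`
factor through shorter words (`nonPropagating_le`), so induction on the length shows that each summand of
`•^r∘^s` with local endomorphism ring is one of the `L(λ)` (`exists_iso_of_retract`), and they are pairwise
non-isomorphic (`IsL.eq_of_iso`).

**Summands in the target.** Endomorphism algebras of words are finite-dimensional, so the image of a primitive
idempotent is a local object, a full functor sends it to zero or to a local object, and idempotents
lift along full functors. A nonzero indecomposable summand of a mixed tensor power is therefore the image of
a primitive idempotent of a word (`IsIndecomposable.exists_iso_map_image`), and a full functor reflects
isomorphism of local objects it does not annihilate (`IsLocalObj.nonempty_iso_of_map`).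
-/

namespace DeligneGL

open Equiv

/-! ### Young symmetrizers -/

section Young

variable {P : Type*} {μ ν : YoungDiagram}

/-- The row of the cell with number `x`. -/
def rowOf (φ : P ≃ μ.cells) (x : P) : ℕ := (φ x).1.1

/-- The column of the cell with number `x`. -/
def colOf (φ : P ≃ μ.cells) (x : P) : ℕ := (φ x).1.2

theorem eq_of_rowOf_colOf (φ : P ≃ μ.cells) {x y : P} (h : rowOf φ x = rowOf φ y)
    (h' : colOf φ x = colOf φ y) : x = y :=
  φ.injective (Subtype.ext (Prod.ext h h'))

/-- The sum of the row indices of the cells. -/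
def rowWeight (μ : YoungDiagram) : ℕ := ∑ x ∈ μ.cells, x.1

theorem sum_cells_eq [Fintype P] {M : Type*} [AddCommMonoid M] (φ : P ≃ μ.cells) (f : ℕ × ℕ → M) :
    ∑ x, f (rowOf φ x, colOf φ x) = ∑ x ∈ μ.cells, f x := by
  rw [← Finset.sum_coe_sort μ.cells f]
  exact Fintype.sum_equiv φ _ _ fun x => rfl

/-- Take the rows of the points of `P` from a numbering of `ν` and the columns from a numbering of `μ`.
If different points always differ in the row or the column, and the weight of `ν` is at most that of
`μ`, then the resulting cells make up `μ`. -/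
theorem image_rowOf_colOf [Fintype P] (φ : P ≃ ν.cells) (ψ : P ≃ μ.cells)
    (H : ∀ x y, rowOf φ x = rowOf φ y → colOf ψ x = colOf ψ y → x = y)
    (hw : rowWeight ν ≤ rowWeight μ) :
    Finset.univ.image (fun x => (rowOf φ x, colOf ψ x)) = μ.cells := by
  classical
  set s : P → ℕ × ℕ := fun x => (rowOf φ x, colOf ψ x) with hs
  set S := Finset.univ.image s
  have hinj : Function.Injective s := fun x y h => H x y (Prod.ext_iff.1 h).1 (Prod.ext_iff.1 h).2
  have hcard : S.card = μ.cells.card := by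
    rw [Finset.card_image_of_injective _ hinj, Finset.card_univ, Fintype.card_congr ψ,
      Fintype.card_coe]
  -- `f` is negative exactly on the cells of `μ`, so `μ` minimizes the sum of `f` over finite sets.
  let f : ℕ × ℕ → ℤ := fun x => (x.1 : ℤ) - μ.colLen x.2
  have hf : ∀ x, f x < 0 ↔ x ∈ μ.cells := by
    rintro ⟨i, j⟩
    rw [YoungDiagram.mem_cells, YoungDiagram.mem_iff_lt_colLen]
    simp only [f]
    omega
  have h1 : ∑ x ∈ S, f x ≤ ∑ x ∈ μ.cells, f x := by
    rw [Finset.sum_image hinj.injOn]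
    have e1 : ∑ x, f (s x) = (∑ x, (rowOf φ x : ℤ)) - ∑ x, (μ.colLen (colOf ψ x) : ℤ) :=
      Finset.sum_sub_distrib _ _
    have e2 := sum_cells_eq φ fun x => (x.1 : ℤ)
    have e3 := sum_cells_eq ψ fun x => (μ.colLen x.2 : ℤ)
    have e4 : ∑ x ∈ μ.cells, f x = (∑ x ∈ μ.cells, (x.1 : ℤ)) - ∑ x ∈ μ.cells, (μ.colLen x.2 : ℤ) :=
      Finset.sum_sub_distrib _ _
    simp only at e2 e3
    rw [e1, e2, e3, e4]
    have : ((rowWeight ν : ℕ) : ℤ) ≤ rowWeight μ := by exact_mod_cast hw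
    simp only [rowWeight, Nat.cast_sum] at this
    linarith
  have h2 : ∑ x ∈ S, f x = ∑ x ∈ S ∩ μ.cells, f x + ∑ x ∈ S \ μ.cells, f x :=
    (Finset.sum_inter_add_sum_sdiff S μ.cells f).symm
  have h3 : ∑ x ∈ μ.cells, f x = ∑ x ∈ S ∩ μ.cells, f x + ∑ x ∈ μ.cells \ S, f x := by
    rw [Finset.inter_comm]
    exact (Finset.sum_inter_add_sum_sdiff μ.cells S f).symm
  have h4 : 0 ≤ ∑ x ∈ S \ μ.cells, f x := Finset.sum_nonneg fun x hx =>
    not_lt.1 fun h => (Finset.mem_sdiff.1 hx).2 ((hf x).1 h)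
  have h5 : μ.cells \ S = ∅ := by
    by_contra h
    have := Finset.sum_neg (s := μ.cells \ S) (f := f)
      (fun x hx => (hf x).2 (Finset.mem_sdiff.1 hx).1) (Finset.nonempty_iff_ne_empty.2 h)
    linarith
  exact (Finset.eq_of_subset_of_card_le (Finset.sdiff_eq_empty_iff_subset.1 h5) hcard.le).symm

/-- If the rows of a numbering of `ν` and the columns of a numbering of `μ` separate points and the
weight of `ν` is at most that of `μ`, then the diagrams agree, as they have the same row lengths. -/
theorem eq_of_separates [Fintype P] (φ : P ≃ ν.cells) (ψ : P ≃ μ.cells)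
    (H : ∀ x y, rowOf φ x = rowOf φ y → colOf ψ x = colOf ψ y → x = y)
    (hw : rowWeight ν ≤ rowWeight μ) : ν = μ := by
  classical
  have h := image_rowOf_colOf φ ψ H hw
  have hinj : Function.Injective fun x => (rowOf φ x, colOf ψ x) :=
    fun x y h => H x y (Prod.ext_iff.1 h).1 (Prod.ext_iff.1 h).2
  have key : ∀ i, ν.rowLen i = μ.rowLen i := by
    intro i
    have e1 := sum_cells_eq φ fun x => if x.1 = i then 1 else 0
    have e2 : ∑ x ∈ μ.cells, (if x.1 = i then 1 else 0) = ∑ x, if rowOf φ x = i then 1 else 0 := by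
      rw [← h, Finset.sum_image hinj.injOn]
    rw [YoungDiagram.rowLen_eq_card, YoungDiagram.rowLen_eq_card, YoungDiagram.row,
      YoungDiagram.row, Finset.card_filter, Finset.card_filter, e2, ← e1]
  ext ⟨i, j⟩
  rw [YoungDiagram.mem_cells, YoungDiagram.mem_cells, YoungDiagram.mem_iff_lt_rowLen,
    YoungDiagram.mem_iff_lt_rowLen, key]

variable [Fintype P] [DecidableEq P] (K : Type*) [Field K]

/-- The sum of the permutations that preserve `r`. -/
noncomputable def rowSum (r : P → ℕ) : MonoidAlgebra K (Perm P) :=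
  ∑ p : {p : Perm P // ∀ x, r (p x) = r x}, MonoidAlgebra.of K _ p.1

/-- The signed sum of the permutations that preserve `c`. -/
noncomputable def colSum (c : P → ℕ) : MonoidAlgebra K (Perm P) :=
  ∑ q : {q : Perm P // ∀ x, c (q x) = c x}, ((Perm.sign q.1 : ℤ) : K) • MonoidAlgebra.of K _ q.1

/-- The Young symmetrizer of a diagram with numbered cells. -/
noncomputable def youngSym (φ : P ≃ μ.cells) : MonoidAlgebra K (Perm P) :=
  rowSum K (rowOf φ) * colSum K (colOf φ)

variable {K}

theorem rowSum_mul_of (r : P → ℕ) (t : Perm P) (ht : ∀ x, r (t x) = r x) :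
    rowSum K r * MonoidAlgebra.of K _ t = rowSum K r := by
  rw [rowSum, Finset.sum_mul]
  refine Fintype.sum_bijective (fun p => ⟨p.1 * t, fun x => by simp [p.2, ht]⟩) ?_ _ _ fun p => ?_
  · refine (Finite.injective_iff_bijective).1 fun p q h => ?_
    simpa [Subtype.ext_iff] using h
  · rw [← map_mul]

theorem sign_mul_self (t : Perm P) : ((Perm.sign t : ℤ) : K) * ((Perm.sign t : ℤ) : K) = 1 := by
  rcases Int.units_eq_one_or (Perm.sign t) with h | h <;> simp [h]

theorem of_mul_colSum (c : P → ℕ) (t : Perm P) (ht : ∀ x, c (t x) = c x) :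
    MonoidAlgebra.of K _ t * colSum K c = ((Perm.sign t : ℤ) : K) • colSum K c := by
  rw [colSum, Finset.mul_sum, Finset.smul_sum]
  refine Fintype.sum_bijective (fun p => ⟨t * p.1, fun x => by simp [p.2, ht]⟩) ?_ _ _ fun p => ?_
  · refine (Finite.injective_iff_bijective).1 fun p q h => ?_
    simpa [Subtype.ext_iff] using h
  · rw [mul_smul_comm, ← map_mul, smul_smul, Perm.sign_mul, Units.val_mul, Int.cast_mul, ← mul_assoc,
      sign_mul_self, one_mul]

/-- A transposition that preserves the rows and is conjugate under `g` to one that preserves the columns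
forces `a * g * b` to equal its negative. -/
theorem rowSum_mul_of_mul_colSum_eq_zero [CharZero K] (r c : P → ℕ) (g : Perm P) {x y : P}
    (hxy : x ≠ y) (hr : r (g x) = r (g y)) (hc : c x = c y) :
    rowSum K r * MonoidAlgebra.of K _ g * colSum K c = 0 := by
  have h1 : ∀ z, r (swap (g x) (g y) z) = r z := by
    intro z
    by_cases h : z = g x
    · rw [h, swap_apply_left, hr]
    · by_cases h' : z = g y
      · rw [h', swap_apply_right, hr]
      · rw [swap_apply_of_ne_of_ne h h']
  have h2 : ∀ z, c (swap x y z) = c z := by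
    intro z
    by_cases h : z = x
    · rw [h, swap_apply_left, hc]
    · by_cases h' : z = y
      · rw [h', swap_apply_right, hc]
      · rw [swap_apply_of_ne_of_ne h h']
  have h3 : swap (g x) (g y) * g = g * swap x y := by
    rw [mul_swap_eq_swap_mul]
  have h4 : rowSum K r * MonoidAlgebra.of K _ g * colSum K c =
      -(rowSum K r * MonoidAlgebra.of K _ g * colSum K c) := by
    conv_lhs => rw [← rowSum_mul_of r _ h1, mul_assoc (rowSum K r), ← map_mul, h3, map_mul,
      ← mul_assoc, mul_assoc, of_mul_colSum c _ h2, Perm.sign_swap hxy, mul_smul_comm]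
    simp
  have h5 : (2 : K) • (rowSum K r * MonoidAlgebra.of K _ g * colSum K c) = 0 := by
    rw [two_smul]
    nth_rewrite 1 [h4]
    exact neg_add_cancel _
  exact (smul_eq_zero.1 h5).resolve_left two_ne_zero

/-- Sandwiching any element between the row and the column sums gives a multiple of the Young
symmetrizer. -/
theorem rowSum_mul_mul_colSum [CharZero K] (φ : P ≃ μ.cells) (z : MonoidAlgebra K (Perm P)) :
    ∃ s : K, rowSum K (rowOf φ) * z * colSum K (colOf φ) = s • youngSym K φ := by
  induction z using MonoidAlgebra.induction_linear with
  | zero => exact ⟨0, by simp⟩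
  | add z z' h h' =>
    obtain ⟨s, hs⟩ := h
    obtain ⟨s', hs'⟩ := h'
    exact ⟨s + s', by rw [mul_add, add_mul, hs, hs', add_smul]⟩
  | single g k =>
    have hk : MonoidAlgebra.single g k = k • MonoidAlgebra.of K (Perm P) g := by simp
    rw [hk]
    simp only [mul_smul_comm, smul_mul_assoc]
    by_cases hg : ∃ x y, x ≠ y ∧ rowOf φ (g x) = rowOf φ (g y) ∧ colOf φ x = colOf φ y
    · obtain ⟨x, y, hxy, hr, hc⟩ := hg
      exact ⟨0, by rw [rowSum_mul_of_mul_colSum_eq_zero _ _ g hxy hr hc, smul_zero, zero_smul]⟩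
    -- Otherwise the cells `(row of g x, column of x)` fill `μ`, and `g` is the product of a row
    -- permutation and the column permutation that moves `x` to that cell.
    · have H : ∀ x y, rowOf (g.trans φ) x = rowOf (g.trans φ) y → colOf φ x = colOf φ y → x = y :=
        fun x y hr hc => by_contra fun hxy => hg ⟨x, y, hxy, hr, hc⟩
      have himg := image_rowOf_colOf (g.trans φ) φ H le_rfl
      have hmem : ∀ x, (rowOf φ (g x), colOf φ x) ∈ μ.cells := fun x => by
        rw [← himg]
        exact Finset.mem_image_of_mem _ (Finset.mem_univ x)
      let q₀ : P → P := fun x => φ.symm ⟨_, hmem x⟩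
      have hq_row : ∀ x, rowOf φ (q₀ x) = rowOf φ (g x) := fun x => by simp [rowOf, q₀]
      have hq_col : ∀ x, colOf φ (q₀ x) = colOf φ x := fun x => by simp [colOf, q₀]
      have hq_inj : Function.Injective q₀ := fun x y h =>
        H x y ((hq_row x).symm.trans ((congrArg _ h).trans (hq_row y)))
          ((hq_col x).symm.trans ((congrArg _ h).trans (hq_col y)))
      let q : Perm P := Equiv.ofBijective q₀ (Finite.injective_iff_bijective.1 hq_inj)
      have hp : ∀ x, rowOf φ ((g * q⁻¹) x) = rowOf φ x := by
        intro x
        obtain ⟨y, rfl⟩ := q.surjective x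
        rw [Perm.mul_apply, Perm.inv_def, symm_apply_apply]
        exact (hq_row y).symm
      refine ⟨k * ((Perm.sign q : ℤ) : K), ?_⟩
      have hg' : g = (g * q⁻¹) * q := by rw [inv_mul_cancel_right]
      rw [hg', map_mul, ← mul_assoc, rowSum_mul_of _ _ hp, mul_assoc, of_mul_colSum _ q hq_col,
        mul_smul_comm, smul_smul, youngSym]

theorem youngSym_mul_mul [CharZero K] (φ : P ≃ μ.cells) (z : MonoidAlgebra K (Perm P)) :
    ∃ s : K, youngSym K φ * z * youngSym K φ = s • youngSym K φ := by
  obtain ⟨s, hs⟩ := rowSum_mul_mul_colSum φ (colSum K (colOf φ) * z * rowSum K (rowOf φ))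
  refine ⟨s, ?_⟩
  rw [← hs, youngSym]
  simp only [mul_assoc]

/-- Of the two products of the symmetrizers of different diagrams with anything in between, the one
whose left factor has the smaller weight vanishes. -/
theorem youngSym_mul_mul_eq_zero [CharZero K] (φ : P ≃ ν.cells) (ψ : P ≃ μ.cells) (hne : ν ≠ μ)
    (hw : rowWeight ν ≤ rowWeight μ) (z : MonoidAlgebra K (Perm P)) :
    youngSym K φ * z * youngSym K ψ = 0 := by
  have key : ∀ z, rowSum K (rowOf φ) * z * colSum K (colOf ψ) = 0 := by
    intro z
    induction z using MonoidAlgebra.induction_linear with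
    | zero => simp
    | add z z' h h' => rw [mul_add, add_mul, h, h', add_zero]
    | single g k =>
      have hk : MonoidAlgebra.single g k = k • MonoidAlgebra.of K (Perm P) g := by simp
      rw [hk]
      simp only [mul_smul_comm, smul_mul_assoc]
      by_cases hg : ∃ x y, x ≠ y ∧ rowOf φ (g x) = rowOf φ (g y) ∧ colOf ψ x = colOf ψ y
      · obtain ⟨x, y, hxy, hr, hc⟩ := hg
        rw [rowSum_mul_of_mul_colSum_eq_zero _ _ g hxy hr hc, smul_zero]
      · exact absurd (eq_of_separates (g.trans φ) ψ
          (fun x y hr hc => by_contra fun hxy => hg ⟨x, y, hxy, hr, hc⟩) hw) hne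
  have := key (colSum K (colOf φ) * z * rowSum K (rowOf ψ))
  rw [← this, youngSym, youngSym]
  simp only [mul_assoc]

theorem youngSym_coeff_one (φ : P ≃ μ.cells) : (youngSym K φ).coeff 1 = 1 := by
  rw [youngSym, rowSum, colSum, Finset.sum_mul_sum]
  simp only [MonoidAlgebra.coeff_sum, Finsupp.finsetSum_apply, mul_smul_comm, ← map_mul]
  rw [Fintype.sum_eq_single ⟨1, fun _ => rfl⟩, Fintype.sum_eq_single ⟨1, fun _ => rfl⟩]
  · simp
  · rintro ⟨q, hq⟩ hne
    have : q ≠ 1 := fun h => hne (Subtype.ext h)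
    simp [this]
  · rintro ⟨p, hp⟩ hne
    refine Finset.sum_eq_zero fun q _ => ?_
    have : p * q.1 ≠ 1 := by
      intro h
      refine hne (Subtype.ext (Equiv.ext fun x => ?_))
      refine eq_of_rowOf_colOf φ (hp x) ?_
      have h1 : p = q.1⁻¹ := eq_inv_of_mul_eq_one_left h
      change colOf φ (p x) = colOf φ x
      rw [h1, ← q.2 (q.1⁻¹ x), Perm.inv_def, apply_symm_apply]
    simp [this]

/-- Right multiplication by `x` has trace `|G|` times the coefficient of `1`, and the trace of a nilpotent
endomorphism vanishes. -/
theorem coeff_one_eq_zero_of_mul_self {G : Type*} [Group G] [Fintype G] [CharZero K]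
    (x : MonoidAlgebra K G) (hx : x * x = 0) : x.coeff 1 = 0 := by
  classical
  let b : Module.Basis G K (MonoidAlgebra K G) := MonoidAlgebra.basis G K
  have h1 : IsNilpotent (LinearMap.mulRight K x) := ⟨2, by
    refine LinearMap.ext fun y => ?_
    rw [pow_two, Module.End.mul_apply, LinearMap.mulRight_apply, LinearMap.mulRight_apply, mul_assoc,
      hx, mul_zero, LinearMap.zero_apply]⟩
  have h2 := (LinearMap.isNilpotent_trace_of_isNilpotent h1).eq_zero
  rw [LinearMap.trace_eq_matrix_trace K b, Matrix.trace] at h2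
  have h3 : ∀ g, Matrix.diag (LinearMap.toMatrix b b (LinearMap.mulRight K x)) g = x.coeff 1 := by
    intro g
    rw [Matrix.diag_apply, LinearMap.toMatrix_apply]
    have hb : b g = MonoidAlgebra.single g 1 := MonoidAlgebra.basis_apply _ _
    have hr : ∀ y, b.repr y = y.coeff := fun _ => rfl
    rw [hr, hb, LinearMap.mulRight_apply, MonoidAlgebra.coeff_single_mul_apply]
    simp
  rw [Finset.sum_congr rfl fun g _ => h3 g, Finset.sum_const, nsmul_eq_mul] at h2
  exact (mul_eq_zero.1 h2).resolve_left (by simp)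

theorem youngSym_mul_self [CharZero K] (φ : P ≃ μ.cells) :
    youngSym K φ * youngSym K φ = (youngSym K φ * youngSym K φ).coeff 1 • youngSym K φ := by
  obtain ⟨s, hs⟩ := youngSym_mul_mul (K := K) φ 1
  rw [mul_one] at hs
  have : (youngSym K φ * youngSym K φ).coeff 1 = s := by
    rw [hs, MonoidAlgebra.coeff_smul_apply, youngSym_coeff_one, smul_eq_mul, mul_one]
  rw [this, hs]

theorem youngSym_sq_coeff_ne_zero [CharZero K] (φ : P ≃ μ.cells) :
    (youngSym K φ * youngSym K φ).coeff 1 ≠ 0 := by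
  intro h
  have := youngSym_mul_self (K := K) φ
  rw [h, zero_smul] at this
  have := coeff_one_eq_zero_of_mul_self _ this
  rw [youngSym_coeff_one] at this
  exact one_ne_zero this

end Young

/-! ### Young symmetrizers generate the group algebra -/

section Young

variable {P : Type*} {μ ν : YoungDiagram} {K : Type*} [Field K]

theorem card_cellsOfRowLens (w : List ℕ) : (YoungDiagram.cellsOfRowLens w).card = w.sum := by
  induction w with
  | nil => rfl
  | cons n w ih =>
    rw [YoungDiagram.cellsOfRowLens, Finset.card_union_of_disjoint, Finset.card_map, ih,
      Finset.card_product, List.sum_cons]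
    · simp
    · rw [Finset.disjoint_left]
      rintro ⟨i, j⟩ h h'
      simp only [Finset.mem_product, Finset.mem_singleton] at h
      obtain ⟨⟨i', j'⟩, -, h'⟩ := Finset.mem_map.1 h'
      have := (Prod.ext_iff.1 h').1
      simp [h.1] at this

/-- The Young diagram of a partition. -/
noncomputable def diagramOf {n : ℕ} (p : Nat.Partition n) : YoungDiagram :=
  YoungDiagram.ofRowLens (p.parts.sort (· ≥ ·)) (Multiset.pairwise_sort _ _).sortedGE

theorem diagramOf_card {n : ℕ} (p : Nat.Partition n) : (diagramOf p).card = n := by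
  refine (card_cellsOfRowLens _).trans ?_
  rw [← Multiset.sum_coe, Multiset.sort_eq, p.parts_sum]

theorem diagramOf_injective {n : ℕ} : Function.Injective (diagramOf (n := n)) := by
  intro p q h
  have key : ∀ p : Nat.Partition n, (diagramOf p).rowLens = p.parts.sort (· ≥ ·) := fun p =>
    YoungDiagram.rowLens_ofRowLens_eq_self fun x hx => p.parts_pos ((Multiset.mem_sort _).1 hx)
  have := congrArg YoungDiagram.rowLens h
  rw [key, key] at this
  refine Nat.Partition.ext ?_
  rw [← Multiset.sort_eq p.parts (· ≥ ·), this, Multiset.sort_eq]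

variable [Fintype P] [DecidableEq P]

/-- The sum of the conjugates of an element of a group algebra; it is central. -/
noncomputable def conjSum {G : Type*} [Group G] [Fintype G] (y : MonoidAlgebra K G) :
    MonoidAlgebra K G :=
  ∑ g, MonoidAlgebra.of K G g * y * MonoidAlgebra.of K G g⁻¹

theorem of_mul_conjSum {G : Type*} [Group G] [Fintype G] (y : MonoidAlgebra K G) (h : G) :
    MonoidAlgebra.of K G h * conjSum y = conjSum y * MonoidAlgebra.of K G h := by
  rw [conjSum, Finset.mul_sum, Finset.sum_mul]
  refine Fintype.sum_equiv (Equiv.mulLeft h) _ _ fun g => ?_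
  simp only [Equiv.coe_mulLeft, mul_inv_rev, map_mul, mul_assoc]
  rw [← map_mul _ h⁻¹ h, inv_mul_cancel, map_one, mul_one]

theorem mul_conjSum {G : Type*} [Group G] [Fintype G] (y x : MonoidAlgebra K G) :
    x * conjSum y = conjSum y * x := by
  induction x using MonoidAlgebra.induction_on with
  | of g => exact of_mul_conjSum y g
  | add x x' h h' => rw [add_mul, mul_add, h, h']
  | smul r x h => rw [smul_mul_assoc, mul_smul_comm, h]

theorem conjSum_coeff_conj {G : Type*} [Group G] [Fintype G] (y : MonoidAlgebra K G) (g h : G) :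
    (conjSum y).coeff (h * g * h⁻¹) = (conjSum y).coeff g := by
  have h1 := congrArg (fun z => z.coeff (h * g)) (of_mul_conjSum y h)
  simp only [MonoidAlgebra.of_apply, MonoidAlgebra.coeff_single_mul_apply,
    MonoidAlgebra.coeff_mul_single_apply, inv_mul_cancel_left, one_mul, mul_one] at h1
  exact h1.symm

theorem sum_coeff_smul_of {G : Type*} [Group G] [Fintype G] (y : MonoidAlgebra K G) :
    ∑ g, y.coeff g • MonoidAlgebra.of K G g = y := by
  refine Eq.trans ?_ (MonoidAlgebra.sum_coeff_single y)
  rw [Finsupp.sum_fintype _ _ (by simp)]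
  simp

/-- Since the conjugation sum is central, the order of the factors does not matter, and one order
vanishes. -/
theorem conjSum_youngSym_mul_eq_zero [CharZero K] (φ : P ≃ ν.cells) (ψ : P ≃ μ.cells) (hne : ν ≠ μ) :
    conjSum (youngSym K φ) * youngSym K ψ = 0 := by
  rcases le_total (rowWeight ν) (rowWeight μ) with h | h
  · rw [conjSum, Finset.sum_mul]
    refine Finset.sum_eq_zero fun g _ => ?_
    rw [mul_assoc, mul_assoc, ← mul_assoc (youngSym K φ), youngSym_mul_mul_eq_zero φ ψ hne h, mul_zero]
  · rw [← mul_conjSum, conjSum, Finset.mul_sum]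
    refine Finset.sum_eq_zero fun g _ => ?_
    rw [← mul_assoc, ← mul_assoc, youngSym_mul_mul_eq_zero ψ φ hne.symm h, zero_mul]

/-- The coefficient of `1` in the product is that in `y * y * y`, which is the square of the number `N`
with `y * y = N • y`. -/
theorem conjSum_youngSym_mul_self_ne_zero [CharZero K] (φ : P ≃ μ.cells) :
    conjSum (youngSym K φ) * youngSym K φ ≠ 0 := by
  set y := youngSym K φ with hy
  have hf : ∀ x, y * x * y = (y * x * y).coeff 1 • y := by
    intro x
    obtain ⟨s, hs⟩ := youngSym_mul_mul (K := K) φ x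
    rw [← hy] at hs
    rw [hs, MonoidAlgebra.coeff_smul_apply, hy, youngSym_coeff_one, smul_eq_mul, mul_one]
  have h1 : (conjSum y * y).coeff 1 = (y * y * y).coeff 1 := by
    rw [conjSum, Finset.sum_mul, MonoidAlgebra.coeff_sum, Finsupp.finsetSum_apply]
    have h2 : y * y * y = ∑ g, y.coeff g • (y * MonoidAlgebra.of K _ g * y) := by
      have h3 : y * y * y = y * (∑ g, y.coeff g • MonoidAlgebra.of K _ g) * y := by
        rw [sum_coeff_smul_of]
      rw [h3, Finset.mul_sum, Finset.sum_mul]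
      simp only [mul_smul_comm, smul_mul_assoc]
    rw [h2, MonoidAlgebra.coeff_sum, Finsupp.finsetSum_apply]
    refine Fintype.sum_equiv (Equiv.inv _) _ _ fun g => ?_
    rw [Equiv.inv_apply, MonoidAlgebra.coeff_smul_apply, mul_assoc, mul_assoc, ← mul_assoc y, hf,
      mul_smul_comm, MonoidAlgebra.coeff_smul_apply, MonoidAlgebra.of_apply, MonoidAlgebra.of_apply,
      MonoidAlgebra.coeff_single_mul_apply, smul_eq_mul, one_mul, mul_one, ← hf, smul_eq_mul, mul_comm]
  intro h
  rw [h] at h1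
  rw [youngSym_mul_self, smul_mul_assoc, MonoidAlgebra.coeff_smul_apply, smul_eq_mul] at h1
  exact mul_ne_zero (youngSym_sq_coeff_ne_zero φ) (youngSym_sq_coeff_ne_zero φ) h1.symm

/-- The Young symmetrizers generate the group algebra as a two-sided ideal: their conjugation sums are
linearly independent class functions, one for each partition, so that they span all class functions. -/
theorem one_mem_span_youngSym [CharZero K]
    (Φ : ∀ μ : YoungDiagram, μ.card = Fintype.card P → (P ≃ μ.cells)) :
    (1 : MonoidAlgebra K (Perm P)) ∈ Submodule.span K
      {z | ∃ (μ : YoungDiagram) (h : μ.card = Fintype.card P) (x y : MonoidAlgebra K (Perm P)),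
        z = x * youngSym K (Φ μ h) * y} := by
  classical
  let Y : Nat.Partition (Fintype.card P) → MonoidAlgebra K (Perm P) := fun p =>
    youngSym K (Φ (diagramOf p) (diagramOf_card p))
  let Ψ : (Nat.Partition (Fintype.card P) → K) →ₗ[K] MonoidAlgebra K (Perm P) :=
    ∑ g : Perm P, (LinearMap.proj g.partition).smulRight (MonoidAlgebra.of K _ g)
  have hΨ : ∀ u, Ψ u = ∑ g : Perm P, u g.partition • MonoidAlgebra.of K _ g := by
    intro u; simp [Ψ]
  let u : Nat.Partition (Fintype.card P) → Nat.Partition (Fintype.card P) → K := fun p π =>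
    if h : ∃ g : Perm P, g.partition = π then (conjSum (Y p)).coeff h.choose else 0
  have hu : ∀ p, Ψ (u p) = conjSum (Y p) := by
    intro p
    rw [hΨ, ← sum_coeff_smul_of (conjSum (Y p))]
    refine Finset.sum_congr rfl fun g _ => ?_
    have h : ∃ g' : Perm P, g'.partition = g.partition := ⟨g, rfl⟩
    have hc : IsConj h.choose g := Perm.partition_eq_of_isConj.2 h.choose_spec
    obtain ⟨t, ht⟩ := isConj_iff.1 hc
    simp only [u, dif_pos h]
    have h3 := conjSum_coeff_conj (Y p) h.choose t
    rw [ht] at h3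
    rw [h3]
  have hli : LinearIndependent K u := by
    refine LinearIndependent.of_comp Ψ ?_
    rw [show Ψ ∘ u = fun p => conjSum (Y p) from funext hu, Fintype.linearIndependent_iff]
    intro t ht p
    have h1 := congrArg (· * Y p) ht
    simp only [Finset.sum_mul, zero_mul, smul_mul_assoc] at h1
    rw [Fintype.sum_eq_single p] at h1
    · exact (smul_eq_zero.1 h1).resolve_right (conjSum_youngSym_mul_self_ne_zero _)
    · intro q hq
      rw [conjSum_youngSym_mul_eq_zero _ _ (diagramOf_injective.ne hq), smul_zero]
  have htop := hli.span_eq_top_of_card_eq_finrank' (Module.finrank_fintype_fun_eq_card K).symm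
  have h1 : Ψ (Pi.single (1 : Perm P).partition 1) = 1 := by
    rw [hΨ, Fintype.sum_eq_single 1]
    · rw [Pi.single_eq_same, one_smul, map_one]
    · intro g hg
      have : g.partition ≠ (1 : Perm P).partition := fun h =>
        hg (isConj_one_left.1 (Perm.partition_eq_of_isConj.2 h))
      rw [Pi.single_eq_of_ne this, zero_smul]
  rw [← h1]
  have h2 : Pi.single (1 : Perm P).partition 1 ∈ Submodule.span K (Set.range u) := by
    rw [htop]; trivial
  have h3 := Submodule.mem_map_of_mem (f := Ψ) h2
  rw [Submodule.map_span] at h3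
  refine Submodule.span_le.2 ?_ h3
  rintro _ ⟨_, ⟨p, rfl⟩, rfl⟩
  rw [hu, conjSum]
  exact Submodule.sum_mem _ fun g _ => Submodule.subset_span
    ⟨diagramOf p, diagramOf_card p, _, _, rfl⟩

end Young

/-! ### Idempotents of finite-dimensional algebras -/

section Idempotents

variable {K A : Type*} [Field K] [Ring A] [Algebra K A]

/-- The Fitting idempotent of an algebraic element `x`: if `X ^ n * q` annihilates `x`, where `q` is prime to
`X`, it is the idempotent of the decomposition of `1` given by a Bézout identity. -/
theorem exists_fitting_idempotent [FiniteDimensional K A] (x : A) :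
    ∃ (n : ℕ) (u f : A), f * f = f ∧ f = x * u ∧ f = u * x ∧ x ^ (n + 1) = x ^ (n + 1) * f := by
  have hx : minpoly K x ≠ 0 := minpoly.ne_zero (Algebra.IsIntegral.isIntegral x)
  obtain ⟨q, hq, hqX⟩ := Polynomial.exists_eq_pow_rootMultiplicity_mul_and_not_dvd (minpoly K x) hx 0
  set n := Polynomial.rootMultiplicity 0 (minpoly K x)
  rw [Polynomial.C_0, sub_zero] at hq hqX
  have hcop : IsCoprime ((Polynomial.X : Polynomial K) ^ (n + 1)) q :=
    ((Polynomial.irreducible_X.coprime_iff_not_dvd).2 hqX).pow_left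
  obtain ⟨a, b, hab⟩ := hcop
  have h0 : x ^ n * Polynomial.aeval x q = 0 := by
    have := minpoly.aeval K x
    rwa [hq, map_mul, map_pow, Polynomial.aeval_X] at this
  have h0' : x ^ (n + 1) * Polynomial.aeval x q = 0 := by rw [pow_succ', mul_assoc, h0, mul_zero]
  have h1 : Polynomial.aeval x a * x ^ (n + 1) + Polynomial.aeval x b * Polynomial.aeval x q = 1 := by
    have := congrArg (Polynomial.aeval x) hab
    simpa using this
  have hcomm : ∀ p q : Polynomial K, Polynomial.aeval x p * Polynomial.aeval x q =
      Polynomial.aeval x q * Polynomial.aeval x p := fun p q => by rw [← map_mul, mul_comm, map_mul]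
  have hcx : ∀ p : Polynomial K, Polynomial.aeval x p * x = x * Polynomial.aeval x p := fun p => by
    simpa using hcomm p Polynomial.X
  have hcxn : ∀ (p : Polynomial K) (m : ℕ), Polynomial.aeval x p * x ^ m = x ^ m * Polynomial.aeval x p :=
    fun p m => by simpa using hcomm p (Polynomial.X ^ m)
  have h2 : x ^ (n + 1) = x ^ (n + 1) * (Polynomial.aeval x a * x ^ (n + 1)) := by
    conv_lhs => rw [← mul_one (x ^ (n + 1)), ← h1, mul_add, hcomm b q, ← mul_assoc _ _ (Polynomial.aeval x b),
      h0', zero_mul, add_zero]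
  refine ⟨n, Polynomial.aeval x a * x ^ n, Polynomial.aeval x a * x ^ (n + 1), ?_, ?_, ?_, h2⟩
  · rw [mul_assoc, ← h2]
  · rw [← mul_assoc, ← hcx, mul_assoc, ← pow_succ']
  · rw [mul_assoc, ← pow_succ]

/-- Idempotents lift along multiplicative maps from a finite-dimensional algebra. -/
theorem exists_idempotent_lift [FiniteDimensional K A] {B : Type*} [Monoid B] (φ : A →* B) (x : A)
    (hx : φ x * φ x = φ x) : ∃ f : A, f * f = f ∧ φ f = φ x := by
  obtain ⟨n, u, f, hf, hxu, -, hn⟩ := exists_fitting_idempotent (K := K) x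
  refine ⟨f, hf, ?_⟩
  have h1 : ∀ m : ℕ, φ x ^ (m + 1) = φ x := fun m => by
    induction m with
    | zero => exact pow_one _
    | succ m ih => rw [pow_succ, ih, hx]
  have h2 := congrArg φ hn
  rw [map_mul, map_pow, h1, hxu, map_mul, ← mul_assoc, hx, ← map_mul, ← hxu] at h2
  exact h2.symm

/-- The algebra `e * A * e` of a primitive idempotent `e` is local: its elements are nilpotent or
invertible, depending on the Fitting idempotent. -/
theorem IsPrimitive.nilpotent_or_unit [FiniteDimensional K A] {e : A} (he : IsPrimitive e) (x : A)
    (hl : e * x = x) (hr : x * e = x) : (∃ n, x ^ (n + 1) = 0) ∨ ∃ u, x * u = e ∧ u * x = e := by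
  obtain ⟨n, u, f, hf, hxu, hux, hn⟩ := exists_fitting_idempotent (K := K) x
  have h1 : e * f = f := by rw [hxu, ← mul_assoc, hl]
  have h2 : f * e = f := by rw [hux, mul_assoc, hr]
  rcases he.indecomposable f (e - f) hf (by rw [mul_sub, sub_mul, sub_mul, he.idem, h1, h2, hf]; abel)
    (by rw [mul_sub, h2, hf, sub_self]) (by rw [sub_mul, h1, hf, sub_self]) (by abel) with h | h
  · exact Or.inl ⟨n, by rw [hn, h, mul_zero]⟩
  · rw [sub_eq_zero] at h
    exact Or.inr ⟨u, by rw [← hxu, h], by rw [← hux, h]⟩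

theorem mul_sum_of_orthogonal {ι : Type*} [Fintype ι] {f : ι → A} {z : A} (hf : ∀ i, f i * f i = f i)
    (horth : ∀ i j, i ≠ j → f i * f j = 0) (hsum : ∑ i, f i = z) (i : ι) :
    f i * z = f i ∧ z * f i = f i := by
  rw [← hsum, Finset.mul_sum, Finset.sum_mul, Fintype.sum_eq_single i fun j hj => horth i j hj.symm,
    Fintype.sum_eq_single i fun j hj => horth j i hj]
  exact ⟨hf i, hf i⟩

/-- Splitting an idempotent `z` into two nonzero orthogonal ones lowers the dimension of `z * A`. -/
theorem exists_primitive_decomposition_aux [FiniteDimensional K A] (n : ℕ) (z : A) (hz : z * z = z)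
    (hn : Module.finrank K (LinearMap.range (LinearMap.mulLeft K z)) ≤ n) :
    ∃ (ι : Type) (_ : Fintype ι) (f : ι → A),
      (∀ i, IsPrimitive (f i)) ∧ (∀ i j, i ≠ j → f i * f j = 0) ∧ ∑ i, f i = z := by
  classical
  induction n generalizing z with
  | zero =>
    have h1 : LinearMap.range (LinearMap.mulLeft K z) = ⊥ :=
      Submodule.finrank_eq_zero.1 (Nat.le_zero.1 hn)
    have h2 : z = 0 := by
      have : z ∈ LinearMap.range (LinearMap.mulLeft K z) := ⟨1, by simp⟩
      rwa [h1, Submodule.mem_bot] at this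
    exact ⟨Empty, inferInstance, Empty.elim, fun i => i.elim, fun i => i.elim, by simp [h2]⟩
  | succ n ih =>
    by_cases hp : IsPrimitive z
    · exact ⟨Unit, inferInstance, fun _ => z, fun _ => hp, fun i j h => (h rfl).elim, by simp⟩
    by_cases h0 : z = 0
    · exact ⟨Empty, inferInstance, Empty.elim, fun i => i.elim, fun i => i.elim, by simp [h0]⟩
    have hex : ∃ f g : A, f * f = f ∧ g * g = g ∧ f * g = 0 ∧ g * f = 0 ∧ z = f + g ∧ f ≠ 0 ∧ g ≠ 0 := by
      by_contra h
      refine hp ⟨h0, hz, fun f g hf hg hfg hgf hs => ?_⟩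
      by_contra h'
      rw [not_or] at h'
      exact h ⟨f, g, hf, hg, hfg, hgf, hs, h'.1, h'.2⟩
    obtain ⟨f, g, hf, hg, hfg, hgf, hs, hf0, hg0⟩ := hex
    have key : ∀ f g : A, f * f = f → g * g = g → f * g = 0 → g * f = 0 → z = f + g → g ≠ 0 →
        Module.finrank K (LinearMap.range (LinearMap.mulLeft K f)) ≤ n := by
      intro f g hf hg hfg hgf hs hg0
      refine Nat.lt_succ_iff.1 (lt_of_lt_of_le (Submodule.finrank_lt_finrank_of_lt ?_) hn)
      refine lt_of_le_of_ne ?_ fun h => hg0 ?_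
      · rintro _ ⟨a, rfl⟩
        exact ⟨f * a, by simp [hs, add_mul, ← mul_assoc, hf, hgf]⟩
      · have : g ∈ LinearMap.range (LinearMap.mulLeft K z) := ⟨g, by simp [hs, add_mul, hfg, hg]⟩
        rw [← h] at this
        obtain ⟨a, ha⟩ := this
        rw [LinearMap.mulLeft_apply] at ha
        rw [← hg]
        nth_rewrite 2 [← ha]
        rw [← mul_assoc, hgf, zero_mul]
    obtain ⟨ι, _, F, hF, hFo, hFs⟩ := ih f hf (key f g hf hg hfg hgf hs hg0)
    obtain ⟨κ, _, G, hG, hGo, hGs⟩ := ih g hg (key g f hg hf hgf hfg (by rw [hs, add_comm]) hf0)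
    have hFf := mul_sum_of_orthogonal (fun i => (hF i).idem) hFo hFs
    have hGg := mul_sum_of_orthogonal (fun i => (hG i).idem) hGo hGs
    refine ⟨ι ⊕ κ, inferInstance, Sum.elim F G, ?_, ?_, ?_⟩
    · rintro (i | i)
      · exact hF i
      · exact hG i
    · rintro (i | i) (j | j) hij
      · exact hFo i j (by simpa using hij)
      · change F i * G j = 0
        rw [← (hFf i).1, ← (hGg j).2, mul_assoc, ← mul_assoc f, hfg, zero_mul, mul_zero]
      · change G i * F j = 0
        rw [← (hGg i).1, ← (hFf j).2, mul_assoc, ← mul_assoc g, hgf, zero_mul, mul_zero]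
      · exact hGo i j (by simpa using hij)
    · simp [hFs, hGs, hs]

variable (K) in
/-- Each idempotent of a finite-dimensional algebra is a sum of orthogonal primitive idempotents. -/
theorem exists_primitive_decomposition [FiniteDimensional K A] (z : A) (hz : z * z = z) :
    ∃ (k : ℕ) (f : Fin k → A),
      (∀ i, IsPrimitive (f i)) ∧ (∀ i j, i ≠ j → f i * f j = 0) ∧ ∑ i, f i = z := by
  obtain ⟨ι, _, f, hf, ho, hs⟩ := exists_primitive_decomposition_aux (K := K) _ z hz le_rfl
  let e := Fintype.equivFin ι
  exact ⟨Fintype.card ι, fun i => f (e.symm i), fun i => hf _,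
    fun i j h => ho _ _ (e.symm.injective.ne h), by rw [← hs]; exact Fintype.sum_equiv e.symm _ _ fun _ => rfl⟩

end Idempotents

/-! ### Propagating edges -/

section Thru

variable {a b c : Row}

/-- All black vertices of the bottom row lie on propagating edges. Then the same holds for the white ones,
and a diagram with equal rows has this property if and only if it is a permutation diagram. -/
def Thru (X : Diagram a b) : Prop := ∀ p, (X (Sum.inl p)).isLeft

theorem Thru.exists_inl {X : Diagram a b} (h : Thru X) (p : a.P) : ∃ q, X (Sum.inl p) = Sum.inl q :=
  Sum.isLeft_iff.1 (h p)

theorem Thru.exists_inr {X : Diagram a b} (h : Thru X) (n : a.N) :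
    ∃ m, X.symm (Sum.inr n) = Sum.inr m := by
  rcases hx : X.symm (Sum.inr n) with p | m
  · obtain ⟨q, hq⟩ := h.exists_inl p
    rw [← hx, apply_symm_apply] at hq
    cases hq
  · exact ⟨m, rfl⟩

theorem Thru.card_le {X : Diagram a b} (h : Thru X) :
    Nat.card a.P ≤ Nat.card b.P ∧ Nat.card a.N ≤ Nat.card b.N := by
  choose f hf using h.exists_inl
  choose g hg using h.exists_inr
  refine ⟨Nat.card_le_card_of_injective f fun x y hxy => ?_,
    Nat.card_le_card_of_injective g fun x y hxy => ?_⟩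
  · have := (hf x).trans ((congrArg _ hxy).trans (hf y).symm)
    simpa using this
  · have := (hg x).trans ((congrArg _ hxy).trans (hg y).symm)
    simpa using this

theorem Thru.of_comp {X : Diagram a b} {Y : Diagram b c} (h : Thru (comp X Y).1) : Thru X := by
  intro p
  rcases hx : X (Sum.inl p) with q | n
  · rfl
  · have h1 : (comp X Y).1 (Sum.inl p) = Sum.inr n :=
      (tr_of_exit (join X Y)).1 _ _ (Exit.out (by simp [join, exR, exL, hx]))
    have h2 := h p
    rw [h1] at h2
    exact absurd h2 (by simp)

/-- If a bijection `A ⊕ N ≃ B ⊕ N` maps the finite set `N` into itself, then so does its inverse. -/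
theorem isRight_symm {A B N : Type*} [Finite N] (e : A ⊕ N ≃ B ⊕ N)
    (h : ∀ n, ∃ m, e (Sum.inr n) = Sum.inr m) (n : N) : ∃ m, e.symm (Sum.inr n) = Sum.inr m := by
  choose f hf using h
  have hinj : Function.Injective f := fun x y hxy => by
    have := (hf x).trans ((congrArg _ hxy).trans (hf y).symm)
    simpa using this
  obtain ⟨m, rfl⟩ := Finite.surjective_of_injective hinj n
  exact ⟨m, by rw [← hf, symm_apply_apply]⟩

theorem thru_iff (X : Diagram a a) : Thru X ↔ ∀ n, ∃ m, X (Sum.inr n) = Sum.inr m := by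
  constructor
  · intro h
    exact isRight_symm X.symm h.exists_inr
  · intro h p
    rcases hx : X (Sum.inl p) with q | n
    · rfl
    · obtain ⟨m, hm⟩ := isRight_symm X h n
      rw [← hx, symm_apply_apply] at hm
      cases hm

theorem Thru.of_comp_right {X Y : Diagram a a} (h : Thru (comp X Y).1) : Thru Y := by
  rw [thru_iff] at h ⊢
  intro n
  rcases hx : Y (Sum.inr n) with q | m
  · have h1 : (comp X Y).1 (Sum.inr n) = Sum.inl q :=
      (tr_of_exit (join X Y)).1 _ _ (Exit.out (by simp [join, exR, exL, hx]))
    obtain ⟨m, hm⟩ := h n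
    rw [h1] at hm
    cases hm
  · exact ⟨m, rfl⟩

theorem thru_ofIso (f : a.P ≃ b.P) (g : a.N ≃ b.N) : Thru (ofIso f g) := fun _ => rfl

theorem Thru.exists_ofIso {X : Diagram a a} (h : Thru X) : ∃ f g, X = ofIso f g := by
  choose f hf using h.exists_inl
  choose g hg using h.exists_inr
  have hfi : Function.Injective f := fun x y hxy => by
    have := (hf x).trans ((congrArg _ hxy).trans (hf y).symm)
    simpa using this
  have hgi : Function.Injective g := fun x y hxy => by
    have := (hg x).trans ((congrArg _ hxy).trans (hg y).symm)
    simpa using this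
  refine ⟨ofBijective f (Finite.injective_iff_bijective.1 hfi),
    ofBijective g (Finite.injective_iff_bijective.1 hgi), ?_⟩
  ext1 x
  rcases x with p | n
  · exact hf p
  · obtain ⟨m, rfl⟩ := (ofBijective g (Finite.injective_iff_bijective.1 hgi)).surjective n
    have h1 : X (Sum.inr (g m)) = Sum.inr m := by rw [← hg, apply_symm_apply]
    simpa [ofIso] using h1

theorem propagating_lt_iff (X : Diagram a a) :
    propagating X < Nat.card a.P + Nat.card a.N ↔ ¬ Thru X := by
  constructor
  · intro h hX
    refine h.ne ?_
    rw [propagating]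
    congr 1
    · exact Nat.card_congr (Equiv.subtypeUnivEquiv hX)
    · exact Nat.card_congr (Equiv.subtypeUnivEquiv fun n => by
        obtain ⟨m, hm⟩ := hX.exists_inr n
        rw [hm]; rfl)
  · intro h
    rw [Thru, not_forall] at h
    obtain ⟨p, hp⟩ := h
    exact add_lt_add_of_lt_of_le (Finite.card_subtype_lt hp) (Finite.card_subtype_le _)

theorem exists_equiv_option {A B : Type} [Finite A] [Finite B] (h : Nat.card A = Nat.card B + 1)
    (x : A) : ∃ e : A ≃ Option B, e x = none := by
  classical
  have h' : Nat.card A = Nat.card (Option B) := by rw [h, Finite.card_option]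
  obtain ⟨e⟩ : Nonempty (A ≃ Option B) := Finite.card_eq.1 h'
  exact ⟨e.trans (swap (e x) none), by simp⟩

/-- A diagram with a top edge factors, without loops, through a row with one vertex of each colour less:
remove the two vertices of such an edge from the top row, and stack the diagram that creates it. -/
theorem exists_factorization (X : Diagram a a) (hX : ¬ Thru X) (hP : Nat.card a.P = Nat.card b.P + 1)
    (hN : Nat.card a.N = Nat.card b.N + 1) :
    ∃ (Y : Diagram a b) (Z : Diagram b a), comp Y Z = (X, 0) := by
  have hex : ∃ n p, X (Sum.inr n) = Sum.inl p := by
    by_contra h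
    refine hX ((thru_iff X).2 fun n => ?_)
    rcases hx : X (Sum.inr n) with p | m
    · exact absurd ⟨n, p, hx⟩ h
    · exact ⟨m, rfl⟩
  obtain ⟨n₁, p₁, hnp⟩ := hex
  obtain ⟨eP, heP⟩ := exists_equiv_option hP p₁
  obtain ⟨eN, heN⟩ := exists_equiv_option hN n₁
  let iN : a.P ⊕ b.N → a.P ⊕ a.N := Sum.map id (fun n => eN.symm (some n))
  let iP : b.P ⊕ a.N → a.P ⊕ a.N := Sum.map (fun p => eP.symm (some p)) id
  have hiN : Function.Injective iN := Function.Injective.sumMap Function.injective_id fun x y h => by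
    simpa using h
  have hiP : Function.Injective iP := Function.Injective.sumMap (fun x y h => by
    simpa using h) Function.injective_id
  have hN₁ : ∀ x, x ≠ Sum.inr n₁ → ∃ y, x = iN y := by
    rintro (p | n) hx
    · exact ⟨Sum.inl p, rfl⟩
    · rcases h : eN n with _ | m
      · rw [← heN] at h
        exact absurd (congrArg Sum.inr (eN.injective h)) hx
      · exact ⟨Sum.inr m, by simp [iN, ← h]⟩
  have hP₁ : ∀ x, x ≠ Sum.inl p₁ → ∃ y, x = iP y := by
    rintro (p | n) hx
    · rcases h : eP p with _ | m
      · rw [← heP] at h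
        exact absurd (congrArg Sum.inl (eP.injective h)) hx
      · exact ⟨Sum.inl m, by simp [iP, ← h]⟩
    · exact ⟨Sum.inr n, rfl⟩
  have hY : ∀ x, ∃ y, X (iN x) = iP y := fun x => hP₁ _ fun h => by
    have h1 := X.injective (h.trans hnp.symm)
    rcases x with p | n
    · cases h1
    · have h2 : eN.symm (some n) = n₁ := Sum.inr_injective h1
      rw [← h2, apply_symm_apply] at heN
      cases heN
  choose f hf using hY
  have hfb : Function.Bijective f := by
    refine ⟨fun x y h => hiN (X.injective ?_), fun y => ?_⟩
    · rw [hf, hf, h]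
    · obtain ⟨x, hx⟩ := hN₁ (X.symm (iP y)) fun h => by
        rw [symm_apply_eq, hnp] at h
        rcases y with p | n
        · have h2 : eP.symm (some p) = p₁ := Sum.inl_injective h
          rw [← h2, apply_symm_apply] at heP
          cases heP
        · cases h
      refine ⟨x, hiP ?_⟩
      rw [← hf, ← hx, apply_symm_apply]
  let Y : Diagram a b := ofBijective f hfb
  let M : b.P ⊕ Option b.N ≃ Option b.P ⊕ b.N :=
    { toFun := Sum.elim (fun p => Sum.inl (some p)) fun n => n.elim (Sum.inl none) Sum.inr
      invFun := Sum.elim (fun p => p.elim (Sum.inr none) Sum.inl) fun n => Sum.inr (some n)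
      left_inv := by rintro (p | _ | n) <;> rfl
      right_inv := by rintro ((_ | p) | n) <;> rfl }
  let Z : Diagram b a :=
    (sumCongr (Equiv.refl _) eN).trans (M.trans (sumCongr eP.symm (Equiv.refl _)))
  have hYf : ∀ x, X (iN x) = iP (Y x) := hf
  have hZ₁ : ∀ p, Z (Sum.inl p) = Sum.inl (eP.symm (some p)) := fun p => rfl
  have hZ₂ : Z (Sum.inr n₁) = Sum.inl p₁ := by
    simp [Z, M, heN, ← heP]
  have hZ₃ : ∀ n, Z (Sum.inr (eN.symm (some n))) = Sum.inr n := fun n => by simp [Z, M]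
  clear_value Y Z
  have hmid : ∀ p, Exit (join Y Z) (Sum.inr (Sum.inl p)) (Sum.inl (eP.symm (some p))) := fun p =>
    Exit.out (by simp [join, exR, exL, hZ₁])
  have hsrc₁ : ∀ p, Exit (join Y Z) (Sum.inl (Sum.inl p)) (X (Sum.inl p)) := by
    intro p
    have h1 : X (Sum.inl p) = iP (Y (Sum.inl p)) := hYf (Sum.inl p)
    rw [h1]
    rcases h : Y (Sum.inl p) with q | n
    · exact Exit.step (u := Sum.inl q) (by simp [join, exR, exL, h]) (hmid q)
    · exact Exit.out (by simp [join, exR, exL, h, iP])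
  have hsrc₂ : ∀ n, Exit (join Y Z) (Sum.inr (Sum.inr n)) (X (Sum.inr (eN.symm (some n)))) := by
    intro n
    have h1 : X (Sum.inr (eN.symm (some n))) = iP (Y (Sum.inr n)) := hYf (Sum.inr n)
    rw [h1]
    rcases h : Y (Sum.inr n) with q | n
    · exact Exit.step (u := Sum.inl q) (by simp [join, exR, exL, h]) (hmid q)
    · exact Exit.out (by simp [join, exR, exL, h, iP])
  refine ⟨Y, Z, Prod.ext (Equiv.ext fun x => (tr_of_exit _).1 _ _ ?_) ((tr_of_exit _).2 ?_)⟩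
  · rcases x with p | n
    · exact hsrc₁ p
    · by_cases hn : n = n₁
      · rw [hn, hnp]
        exact Exit.out (by simp [join, exR, exL, hZ₂])
      · obtain ⟨m, rfl⟩ : ∃ m, n = eN.symm (some m) := by
          rcases h : eN n with _ | m
          · rw [← heN] at h
            exact absurd (eN.injective h) hn
          · exact ⟨m, by simp [← h]⟩
        exact Exit.step (u := Sum.inr m) (by simp [join, exR, exL, hZ₃]) (hsrc₂ m)
  · rintro (p | n)
    · exact ⟨_, hmid p⟩
    · exact ⟨_, hsrc₂ n⟩

end Thru

section NP

variable {K : Type*} [Field K] {δ : K} {a b c : Row}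

/-- Non-propagating: a linear combination of diagrams in which no diagram with property `Thru` occurs. -/
def NP (f : Diagram a b →₀ K) : Prop := ∀ X, Thru X → f X = 0

theorem NP.add {f g : Diagram a b →₀ K} (hf : NP f) (hg : NP g) : NP (f + g) := fun X hX => by
  rw [Finsupp.add_apply, hf X hX, hg X hX, add_zero]

theorem NP.smul {f : Diagram a b →₀ K} (s : K) (hf : NP f) : NP (s • f) := fun X hX => by
  rw [Finsupp.smul_apply, hf X hX, smul_zero]

theorem NP.zero : NP (0 : Diagram a b →₀ K) := fun _ _ => rfl

theorem NP.single {X : Diagram a b} (hX : ¬ Thru X) (x : K) : NP (Finsupp.single X x) := fun Y hY => by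
  classical
  rw [Finsupp.single_apply, if_neg]
  rintro rfl
  exact hX hY

theorem NP.induction {f : Diagram a b →₀ K} (hf : NP f) {p : (Diagram a b →₀ K) → Prop} (h0 : p 0)
    (hadd : ∀ f g, p f → p g → p (f + g)) (hs : ∀ X x, ¬ Thru X → p (Finsupp.single X x)) : p f := by
  rw [← Finsupp.sum_single f]
  refine Finset.sum_induction _ p hadd h0 fun X hX => hs _ _ fun h => ?_
  exact (Finsupp.mem_support_iff.1 hX) (hf X h)

theorem NP.compL_right {f : Diagram a b →₀ K} (hf : NP f) (g : Diagram b c →₀ K) :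
    NP (compL δ a b c f g) := by
  refine hf.induction (p := fun f => NP (compL δ a b c f g)) ?_ ?_ ?_
  · simpa using NP.zero
  · intro f f' h h'
    rw [map_add, LinearMap.add_apply]
    exact h.add h'
  · intro X x hX
    induction g using Finsupp.induction_linear with
    | zero => simpa using NP.zero
    | add g g' h h' => rw [map_add]; exact h.add h'
    | single Y y =>
      rw [compL_single]
      exact NP.single (fun h => hX h.of_comp) _

theorem NP.compL_left (f : Diagram a a →₀ K) {g : Diagram a a →₀ K} (hg : NP g) :
    NP (compL δ a a a f g) := by
  refine hg.induction (p := fun g => NP (compL δ a a a f g)) ?_ ?_ ?_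
  · simpa using NP.zero
  · intro f f' h h'
    rw [map_add]
    exact h.add h'
  · intro X x hX
    induction f using Finsupp.induction_linear with
    | zero => simpa using NP.zero
    | add g g' h h' => rw [map_add, LinearMap.add_apply]; exact h.add h'
    | single Y y =>
      rw [compL_single]
      exact NP.single (fun h => hX h.of_comp_right) _

theorem NP.of_card_lt (h : Nat.card b.P < Nat.card a.P ∨ Nat.card b.N < Nat.card a.N)
    (f : Diagram a b →₀ K) : NP f := fun X hX => by
  have := hX.card_le
  omega

theorem mem_nonPropagating {r s : ℕ} (f : End (mixedObj δ r s)) :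
    f ∈ nonPropagating δ r s ↔
      NP (f : Diagram (wordRow (mixedWord r s)) (wordRow (mixedWord r s)) →₀ K) := by
  have hrs : r + s = Nat.card (wordRow (mixedWord r s)).P + Nat.card (wordRow (mixedWord r s)).N := by
    rw [← Nat.card_congr (blackPos r s), ← Nat.card_congr (whitePos r s), Nat.card_fin, Nat.card_fin]
  rw [nonPropagating]
  constructor
  · intro h
    induction h using Submodule.span_induction with
    | mem f hf =>
      obtain ⟨X, hX, rfl⟩ := hf
      rw [hrs, propagating_lt_iff] at hX
      exact NP.single hX 1
    | zero => exact NP.zero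
    | add f g _ _ hf hg => exact hf.add hg
    | smul s f _ hf => exact hf.smul s
  · intro h
    refine h.induction (p := fun f : End (mixedObj δ r s) => f ∈ Submodule.span K _) (Submodule.zero_mem _)
      (fun f g => Submodule.add_mem _) fun X x hX => ?_
    have h1 : (Finsupp.single X x : End (mixedObj δ r s)) =
        x • (Finsupp.single X 1 : Diagram _ _ →₀ K) := by
      rw [Finsupp.smul_single, smul_eq_mul, mul_one]
    rw [h1]
    refine Submodule.smul_mem _ _ (Submodule.subset_span ⟨X, ?_, rfl⟩)
    rwa [hrs, propagating_lt_iff]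

end NP

/-! ### The idempotents of pairs of Young diagrams -/

section NormalizedSymmetrizer

variable {P : Type*} {μ ν : YoungDiagram} {K : Type*} [Field K] [Fintype P] [DecidableEq P]

variable (K) in
/-- The idempotent proportional to a Young symmetrizer. -/
noncomputable def youngIdemOf (φ : P ≃ μ.cells) : MonoidAlgebra K (Perm P) :=
  ((youngSym K φ * youngSym K φ).coeff 1)⁻¹ • youngSym K φ

theorem youngSym_eq_smul [CharZero K] (φ : P ≃ μ.cells) :
    youngSym K φ = (youngSym K φ * youngSym K φ).coeff 1 • youngIdemOf K φ := by
  rw [youngIdemOf, smul_smul, mul_inv_cancel₀ (youngSym_sq_coeff_ne_zero φ), one_smul]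

theorem youngIdemOf_mul_self [CharZero K] (φ : P ≃ μ.cells) :
    youngIdemOf K φ * youngIdemOf K φ = youngIdemOf K φ := by
  have h := youngSym_mul_self (K := K) φ
  have h0 := youngSym_sq_coeff_ne_zero (K := K) φ
  rw [youngIdemOf]
  generalize (youngSym K φ * youngSym K φ).coeff 1 = N at h h0
  rw [smul_mul_smul_comm, h, smul_smul, mul_assoc, inv_mul_cancel₀ h0, mul_one]

theorem youngIdemOf_mul_mul [CharZero K] (φ : P ≃ μ.cells) (z : MonoidAlgebra K (Perm P)) :
    ∃ s : K, youngIdemOf K φ * z * youngIdemOf K φ = s • youngIdemOf K φ := by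
  obtain ⟨s, hs⟩ := youngSym_mul_mul φ z
  refine ⟨((youngSym K φ * youngSym K φ).coeff 1)⁻¹ * s, ?_⟩
  simp only [youngIdemOf, smul_mul_assoc, mul_smul_comm, hs, smul_smul]
  congr 1
  ring

theorem youngIdemOf_mul_mul_eq_zero [CharZero K] (φ : P ≃ ν.cells) (ψ : P ≃ μ.cells) (hne : ν ≠ μ)
    (hw : rowWeight ν ≤ rowWeight μ) (z : MonoidAlgebra K (Perm P)) :
    youngIdemOf K φ * z * youngIdemOf K ψ = 0 := by
  simp only [youngIdemOf, smul_mul_assoc, mul_smul_comm, youngSym_mul_mul_eq_zero φ ψ hne hw, smul_zero]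

theorem youngIdemOf_coeff_one_ne_zero [CharZero K] (φ : P ≃ μ.cells) :
    (youngIdemOf K φ).coeff 1 ≠ 0 := by
  rw [youngIdemOf, MonoidAlgebra.coeff_smul_apply, youngSym_coeff_one, smul_eq_mul, mul_one]
  exact inv_ne_zero (youngSym_sq_coeff_ne_zero φ)

theorem one_mem_span_youngIdemOf [CharZero K]
    (Φ : ∀ μ : YoungDiagram, μ.card = Fintype.card P → (P ≃ μ.cells)) :
    (1 : MonoidAlgebra K (Perm P)) ∈ Submodule.span K
      {z | ∃ (μ : YoungDiagram) (h : μ.card = Fintype.card P) (x y : MonoidAlgebra K (Perm P)),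
        z = x * youngIdemOf K (Φ μ h) * y} := by
  refine Submodule.span_mono ?_ (one_mem_span_youngSym Φ)
  rintro _ ⟨μ, h, x, y, rfl⟩
  refine ⟨μ, h, (youngSym K (Φ μ h) * youngSym K (Φ μ h)).coeff 1 • x, y, ?_⟩
  conv_lhs => rw [youngSym_eq_smul, mul_smul_comm, smul_mul_assoc]
  rw [smul_mul_assoc, smul_mul_assoc]

theorem domCongr_youngElement (φ : P ≃ μ.cells) :
    MonoidAlgebra.domCongr K K φ.symm.permCongrHom (youngElement K μ) = youngSym K φ := by
  classical
  rw [youngElement, youngSym, rowSum, colSum, map_sum, Finset.sum_mul]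
  refine Fintype.sum_equiv (φ.symm.permCongr.subtypeEquiv fun p => ?_) _ _ fun p => ?_
  · rw [← φ.forall_congr_right]
    simp [rowOf]
  · rw [map_sum, Finset.mul_sum]
    refine Fintype.sum_equiv (φ.symm.permCongr.subtypeEquiv fun p => ?_) _ _ fun q => ?_
    · rw [← φ.forall_congr_right]
      simp [colOf]
    · rw [MonoidAlgebra.domCongr_single, mul_smul_comm, ← map_mul, MonoidAlgebra.of_apply,
        MonoidAlgebra.smul_single', mul_one]
      refine congrArg₂ MonoidAlgebra.single ?_ ?_
      · exact map_mul _ _ _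
      · change _ = ((Perm.sign (φ.symm.permCongr q.1) : ℤ) : K)
        rw [Perm.sign_permCongr]

/-- Renumbering the cells turns `youngIdem` into `youngIdemOf`. -/
theorem domCongr_youngIdem (φ : P ≃ μ.cells) :
    MonoidAlgebra.domCongr K K φ.symm.permCongrHom (youngIdem K μ) = youngIdemOf K φ := by
  rw [youngIdem, youngIdemOf, map_smul, domCongr_youngElement]
  congr 2
  rw [← domCongr_youngElement, ← map_mul, MonoidAlgebra.coeff_domCongr, map_one φ.symm.permCongrHom.symm]

end NormalizedSymmetrizer

section PermL

variable {K : Type*} [Field K] {δ : K} {a : Row}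

/-- The bilinear map that sends permutations `σ` and `τ` to the permutation diagram `σ• ⊗ τ∘`. -/
noncomputable def permL (K : Type*) [Field K] (a : Row) :
    MonoidAlgebra K (Perm a.P) →ₗ[K] MonoidAlgebra K (Perm a.N) →ₗ[K] (Diagram a a →₀ K) :=
  (Finsupp.linearCombination K fun σ : Perm a.P =>
    (Finsupp.linearCombination K fun τ : Perm a.N =>
      (Finsupp.single (ofIso σ τ) 1 : Diagram a a →₀ K)) ∘ₗ
        (MonoidAlgebra.coeffLinearEquiv K).toLinearMap) ∘ₗ
    (MonoidAlgebra.coeffLinearEquiv K).toLinearMap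

theorem permL_single (σ : Perm a.P) (τ : Perm a.N) (x y : K) :
    permL K a (MonoidAlgebra.single σ x) (MonoidAlgebra.single τ y) =
      Finsupp.single (ofIso σ τ) (x * y) := by
  have h1 : ∀ {M : Type} [Monoid M] (m : M) (x : K),
      MonoidAlgebra.coeffLinearEquiv K (MonoidAlgebra.single m x) = Finsupp.single m x := fun _ _ => rfl
  simp only [permL, LinearMap.comp_apply, LinearEquiv.coe_coe, h1,
    Finsupp.linearCombination_single, LinearMap.smul_apply, Finsupp.smul_single, smul_eq_mul, mul_one]

theorem ofIso_injective {σ σ' : Perm a.P} {τ τ' : Perm a.N} :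
    (ofIso σ τ : Diagram a a) = ofIso σ' τ' ↔ σ = σ' ∧ τ = τ' := by
  constructor
  · intro h
    constructor
    · ext1 x
      have := congrArg (fun e : Diagram a a => e (Sum.inl x)) h
      simpa [ofIso] using this
    · have : τ.symm = τ'.symm := by
        ext1 x
        have := congrArg (fun e : Diagram a a => e (Sum.inr x)) h
        simpa [ofIso] using this
      exact Equiv.symm_bijective.injective this
  · rintro ⟨rfl, rfl⟩
    rfl

theorem permL_apply_ofIso (x : MonoidAlgebra K (Perm a.P)) (y : MonoidAlgebra K (Perm a.N))
    (σ : Perm a.P) (τ : Perm a.N) : permL K a x y (ofIso σ τ) = x.coeff σ * y.coeff τ := by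
  classical
  induction x using MonoidAlgebra.induction_linear with
  | zero => simp
  | add x x' h h' => simp [h, h', add_mul]
  | single g k =>
    induction y using MonoidAlgebra.induction_linear with
    | zero => simp
    | add x x' h h' => simp [h, h', mul_add]
    | single g' k' =>
      rw [permL_single, Finsupp.single_apply, MonoidAlgebra.coeff_single, MonoidAlgebra.coeff_single,
        Finsupp.single_apply, Finsupp.single_apply, ofIso_injective]
      split_ifs <;> simp_all

/-- The factors are exchanged on the right because composition of diagrams is written from left to right,
and composition of permutations from right to left. -/
theorem compL_permL (x y : MonoidAlgebra K (Perm a.P)) (x' y' : MonoidAlgebra K (Perm a.N)) :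
    compL δ a a a (permL K a x x') (permL K a y y') = permL K a (y * x) (y' * x') := by
  induction x using MonoidAlgebra.induction_linear with
  | zero => simp
  | add x x' h h' => simp [h, h', mul_add]
  | single g k =>
  induction y using MonoidAlgebra.induction_linear with
  | zero => simp
  | add x x' h h' => simp [h, h', add_mul]
  | single h l =>
  induction x' using MonoidAlgebra.induction_linear with
  | zero => simp
  | add x x' h h' => simp [h, h', mul_add]
  | single g' k' =>
  induction y' using MonoidAlgebra.induction_linear with
  | zero => simp
  | add x x' h h' => simp [h, h', add_mul]
  | single h' l' =>
    rw [permL_single, permL_single, MonoidAlgebra.single_mul_single, MonoidAlgebra.single_mul_single,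
      permL_single, compL_single, comp_ofIso, pow_zero, mul_one]
    congr 1
    · ext1 x
      rcases x with x | x
      · simp [ofIso]
      · simp [ofIso, Perm.mul_def]
    · ring

theorem permL_one_one : permL K a 1 1 = isoL (Equiv.refl _) (Equiv.refl _) := by
  rw [MonoidAlgebra.one_def, MonoidAlgebra.one_def, permL_single, mul_one]
  rfl

/-- The endomorphisms are spanned by the permutation diagrams and those that are not `Thru`. -/
theorem diagram_induction {p : (Diagram a a →₀ K) → Prop} (hadd : ∀ f g, p f → p g → p (f + g))
    (hperm : ∀ x y, p (permL K a x y)) (hnp : ∀ f, NP f → p f) (f : Diagram a a →₀ K) : p f := by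
  induction f using Finsupp.induction_linear with
  | zero => exact hnp _ NP.zero
  | add f g hf hg => exact hadd f g hf hg
  | single X x =>
    by_cases hX : Thru X
    · obtain ⟨σ, τ, rfl⟩ := hX.exists_ofIso
      have := hperm (MonoidAlgebra.single σ x) (MonoidAlgebra.single τ 1)
      rwa [permL_single, mul_one] at this
    · exact hnp _ (NP.single hX x)

variable [Fintype a.P] [DecidableEq a.P] [Fintype a.N] [DecidableEq a.N] {μ ν μ' ν' : YoungDiagram}

variable (K) in
/-- The product of the idempotents of two Young diagrams, with cells numbered by the black and by the white
vertices of a row. -/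
noncomputable def zOf (φ : a.P ≃ μ.cells) (ψ : a.N ≃ ν.cells) : Diagram a a →₀ K :=
  permL K a (youngIdemOf K φ) (youngIdemOf K ψ)

variable [CharZero K]

theorem zOf_comp_self (φ : a.P ≃ μ.cells) (ψ : a.N ≃ ν.cells) :
    compL δ a a a (zOf K φ ψ) (zOf K φ ψ) = zOf K φ ψ := by
  rw [zOf, compL_permL, youngIdemOf_mul_self, youngIdemOf_mul_self]

theorem not_NP_zOf (φ : a.P ≃ μ.cells) (ψ : a.N ≃ ν.cells) : ¬ NP (zOf K φ ψ) := by
  intro h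
  have := h (ofIso 1 1) (thru_ofIso _ _)
  rw [zOf, permL_apply_ofIso] at this
  exact mul_ne_zero (youngIdemOf_coeff_one_ne_zero φ) (youngIdemOf_coeff_one_ne_zero ψ) this

/-- The idempotent is primitive modulo the diagrams that are not `Thru`, even absolutely so. -/
theorem zOf_comp_comp (φ : a.P ≃ μ.cells) (ψ : a.N ≃ ν.cells) (f : Diagram a a →₀ K) :
    ∃ s : K, NP (compL δ a a a (zOf K φ ψ) (compL δ a a a f (zOf K φ ψ)) - s • zOf K φ ψ) := by
  induction f using diagram_induction with
  | hadd f g hf hg =>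
    obtain ⟨s, hs⟩ := hf
    obtain ⟨t, ht⟩ := hg
    refine ⟨s + t, ?_⟩
    have := hs.add ht
    rw [map_add, LinearMap.add_apply, map_add, add_smul]
    convert this using 1
    abel
  | hperm x y =>
    obtain ⟨s, hs⟩ := youngIdemOf_mul_mul φ x
    obtain ⟨t, ht⟩ := youngIdemOf_mul_mul ψ y
    refine ⟨s * t, ?_⟩
    rw [zOf, compL_permL, compL_permL, hs, ht, map_smul, map_smul, LinearMap.smul_apply, smul_smul,
      mul_comm, sub_self]
    exact NP.zero
  | hnp f hf =>
    refine ⟨0, ?_⟩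
    rw [zero_smul, sub_zero]
    exact NP.compL_left _ (hf.compL_right _)

/-- For different pairs of diagrams, one of the two spaces of maps between the images of the idempotents
vanishes modulo the diagrams that are not `Thru`. -/
theorem zOf_comp_comp_NP (φ : a.P ≃ μ.cells) (ψ : a.N ≃ ν.cells) (φ' : a.P ≃ μ'.cells)
    (ψ' : a.N ≃ ν'.cells) (h : ¬ (μ = μ' ∧ ν = ν')) :
    (∀ f, NP (compL δ a a a (zOf K φ ψ) (compL δ a a a f (zOf K φ' ψ')))) ∨
      (∀ f, NP (compL δ a a a (zOf K φ' ψ') (compL δ a a a f (zOf K φ ψ)))) := by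
  have key : ∀ {μ ν μ' ν' : YoungDiagram} (φ : a.P ≃ μ.cells) (ψ : a.N ≃ ν.cells)
      (φ' : a.P ≃ μ'.cells) (ψ' : a.N ≃ ν'.cells), ((∀ x, youngIdemOf K φ' * x * youngIdemOf K φ = 0) ∨
        (∀ x, youngIdemOf K ψ' * x * youngIdemOf K ψ = 0)) →
      ∀ f, NP (compL δ a a a (zOf K φ ψ) (compL δ a a a f (zOf K φ' ψ'))) := by
    intro μ ν μ' ν' φ ψ φ' ψ' h f
    induction f using diagram_induction with
    | hadd f g hf hg =>
      rw [map_add, LinearMap.add_apply, map_add]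
      exact hf.add hg
    | hperm x y =>
      rw [zOf, zOf, compL_permL, compL_permL]
      rcases h with h | h
      · rw [h, map_zero, LinearMap.zero_apply]
        exact NP.zero
      · rw [h, map_zero]
        exact NP.zero
    | hnp f hf => exact NP.compL_left _ (hf.compL_right _)
  rw [not_and_or] at h
  rcases h with h | h
  · rcases le_total (rowWeight μ) (rowWeight μ') with hw | hw
    · exact Or.inr (key φ' ψ' φ ψ (Or.inl (youngIdemOf_mul_mul_eq_zero φ φ' h hw)))
    · exact Or.inl (key φ ψ φ' ψ' (Or.inl (youngIdemOf_mul_mul_eq_zero φ' φ (Ne.symm h) hw)))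
  · rcases le_total (rowWeight ν) (rowWeight ν') with hw | hw
    · exact Or.inr (key φ' ψ' φ ψ (Or.inr (youngIdemOf_mul_mul_eq_zero ψ ψ' h hw)))
    · exact Or.inl (key φ ψ φ' ψ' (Or.inr (youngIdemOf_mul_mul_eq_zero ψ' ψ (Ne.symm h) hw)))

theorem id_mem_span_zOf (Φ : ∀ μ : YoungDiagram, μ.card = Fintype.card a.P → (a.P ≃ μ.cells))
    (Ψ : ∀ ν : YoungDiagram, ν.card = Fintype.card a.N → (a.N ≃ ν.cells)) :
    (isoL (Equiv.refl _) (Equiv.refl _) : Diagram a a →₀ K) ∈ Submodule.span K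
      {z | ∃ (μ ν : YoungDiagram) (h : μ.card = Fintype.card a.P) (h' : ν.card = Fintype.card a.N)
        (f g : Diagram a a →₀ K),
        z = compL δ a a a f (compL δ a a a (zOf K (Φ μ h) (Ψ ν h')) g)} := by
  rw [← permL_one_one]
  have h1 := Submodule.apply_mem_map₂ (permL K a) (one_mem_span_youngIdemOf Φ)
    (one_mem_span_youngIdemOf Ψ)
  rw [Submodule.map₂_span_span] at h1
  refine Submodule.span_mono ?_ h1
  rintro _ ⟨_, ⟨μ, h, x, y, rfl⟩, _, ⟨ν, h', x', y', rfl⟩, rfl⟩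
  refine ⟨μ, ν, h, h', permL K a y y', permL K a x x', ?_⟩
  rw [zOf, compL_permL, compL_permL]

end PermL

/-! ### The idempotents `z_λ` -/

section MixedWords

variable {K : Type*} [Field K] {δ : K}

/-- The numbering of the cells of a Young diagram by the black letters of a mixed word. -/
noncomputable def blackNum (r s : ℕ) (μ : YoungDiagram) (h : μ.card = r) :
    (wordRow (mixedWord r s)).P ≃ μ.cells :=
  (μ.cells.equivFin.trans ((finCongr h).trans (blackPos r s))).symm

/-- The numbering of the cells of a Young diagram by the white letters of a mixed word. -/
noncomputable def whiteNum (r s : ℕ) (μ : YoungDiagram) (h : μ.card = s) :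
    (wordRow (mixedWord r s)).N ≃ μ.cells :=
  (μ.cells.equivFin.trans ((finCongr h).trans (whitePos r s))).symm

theorem card_black (r s : ℕ) : Nat.card (wordRow (mixedWord r s)).P = r := by
  rw [← Nat.card_congr (blackPos r s), Nat.card_fin]

theorem card_white (r s : ℕ) : Nat.card (wordRow (mixedWord r s)).N = s := by
  rw [← Nat.card_congr (whitePos r s), Nat.card_fin]

theorem permL_eq_sum {a : Row} [Fintype (Perm a.P)] [Fintype (Perm a.N)] (x : MonoidAlgebra K (Perm a.P))
    (y : MonoidAlgebra K (Perm a.N)) :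
    permL K a x y = ∑ σ, ∑ τ, Finsupp.single (ofIso σ τ) (x.coeff σ * y.coeff τ) := by
  conv_lhs => rw [← sum_coeff_smul_of x, ← sum_coeff_smul_of y]
  rw [map_sum (permL K a), LinearMap.sum_apply]
  refine Finset.sum_congr rfl fun σ _ => ?_
  rw [map_sum]
  refine Finset.sum_congr rfl fun τ _ => ?_
  rw [MonoidAlgebra.of_apply, MonoidAlgebra.of_apply, MonoidAlgebra.smul_single', mul_one,
    MonoidAlgebra.smul_single', mul_one, permL_single]

theorem zIdem_eq (l : Bipartition) [Fintype (wordRow (mixedWord l.1.card l.2.card)).P]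
    [DecidableEq (wordRow (mixedWord l.1.card l.2.card)).P]
    [Fintype (wordRow (mixedWord l.1.card l.2.card)).N]
    [DecidableEq (wordRow (mixedWord l.1.card l.2.card)).N] :
    (zIdem δ l : Diagram (wordRow _) (wordRow _) →₀ K) =
      zOf K (blackNum _ l.2.card l.1 rfl) (whiteNum l.1.card _ l.2 rfl) := by
  classical
  rw [zOf, permL_eq_sum, zIdem]
  refine Fintype.sum_equiv (blackNum l.1.card l.2.card l.1 rfl).symm.permCongr _ _ fun σ => ?_
  refine Fintype.sum_equiv (whiteNum l.1.card l.2.card l.2 rfl).symm.permCongr _ _ fun τ => ?_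
  rw [← domCongr_youngIdem, ← domCongr_youngIdem, MonoidAlgebra.coeff_domCongr,
    MonoidAlgebra.coeff_domCongr]
  congr 2
  · refine congrArg _ ?_
    symm
    rw [MulEquiv.symm_apply_eq]
    rfl
  · refine congrArg _ ?_
    symm
    rw [MulEquiv.symm_apply_eq]
    rfl

theorem comp_mem_nonPropagating {r s : ℕ} {f : End (mixedObj δ r s)} (hf : f ∈ nonPropagating δ r s)
    (g : End (mixedObj δ r s)) : (f ≫ g : End (mixedObj δ r s)) ∈ nonPropagating δ r s := by
  rw [mem_nonPropagating] at hf ⊢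
  exact hf.compL_right g

/-- `J` is spanned by endomorphisms that factor through a shorter word. -/
theorem nonPropagating_le {r s : ℕ} {f : End (mixedObj δ r s)} (hf : f ∈ nonPropagating δ r s) :
    f ∈ Submodule.span K {h : End (mixedObj δ r s) | ∃ r' s', r = r' + 1 ∧ s = s' + 1 ∧
      ∃ (X : mixedObj δ r s ⟶ mixedObj δ r' s') (Y : mixedObj δ r' s' ⟶ mixedObj δ r s),
        h = X ≫ Y} := by
  rw [mem_nonPropagating] at hf
  refine hf.induction (p := fun f : End (mixedObj δ r s) => f ∈ Submodule.span K _) (Submodule.zero_mem _)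
      (fun f g => Submodule.add_mem _) fun X x hX => Submodule.subset_span ?_
  have hex : ∃ n p, X (Sum.inr n) = Sum.inl p := by
    by_contra h
    refine hX ((thru_iff X).2 fun n => ?_)
    rcases hx : X (Sum.inr n) with p | m
    · exact absurd ⟨n, p, hx⟩ h
    · exact ⟨m, rfl⟩
  obtain ⟨n, p, -⟩ := hex
  have hr : 0 < r := by
    rw [← card_black r s]
    exact Nat.card_pos_iff.2 ⟨⟨p⟩, inferInstance⟩
  have hs : 0 < s := by
    rw [← card_white r s]
    exact Nat.card_pos_iff.2 ⟨⟨n⟩, inferInstance⟩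
  refine ⟨r - 1, s - 1, by omega, by omega, ?_⟩
  obtain ⟨Y, Z, hYZ⟩ := exists_factorization (b := wordRow (mixedWord (r - 1) (s - 1))) X hX
    (by rw [card_black, card_black]; omega) (by rw [card_white, card_white]; omega)
  refine ⟨(Finsupp.single Y x : Diagram _ _ →₀ K), (Finsupp.single Z 1 : Diagram _ _ →₀ K), ?_⟩
  have h1 := compL_single δ Y Z x 1
  rw [hYZ, pow_zero, mul_one, mul_one] at h1
  exact h1.symm

variable [CharZero K]

theorem zIdem_comp_self (l : Bipartition) : zIdem δ l ≫ zIdem δ l = zIdem δ l := by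
  classical
  have := Fintype.ofFinite (wordRow (mixedWord l.1.card l.2.card)).P
  have := Fintype.ofFinite (wordRow (mixedWord l.1.card l.2.card)).N
  have h := zOf_comp_self (δ := δ) (K := K) (blackNum _ l.2.card l.1 rfl) (whiteNum l.1.card _ l.2 rfl)
  rw [← zIdem_eq (δ := δ)] at h
  exact h

theorem zIdem_notMem (l : Bipartition) : zIdem δ l ∉ nonPropagating δ l.1.card l.2.card := by
  classical
  have := Fintype.ofFinite (wordRow (mixedWord l.1.card l.2.card)).P
  have := Fintype.ofFinite (wordRow (mixedWord l.1.card l.2.card)).N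
  have h := not_NP_zOf (K := K) (blackNum _ l.2.card l.1 rfl) (whiteNum l.1.card _ l.2 rfl)
  rw [← zIdem_eq (δ := δ)] at h
  rwa [mem_nonPropagating]

theorem zIdem_comp_comp (l : Bipartition) (f : End (mixedObj δ l.1.card l.2.card)) :
    ∃ s : K, zIdem δ l * f * zIdem δ l - s • zIdem δ l ∈
      nonPropagating δ l.1.card l.2.card := by
  classical
  have := Fintype.ofFinite (wordRow (mixedWord l.1.card l.2.card)).P
  have := Fintype.ofFinite (wordRow (mixedWord l.1.card l.2.card)).N
  obtain ⟨s, hs⟩ := zOf_comp_comp (δ := δ) (K := K) (blackNum _ l.2.card l.1 rfl)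
    (whiteNum l.1.card _ l.2 rfl) f
  refine ⟨s, ?_⟩
  rw [← zIdem_eq (δ := δ)] at hs
  rw [mem_nonPropagating]
  exact hs

/-- For different bipartitions there is no way to get back and forth between `z_λ` and `z_μ`
modulo `J`. -/
theorem zIdem_comp_comp_mem {l m : Bipartition} (hlm : l ≠ m)
    (f : mixedObj δ l.1.card l.2.card ⟶ mixedObj δ m.1.card m.2.card)
    (g : mixedObj δ m.1.card m.2.card ⟶ mixedObj δ l.1.card l.2.card) :
    (zIdem δ l ≫ f ≫ zIdem δ m ≫ g : End _) ∈ nonPropagating δ l.1.card l.2.card ∨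
      (zIdem δ m ≫ g ≫ zIdem δ l ≫ f : End _) ∈ nonPropagating δ m.1.card m.2.card := by
  classical
  have key : ∀ {r s r' s' : ℕ} (hr : r = r') (hs : s = s') {μ ν μ' ν' : YoungDiagram}
      [Fintype (wordRow (mixedWord r s)).P] [Fintype (wordRow (mixedWord r s)).N]
      [Fintype (wordRow (mixedWord r' s')).P] [Fintype (wordRow (mixedWord r' s')).N]
      (φ : (wordRow (mixedWord r s)).P ≃ μ.cells) (ψ : (wordRow (mixedWord r s)).N ≃ ν.cells)
      (φ' : (wordRow (mixedWord r' s')).P ≃ μ'.cells) (ψ' : (wordRow (mixedWord r' s')).N ≃ ν'.cells)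
      (z : mixedObj δ r s ⟶ mixedObj δ r s) (z' : mixedObj δ r' s' ⟶ mixedObj δ r' s')
      (f : mixedObj δ r s ⟶ mixedObj δ r' s') (g : mixedObj δ r' s' ⟶ mixedObj δ r s),
      z = zOf K φ ψ → z' = zOf K φ' ψ' → ¬ (μ = μ' ∧ ν = ν') →
      (z ≫ f ≫ z' ≫ g : End _) ∈ nonPropagating δ r s ∨
        (z' ≫ g ≫ z ≫ f : End _) ∈ nonPropagating δ r' s' := by
    intro r s r' s' hr hs μ ν μ' ν' i1 i2 i3 i4 φ ψ φ' ψ' z z' f g hz hz' hne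
    subst hr hs
    obtain rfl : i3 = i1 := Subsingleton.elim _ _
    obtain rfl : i4 = i2 := Subsingleton.elim _ _
    rcases zOf_comp_comp_NP (δ := δ) (K := K) φ ψ φ' ψ' hne with h | h
    · left
      have h1 := (mem_nonPropagating (δ := δ) (z ≫ f ≫ z')).2 (by rw [hz, hz']; exact h f)
      have h2 := comp_mem_nonPropagating h1 g
      rwa [Category.assoc, Category.assoc] at h2
    · right
      have h1 := (mem_nonPropagating (δ := δ) (z' ≫ g ≫ z)).2 (by rw [hz, hz']; exact h g)
      have h2 := comp_mem_nonPropagating h1 f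
      rwa [Category.assoc, Category.assoc] at h2
  have := Fintype.ofFinite (wordRow (mixedWord l.1.card l.2.card)).P
  have := Fintype.ofFinite (wordRow (mixedWord l.1.card l.2.card)).N
  have := Fintype.ofFinite (wordRow (mixedWord m.1.card m.2.card)).P
  have := Fintype.ofFinite (wordRow (mixedWord m.1.card m.2.card)).N
  by_cases h1 : m.1.card < l.1.card ∨ m.2.card < l.2.card
  · left
    rw [mem_nonPropagating]
    have h2 : NP (zIdem δ l ≫ f : Diagram (wordRow _) (wordRow _) →₀ K) :=
      NP.of_card_lt (by rwa [card_black, card_black, card_white, card_white]) _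
    have h3 := h2.compL_right (δ := δ) (zIdem δ m ≫ g)
    have h4 : zIdem δ l ≫ f ≫ zIdem δ m ≫ g = (zIdem δ l ≫ f) ≫ zIdem δ m ≫ g := by
      rw [Category.assoc]
    rw [h4]
    exact h3
  by_cases h1' : l.1.card < m.1.card ∨ l.2.card < m.2.card
  · right
    rw [mem_nonPropagating]
    have h2 : NP (zIdem δ m ≫ g : Diagram (wordRow _) (wordRow _) →₀ K) :=
      NP.of_card_lt (by rwa [card_black, card_black, card_white, card_white]) _
    have h3 := h2.compL_right (δ := δ) (zIdem δ l ≫ f)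
    have h4 : zIdem δ m ≫ g ≫ zIdem δ l ≫ f = (zIdem δ m ≫ g) ≫ zIdem δ l ≫ f := by
      rw [Category.assoc]
    rw [h4]
    exact h3
  exact key (by omega) (by omega) _ _ _ _ _ _ f g (zIdem_eq l) (zIdem_eq m) fun h =>
    hlm (Prod.ext h.1 h.2)

/-- The idempotents `z_λ` of the bipartitions of size `(r, s)` generate the unit ideal. -/
theorem id_mem_span_zIdem (r s : ℕ) : (𝟙 (mixedObj δ r s) : End (mixedObj δ r s)) ∈ Submodule.span K
    {h : End (mixedObj δ r s) | ∃ (l : Bipartition)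
      (f : mixedObj δ r s ⟶ mixedObj δ l.1.card l.2.card)
      (g : mixedObj δ l.1.card l.2.card ⟶ mixedObj δ r s),
      l.1.card = r ∧ l.2.card = s ∧ h = f ≫ zIdem δ l ≫ g} := by
  classical
  have := Fintype.ofFinite (wordRow (mixedWord r s)).P
  have := Fintype.ofFinite (wordRow (mixedWord r s)).N
  have hP : Fintype.card (wordRow (mixedWord r s)).P = r := by
    rw [← Nat.card_eq_fintype_card, card_black]
  have hN : Fintype.card (wordRow (mixedWord r s)).N = s := by
    rw [← Nat.card_eq_fintype_card, card_white]
  have h := id_mem_span_zOf (δ := δ) (K := K) (a := wordRow (mixedWord r s))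
    (fun μ h => blackNum r s μ (h.trans hP)) (fun ν h => whiteNum r s ν (h.trans hN))
  refine Submodule.span_mono ?_ h
  rintro _ ⟨μ, ν, h, h', f, g, rfl⟩
  obtain rfl : μ.card = r := h.trans hP
  obtain rfl : ν.card = s := h'.trans hN
  refine ⟨(μ, ν), f, g, rfl, rfl, ?_⟩
  have h1 := zIdem_eq (δ := δ) (μ, ν)
  exact congrArg (fun z => compL δ _ _ _ f (compL δ _ _ _ z g)) h1.symm

end MixedWords

/-! ### Local objects -/

section LocalObjects

variable {C : Type*} [Category* C] [Preadditive C]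

/-- A nonzero object all of whose endomorphisms are invertible or nilpotent. -/
def IsLocalObj (X : C) : Prop :=
  𝟙 X ≠ 0 ∧ ∀ f : End X, IsIso (f : X ⟶ X) ∨ ∃ n : ℕ, f ^ (n + 1) = 0

theorem IsLocalObj.not_isIso_zero {X : C} (hX : IsLocalObj X) : ¬ IsIso (0 : X ⟶ X) := fun h =>
  hX.1 (by rw [← IsIso.hom_inv_id (0 : X ⟶ X), Limits.zero_comp])

theorem IsLocalObj.not_isIso_of_pow {X : C} (hX : IsLocalObj X) (f : End X) (n : ℕ)
    (h : f ^ n = 0) : ¬ IsIso (f : X ⟶ X) := fun hf => by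
  have h1 : IsUnit (f ^ n) := ((isUnit_iff_isIso f).2 hf).pow n
  rw [h] at h1
  exact hX.not_isIso_zero ((isUnit_iff_isIso (0 : X ⟶ X)).1 h1)

theorem IsLocalObj.isIso_or_of_add {X : C} (hX : IsLocalObj X) (f g : X ⟶ X) (h : IsIso (f + g)) :
    IsIso f ∨ IsIso g := by
  have h1 : f ≫ inv (f + g) + g ≫ inv (f + g) = 𝟙 X := by
    rw [← Preadditive.add_comp, IsIso.hom_inv_id]
  rcases hX.2 (f ≫ inv (f + g)) with h2 | ⟨n, hn⟩
  · exact Or.inl (IsIso.of_isIso_comp_right f (inv (f + g)))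
  · have h3 : IsNilpotent (End.of (f ≫ inv (f + g))) := ⟨_, hn⟩
    have h4 : 1 - End.of (f ≫ inv (f + g)) = g ≫ inv (f + g) := by
      rw [sub_eq_iff_eq_add, add_comm]
      exact h1.symm
    have h5 := (isUnit_iff_isIso (C := C) (X := X) _).1 h3.isUnit_one_sub
    rw [h4] at h5
    exact Or.inr (IsIso.of_isIso_comp_right g (inv (f + g)))

theorem IsLocalObj.exists_isIso_of_sum {X : C} (hX : IsLocalObj X) {ι : Type*} (s : Finset ι)
    (f : ι → (X ⟶ X)) (h : IsIso (∑ i ∈ s, f i)) : ∃ i ∈ s, IsIso (f i) := by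
  classical
  induction s using Finset.induction_on with
  | empty => exact absurd h hX.not_isIso_zero
  | insert i s hi ih =>
    rw [Finset.sum_insert hi] at h
    rcases hX.isIso_or_of_add _ _ h with h | h
    · exact ⟨i, Finset.mem_insert_self _ _, h⟩
    · obtain ⟨j, hj, hj'⟩ := ih h
      exact ⟨j, Finset.mem_insert_of_mem hj, hj'⟩

/-- Local objects are isomorphic as soon as an automorphism of one of them factors through the other. -/
theorem IsLocalObj.nonempty_iso {X Y : C} (hX : IsLocalObj X) (hY : IsLocalObj Y) (a : X ⟶ Y) (b : Y ⟶ X)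
    (h : IsIso (a ≫ b)) : Nonempty (X ≅ Y) := by
  rcases hY.2 (b ≫ a) with h1 | ⟨n, hn⟩
  · have h2 : IsSplitMono a := IsSplitMono.mk' ⟨b ≫ inv (a ≫ b), by
      rw [← Category.assoc, IsIso.hom_inv_id]⟩
    have h3 : IsSplitEpi a := IsSplitEpi.mk' ⟨inv (b ≫ a) ≫ b, by
      rw [Category.assoc, IsIso.inv_hom_id]⟩
    have h4 : IsIso a := isIso_of_mono_of_isSplitEpi a
    exact ⟨asIso a⟩
  · exfalso
    refine hX.not_isIso_of_pow _ (n + 2) ?_ h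
    have key : ∀ m : ℕ, End.of (a ≫ b) ^ (m + 1) = a ≫ (End.of (b ≫ a) ^ m) ≫ b := by
      intro m
      induction m with
      | zero => rw [zero_add, pow_one, pow_zero]; exact (congrArg (a ≫ ·) (Category.id_comp b)).symm
      | succ m ih =>
        rw [pow_succ' _ (m + 1), ih, pow_succ' (End.of (b ≫ a)) m, End.mul_def, End.mul_def]
        simp only [Category.assoc]
    rw [key, hn]
    exact (congrArg (a ≫ ·) Limits.zero_comp).trans Limits.comp_zero

theorem IsLocalObj.of_iso {X Y : C} (hX : IsLocalObj X) (e : X ≅ Y) : IsLocalObj Y := by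
  have key : ∀ (f : End Y) (m : ℕ), f ^ m = e.inv ≫ (End.of (e.hom ≫ f ≫ e.inv) ^ m) ≫ e.hom := by
    intro f m
    induction m with
    | zero => 
      rw [pow_zero, pow_zero]
      exact (by simp : 𝟙 Y = e.inv ≫ 𝟙 X ≫ e.hom)
    | succ m ih =>
      rw [pow_succ', pow_succ', ih, End.mul_def, End.mul_def]
      simp
  refine ⟨fun h => hX.1 ?_, fun f => ?_⟩
  · rw [← e.hom_inv_id, ← Category.id_comp e.inv, h, Limits.zero_comp, Limits.comp_zero]
  · rcases hX.2 (e.hom ≫ f ≫ e.inv) with h | ⟨n, hn⟩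
    · left
      have : f = e.inv ≫ (e.hom ≫ f ≫ e.inv) ≫ e.hom := by simp
      rw [this]
      infer_instance
    · right
      refine ⟨n, ?_⟩
      rw [key, hn]
      exact (congrArg (e.inv ≫ ·) Limits.zero_comp).trans Limits.comp_zero

theorem IsLocalObj.isIndecomposable {X : C} (hX : IsLocalObj X) : IsIndecomposable X := by
  intro X₁ X₂ B
  rcases hX.isIso_or_of_add (B.p₁ ≫ B.i₁) (B.p₂ ≫ B.i₂) (by rw [B.total]; infer_instance) with h | h
  · right
    have : (B.p₁ ≫ B.i₁) ≫ B.p₂ ≫ B.i₂ = 0 := by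
      rw [Category.assoc, ← Category.assoc B.i₁, B.i₁_p₂, Limits.zero_comp, Limits.comp_zero]
    rw [← cancel_epi (B.p₁ ≫ B.i₁), this, Limits.comp_zero]
  · left
    have : (B.p₂ ≫ B.i₂) ≫ B.p₁ ≫ B.i₁ = 0 := by
      rw [Category.assoc, ← Category.assoc B.i₂, B.i₂_p₁, Limits.zero_comp, Limits.comp_zero]
    rw [← cancel_epi (B.p₂ ≫ B.i₂), this, Limits.comp_zero]

/-- The image of a local object under a full functor is local or zero. -/
theorem IsLocalObj.map {X : C} (hX : IsLocalObj X) {D : Type*} [Category* D] [Preadditive D] (F : C ⥤ D)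
    [F.Full] [F.Additive] (h : ¬ Limits.IsZero (F.obj X)) : IsLocalObj (F.obj X) := by
  refine ⟨fun h' => h ((Limits.IsZero.iff_id_eq_zero _).2 h'), fun f => ?_⟩
  obtain ⟨f, rfl⟩ := F.map_surjective f
  rcases hX.2 f with h | ⟨n, hn⟩
  · exact Or.inl inferInstance
  · refine Or.inr ⟨n, ?_⟩
    have := congrArg (F.mapEnd X) hn
    rw [map_pow] at this
    exact this.trans (F.map_zero _ _)

end LocalObjects

/-! ### Images of idempotents -/

section Image

variable {K : Type*} [Field K] {δ : K} {w : Rep0 δ}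

/-- The inclusion of the image of an idempotent. -/
noncomputable def imageι (e : w ⟶ w) (he : e ≫ e = e) : RepGL.image e he ⟶ (RepGL.incl δ).obj w where
  f := (Mat_.embedding (Rep0 δ)).map e
  comm := by
    change (Mat_.embedding (Rep0 δ)).map e ≫ (Mat_.embedding (Rep0 δ)).map e ≫ 𝟙 _ = _
    rw [Category.comp_id, ← Functor.map_comp, he]

/-- The projection to the image of an idempotent. -/
noncomputable def imageπ (e : w ⟶ w) (he : e ≫ e = e) : (RepGL.incl δ).obj w ⟶ RepGL.image e he where
  f := (Mat_.embedding (Rep0 δ)).map e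
  comm := by
    change 𝟙 _ ≫ (Mat_.embedding (Rep0 δ)).map e ≫ (Mat_.embedding (Rep0 δ)).map e = _
    rw [Category.id_comp, ← Functor.map_comp, he]

theorem imageι_π (e : w ⟶ w) (he : e ≫ e = e) : imageι e he ≫ imageπ e he = 𝟙 _ := by
  apply Idempotents.Karoubi.hom_ext
  change (Mat_.embedding (Rep0 δ)).map e ≫ (Mat_.embedding (Rep0 δ)).map e = _
  rw [← Functor.map_comp, he]
  rfl

theorem imageπ_ι (e : w ⟶ w) (he : e ≫ e = e) :
    imageπ e he ≫ imageι e he = (RepGL.incl δ).map e := by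
  apply Idempotents.Karoubi.hom_ext
  change (Mat_.embedding (Rep0 δ)).map e ≫ (Mat_.embedding (Rep0 δ)).map e = _
  rw [← Functor.map_comp, he]
  rfl

instance (w w' : Rep0 δ) : Module.Finite K (w ⟶ w') :=
  inferInstanceAs (Module.Finite K (Diagram (wordRow w.word) (wordRow w'.word) →₀ K))

instance (w : Rep0 δ) : FiniteDimensional K (End w) :=
  inferInstanceAs (Module.Finite K (w ⟶ w))

/-- The endomorphism ring of the image of `e` is `e * A * e`, where `A` is the endomorphism algebra of
the word. -/
theorem isLocalObj_image (e : End w) (he : IsPrimitive e) :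
    IsLocalObj (RepGL.image (δ := δ) e he.idem) := by
  set i := imageι (δ := δ) e he.idem
  set p := imageπ (δ := δ) e he.idem
  have hip : i ≫ p = 𝟙 _ := imageι_π _ _
  have hpi : p ≫ i = (RepGL.incl δ).map e := imageπ_ι _ _
  refine ⟨fun h => he.ne_zero ?_, fun f => ?_⟩
  · apply (RepGL.incl δ).map_injective
    rw [Functor.map_zero, ← hpi, ← Category.id_comp i, h, Limits.zero_comp, Limits.comp_zero]
  · obtain ⟨y, hy⟩ := (RepGL.incl δ).map_surjective (p ≫ f ≫ i)
    have h1 : y ≫ e = y := (RepGL.incl δ).map_injective (by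
      rw [Functor.map_comp, hy, ← hpi]
      simp only [Category.assoc]
      rw [← Category.assoc i, hip, Category.id_comp])
    have h2 : e ≫ y = y := (RepGL.incl δ).map_injective (by
      rw [Functor.map_comp, hy, ← hpi]
      simp only [Category.assoc]
      rw [← Category.assoc i, hip, Category.id_comp])
    have hf : f = i ≫ (RepGL.incl δ).map y ≫ p := by
      rw [hy]
      simp only [Category.assoc]
      rw [hip, Category.comp_id, ← Category.assoc, hip, Category.id_comp]
    rcases he.nilpotent_or_unit (K := K) (y : End w) h1 h2 with ⟨n, hn⟩ | ⟨u, hu1, hu2⟩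
    · right
      refine ⟨n, ?_⟩
      have key : ∀ m : ℕ, f ^ (m + 1) = i ≫ (RepGL.incl δ).map (End.of y ^ (m + 1)) ≫ p := by
        intro m
        induction m with
        | zero => rw [zero_add, pow_one, pow_one]; exact hf
        | succ m ih =>
          rw [pow_succ, ih, pow_succ _ (m + 1), End.mul_def, End.mul_def, Functor.map_comp]
          conv_lhs => rw [hf]
          simp only [Category.assoc]
          rw [← Category.assoc p i, hpi, ← Category.assoc ((RepGL.incl δ).map y),
            ← Functor.map_comp, h1]
      rw [key, hn]
      have h0 : (RepGL.incl δ).map (0 : w ⟶ w) = 0 := Functor.map_zero _ _ _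
      exact (congrArg (fun t => i ≫ t ≫ p) h0).trans (by rw [Limits.zero_comp, Limits.comp_zero])
    · left
      have h3 : ∀ a b : w ⟶ w, a ≫ e = a → a ≫ b = e →
          (i ≫ (RepGL.incl δ).map a ≫ p) ≫ (i ≫ (RepGL.incl δ).map b ≫ p) = 𝟙 _ := by
        intro a b ha hab
        have hc : (RepGL.incl δ).map a ≫ (RepGL.incl δ).map e ≫ (RepGL.incl δ).map b =
            (RepGL.incl δ).map e := by
          rw [← Category.assoc, ← Functor.map_comp, ha, ← Functor.map_comp, hab]
        simp only [Category.assoc]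
        rw [← Category.assoc p i, hpi]
        have hc' := congrArg (fun t => i ≫ t ≫ p) hc
        simp only [Category.assoc] at hc' ⊢
        rw [hc', ← hpi, Category.assoc, hip, Category.comp_id, hip]
      have hue : (e ≫ u ≫ e) ≫ e = e ≫ u ≫ e := by
        rw [Category.assoc, Category.assoc]
        exact congrArg (fun t => e ≫ u ≫ t) he.idem
      have hyu : y ≫ u = e := hu2
      have huy : u ≫ y = e := hu1
      have hee : e ≫ e = e := he.idem
      rw [hf]
      refine ⟨i ≫ (RepGL.incl δ).map (e ≫ u ≫ e) ≫ p, h3 _ _ h1 ?_, h3 _ _ hue ?_⟩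
      · rw [← Category.assoc, h1, ← Category.assoc, hyu, hee]
      · rw [Category.assoc, Category.assoc, h2, huy, hee]

end Image

/-! ### Classification of the local summands of words -/

section Classification

variable {K : Type*} [Field K] {δ : K}

/-- Non-isomorphisms of a local object are closed under sums, so that a linear combination that
induces an isomorphism has a term that does. -/
theorem IsLocalObj.exists_isIso_of_mem_span {X : RepGL δ} (hX : IsLocalObj X) {w w' : Rep0 δ}
    (i : X ⟶ (RepGL.incl δ).obj w) (p : (RepGL.incl δ).obj w' ⟶ X) (S : Set (w ⟶ w')) (h : w ⟶ w')
    (hS : h ∈ Submodule.span K S) (hi : IsIso (i ≫ (RepGL.incl δ).map h ≫ p)) :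
    ∃ c : K, ∃ g ∈ S, IsIso (i ≫ (RepGL.incl δ).map (c • g) ≫ p) := by
  obtain ⟨n, c, g, rfl⟩ := (Submodule.mem_span_set' (R := K)).1 hS
  rw [Functor.map_sum, Preadditive.sum_comp, Preadditive.comp_sum] at hi
  obtain ⟨j, -, hj⟩ := hX.exists_isIso_of_sum _ _ hi
  exact ⟨c j, g j, (g j).2, hj⟩

/-- A decomposition of `z_λ` has at most one member outside `J`, as `z_λ` is primitive modulo `J`. -/
theorem mem_nonPropagating_of_ne [CharZero K] (l : Bipartition) {k : ℕ}
    (f : Fin k → End (mixedObj δ l.1.card l.2.card)) (hf : ∀ i, IsPrimitive (f i))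
    (horth : ∀ i j, i ≠ j → f i * f j = 0) (hsum : ∑ i, f i = zIdem δ l) {i j : Fin k} (hij : i ≠ j)
    (hi : f i ∉ nonPropagating δ l.1.card l.2.card) :
    f j ∈ nonPropagating δ l.1.card l.2.card := by
  have hz := mul_sum_of_orthogonal (fun i => (hf i).idem) horth hsum
  obtain ⟨s, hs⟩ := zIdem_comp_comp l (f j)
  rw [(hz j).2, (hz j).1] at hs
  by_cases h0 : s = 0
  · rwa [h0, zero_smul, sub_zero] at hs
  · exfalso
    apply hi
    have h1 : f i * (f j - s • zIdem δ l) ∈ nonPropagating δ l.1.card l.2.card :=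
      comp_mem_nonPropagating hs (f i)
    rw [mul_sub, horth _ _ hij, mul_smul_comm, (hz i).1, zero_sub] at h1
    have h2 := Submodule.smul_mem _ (-s⁻¹) h1
    rwa [smul_neg, neg_smul, neg_neg, smul_smul, inv_mul_cancel₀ h0, one_smul] at h2

theorem exists_isL [CharZero K] (l : Bipartition) : ∃ X : RepGL δ, IsL δ l X := by
  obtain ⟨k, f, hf, horth, hsum⟩ := exists_primitive_decomposition K (zIdem δ l)
    (zIdem_comp_self (δ := δ) (l := l))
  by_cases h : ∃ i, f i ∉ nonPropagating δ l.1.card l.2.card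
  · obtain ⟨i, hi⟩ := h
    exact ⟨_, f i, ⟨hf i, ⟨k, f, hf, horth, hsum, i, rfl⟩, hi⟩, ⟨Iso.refl _⟩⟩
  · push Not at h
    exact absurd (hsum ▸ Submodule.sum_mem _ fun i _ => h i) (zIdem_notMem (δ := δ) (l := l))

theorem IsL.isLocalObj {l : Bipartition} {X : RepGL δ} (h : IsL δ l X) : IsLocalObj X := by
  obtain ⟨e, he, ⟨φ⟩⟩ := h
  exact (isLocalObj_image e he.primitive).of_iso φ.symm

/-- The identity of `•^r∘^s` is a combination of morphisms through the idempotents `z_λ` and of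
morphisms through shorter words. Hence a local summand is one of the objects `L(λ)`, by induction
on `r`. -/
theorem exists_iso_of_retract [CharZero K] {L : Bipartition → RepGL δ} (hL : ∀ l, IsL δ l (L l)) (r : ℕ) :
    ∀ (s : ℕ) (X : RepGL δ), IsLocalObj X → ∀ (i : X ⟶ (RepGL.incl δ).obj (mixedObj δ r s))
      (p : (RepGL.incl δ).obj (mixedObj δ r s) ⟶ X), i ≫ p = 𝟙 X → ∃ l, Nonempty (X ≅ L l) := by
  induction r using Nat.strong_induction_on with
  | _ r ih =>
  intro s X hX i p hip
  obtain ⟨c, _, ⟨l, f, g, rfl, rfl, rfl⟩, hiso⟩ := hX.exists_isIso_of_mem_span i p _ _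
    (id_mem_span_zIdem (δ := δ) r s) (by
      rw [CategoryTheory.Functor.map_id, Category.id_comp, hip]; infer_instance)
  rw [← Linear.smul_comp] at hiso
  generalize c • f = f at hiso
  obtain ⟨e, he, ⟨φ⟩⟩ := hL l
  obtain ⟨k, F, hF, horth, hsum, j₀, rfl⟩ := he.exists_decomposition
  have hsplit : i ≫ (RepGL.incl δ).map (f ≫ zIdem δ l ≫ g) ≫ p =
      ∑ j, (i ≫ (RepGL.incl δ).map f) ≫ (RepGL.incl δ).map (F j) ≫ (RepGL.incl δ).map g ≫ p := by
    rw [← hsum]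
    have h1 : (∑ j, F j) ≫ g = ∑ j, (F j ≫ g : _ ⟶ _) := Preadditive.sum_comp _ _ _
    rw [h1, Preadditive.comp_sum, Functor.map_sum, Preadditive.sum_comp, Preadditive.comp_sum]
    simp only [Functor.map_comp, Category.assoc]
  rw [hsplit] at hiso
  obtain ⟨j, -, hj⟩ := hX.exists_isIso_of_sum _ _ hiso
  -- Either the term of `e_λ` is invertible, or one of the other members, which lie in `J`.
  by_cases hjj : j₀ = j
  · subst hjj
    refine ⟨l, ?_⟩
    have h2 := imageπ_ι (F j₀) he.primitive.idem
    obtain ⟨ψ⟩ := hX.nonempty_iso (isLocalObj_image (F j₀) he.primitive)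
      ((i ≫ (RepGL.incl δ).map f) ≫ imageπ (F j₀) he.primitive.idem)
      (imageι (F j₀) he.primitive.idem ≫ (RepGL.incl δ).map g ≫ p) (by
        rw [← h2] at hj
        simpa only [Category.assoc] using hj)
    exact ⟨ψ ≪≫ φ.symm⟩
  · have hJ := nonPropagating_le (mem_nonPropagating_of_ne l F hF horth hsum hjj he.not_mem)
    obtain ⟨c, _, ⟨r', s', hr, hs, A, B, rfl⟩, hiso'⟩ :=
      hX.exists_isIso_of_mem_span _ _ _ _ hJ hj
    rw [← Linear.smul_comp] at hiso'
    generalize c • A = A at hiso'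
    refine ih r' (by omega) s' X hX ((i ≫ (RepGL.incl δ).map f) ≫ (RepGL.incl δ).map A)
      ((RepGL.incl δ).map B ≫ ((RepGL.incl δ).map g ≫ p) ≫ inv ((i ≫ (RepGL.incl δ).map f) ≫
        (RepGL.incl δ).map (A ≫ B) ≫ (RepGL.incl δ).map g ≫ p)) ?_
    · have := IsIso.hom_inv_id
        ((i ≫ (RepGL.incl δ).map f) ≫ (RepGL.incl δ).map (A ≫ B) ≫ (RepGL.incl δ).map g ≫ p)
      simpa only [Functor.map_comp, Category.assoc] using this

theorem IsELambda.zIdem_comp {l : Bipartition} {e : End (mixedObj δ l.1.card l.2.card)}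
    (he : IsELambda δ l e) : zIdem δ l ≫ e = e := by
  obtain ⟨k, F, hF, horth, hsum, j, rfl⟩ := he.exists_decomposition
  exact (mul_sum_of_orthogonal (fun i => (hF i).idem) horth hsum j).1

/-- An isomorphism between `L(λ)` and `L(μ)` would factor `e_λ` and `e_μ` through each other, but for
`λ ≠ μ` one of these factorizations lies in `J`. -/
theorem IsL.eq_of_iso [CharZero K] {l m : Bipartition} {X Y : RepGL δ} (hX : IsL δ l X) (hY : IsL δ m Y)
    (φ : X ≅ Y) : l = m := by
  by_contra hlm
  obtain ⟨e, he, ⟨a⟩⟩ := hX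
  obtain ⟨e', he', ⟨b⟩⟩ := hY
  let ψ := a.symm ≪≫ φ ≪≫ b
  obtain ⟨f, hf⟩ := (RepGL.incl δ).map_surjective
    (imageπ e he.primitive.idem ≫ ψ.hom ≫ imageι e' he'.primitive.idem)
  obtain ⟨g, hg⟩ := (RepGL.incl δ).map_surjective
    (imageπ e' he'.primitive.idem ≫ ψ.inv ≫ imageι e he.primitive.idem)
  have h1 : f ≫ g = e := (RepGL.incl δ).map_injective (by
    rw [Functor.map_comp, hf, hg, ← imageπ_ι e he.primitive.idem]
    simp only [Category.assoc]
    rw [← Category.assoc (imageι _ _) (imageπ _ _), imageι_π, Category.id_comp, ψ.hom_inv_id_assoc])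
  have h2 : g ≫ f = e' := (RepGL.incl δ).map_injective (by
    rw [Functor.map_comp, hf, hg, ← imageπ_ι e' he'.primitive.idem]
    simp only [Category.assoc]
    rw [← Category.assoc (imageι _ _) (imageπ _ _), imageι_π, Category.id_comp, ψ.inv_hom_id_assoc])
  have h3 : e ≫ f = f := (RepGL.incl δ).map_injective (by
    rw [Functor.map_comp, hf, ← imageπ_ι e he.primitive.idem]
    simp only [Category.assoc]
    rw [← Category.assoc (imageι _ _) (imageπ _ _), imageι_π, Category.id_comp])
  have h4 : e' ≫ g = g := (RepGL.incl δ).map_injective (by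
    rw [Functor.map_comp, hg, ← imageπ_ι e' he'.primitive.idem]
    simp only [Category.assoc]
    rw [← Category.assoc (imageι _ _) (imageπ _ _), imageι_π, Category.id_comp])
  have h5 : zIdem δ l ≫ f = f := by
    rw [← h3, ← Category.assoc]
    exact congrArg (· ≫ f) he.zIdem_comp
  have h6 : zIdem δ m ≫ g = g := by
    rw [← h4, ← Category.assoc]
    exact congrArg (· ≫ g) he'.zIdem_comp
  rcases zIdem_comp_comp_mem hlm f g with h | h
  · rw [h6, ← Category.assoc, h5, h1] at h
    exact he.not_mem h
  · rw [h5, ← Category.assoc, h6, h2] at h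
    exact he'.not_mem h

end Classification

/-! ### Duality and fullness -/

section Pairing

open Functor.LaxMonoidal Functor.OplaxMonoidal

variable {C D : Type*} [Category* C] [Category* D] [MonoidalCategory C] [MonoidalCategory D]
  (F : C ⥤ D) [F.Monoidal]

/-- A monoidal functor preserves dual pairs. -/
@[reducible]
def mapExactPairing (X Y : C) [ExactPairing X Y] : ExactPairing (F.obj X) (F.obj Y) where
  coevaluation' := ε F ≫ F.map (η_ X Y) ≫ δ F X Y
  evaluation' := μ F Y X ≫ F.map (ε_ X Y) ≫ η F
  coevaluation_evaluation' := by
    have h := congrArg F.map (ExactPairing.coevaluation_evaluation X Y)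
    have h' := congrArg (fun t => F.obj Y ◁ ε F ≫ μ F _ _ ≫ t ≫ δ F _ _ ≫ η F ▷ _) h
    simp only [Functor.map_comp, Category.assoc] at h'
    rw [Functor.Monoidal.map_associator_inv']
    simp only [MonoidalCategory.whiskerLeft_comp, comp_whiskerRight, Category.assoc,
      Functor.Monoidal.whiskerLeft_δ_μ_assoc, Functor.Monoidal.whiskerRight_δ_μ_assoc,
      μ_natural_right_assoc, δ_natural_left_assoc]
    rw [h']
    simp
  evaluation_coevaluation' := by
    have h := congrArg F.map (ExactPairing.evaluation_coevaluation X Y)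
    have h' := congrArg (fun t => ε F ▷ F.obj X ≫ μ F _ _ ≫ t ≫ δ F _ _ ≫ _ ◁ η F) h
    simp only [Functor.map_comp, Category.assoc] at h'
    rw [Functor.Monoidal.map_associator']
    simp only [MonoidalCategory.whiskerLeft_comp, comp_whiskerRight, Category.assoc,
      Functor.Monoidal.whiskerLeft_δ_μ_assoc, Functor.Monoidal.whiskerRight_δ_μ_assoc,
      μ_natural_left_assoc, δ_natural_right_assoc]
    rw [h']
    simp

/-- Surjectivity on morphisms is carried over by the bijection between `Hom(Y' ⊗ a, b)` and
`Hom(a, Y ⊗ b)`, which monoidal functors respect. -/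
theorem map_surjective_tensorLeft {Y Y' : C} [ExactPairing Y Y'] (a b : C)
    (h : Function.Surjective (F.map : (a ⟶ Y ⊗ b) → _)) :
    Function.Surjective (F.map : (Y' ⊗ a ⟶ b) → _) := fun f => by
  let _ := mapExactPairing F Y Y'
  obtain ⟨k, hk⟩ := h (tensorLeftHomEquiv (F.obj a) (F.obj Y) (F.obj Y') (F.obj b) (μ F Y' a ≫ f) ≫ μ F Y b)
  refine ⟨(tensorLeftHomEquiv a Y Y' b).symm k, ?_⟩
  have h1 := (tensorLeftHomEquiv (F.obj a) (F.obj Y) (F.obj Y') (F.obj b)).symm_apply_apply (μ F Y' a ≫ f)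
  rw [← cancel_epi (μ F Y' a), ← h1]
  generalize tensorLeftHomEquiv (F.obj a) (F.obj Y) (F.obj Y') (F.obj b) (μ F Y' a ≫ f) = g at *
  have h2 : (ε_ (F.obj Y) (F.obj Y')) = μ F Y' Y ≫ F.map (ε_ Y Y') ≫ η F := rfl
  simp only [tensorLeftHomEquiv, Equiv.coe_fn_symm_mk, Functor.map_comp, h2]
  rw [Functor.Monoidal.map_associator_inv', Functor.Monoidal.map_leftUnitor]
  simp only [MonoidalCategory.whiskerLeft_comp, comp_whiskerRight, Category.assoc,
      Functor.Monoidal.whiskerRight_δ_μ_assoc, ← μ_natural_right_assoc, ← δ_natural_left_assoc, hk]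
  

theorem map_surjective_tensorLeft_symm {Y Y' : C} [ExactPairing Y Y'] (a b : C)
    (h : Function.Surjective (F.map : (Y' ⊗ a ⟶ b) → _)) :
    Function.Surjective (F.map : (a ⟶ Y ⊗ b) → _) := fun f => by
  let _ := mapExactPairing F Y Y'
  obtain ⟨k, hk⟩ := h (δ F Y' a ≫
    (tensorLeftHomEquiv (F.obj a) (F.obj Y) (F.obj Y') (F.obj b)).symm (f ≫ δ F Y b))
  refine ⟨tensorLeftHomEquiv a Y Y' b k, ?_⟩
  have h1 := (tensorLeftHomEquiv (F.obj a) (F.obj Y) (F.obj Y') (F.obj b)).apply_symm_apply (f ≫ δ F Y b)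
  rw [← cancel_mono (δ F Y b), ← h1]
  generalize (tensorLeftHomEquiv (F.obj a) (F.obj Y) (F.obj Y') (F.obj b)).symm (f ≫ δ F Y b) = g at *
  have h2 : (η_ (F.obj Y) (F.obj Y')) = ε F ≫ F.map (η_ Y Y') ≫ δ F Y Y' := rfl
  simp only [tensorLeftHomEquiv, Equiv.coe_fn_mk, Functor.map_comp, h2]
  rw [Functor.Monoidal.map_associator', Functor.Monoidal.map_leftUnitor_inv]
  simp only [MonoidalCategory.whiskerLeft_comp, comp_whiskerRight, Category.assoc,
      Functor.Monoidal.whiskerRight_δ_μ_assoc, ← μ_natural_left_assoc, ← δ_natural_right, hk]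

end Pairing

/-! ### Duality of rows -/

section RowPairing

variable {K : Type*} [Field K]

/-- The row with the colours exchanged. -/
abbrev Row.dual (a : Row) : Row := ⟨a.N, a.P⟩

/-- The diagram with empty bottom row that joins each vertex to its copy in the dual row. -/
def Row.coev (a : Row) : Diagram Row.one (a.tensor a.dual) :=
  (emptySum _ _).trans ((sumComm _ _).trans (sumEmpty _ _).symm)

/-- The diagram with empty top row that joins each vertex to its copy in the dual row. -/
def Row.ev (a : Row) : Diagram (a.dual.tensor a) Row.one :=
  (sumEmpty _ _).trans ((sumComm _ _).trans (emptySum _ _).symm)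

/-- The first triangle identity: following the strands gives the identity diagram without loops. -/
theorem Row.coev_ev (a : Row) :
    DeligneGL.comp (tens (ofIso (Equiv.refl a.dual.P) (Equiv.refl a.dual.N)) a.coev)
      ((sumCongr (sumAssoc _ _ _).symm (Equiv.refl _)).trans
        ((tens a.ev (ofIso (Equiv.refl a.dual.P) (Equiv.refl a.dual.N))).trans
          (sumCongr (Equiv.refl _) (sumAssoc _ _ _)))) =
      (ofIso ((sumEmpty _ _).trans (emptySum _ _).symm) ((sumEmpty _ _).trans (emptySum _ _).symm), 0) := by
  refine Prod.ext ?_ ?_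
  · ext1 x
    refine (tr_of_exit _).1 _ _ ?_
    rcases x with (x | x) | (x | x)
    · exact Exit.step rfl (Exit.step rfl (Exit.step rfl (Exit.out rfl)))
    · exact x.elim
    · exact x.elim
    · exact Exit.step rfl (Exit.step rfl (Exit.step rfl (Exit.out rfl)))
  · refine (tr_of_exit _).2 ?_
    rintro ((x | x | x) | (x | x | x))
    · exact ⟨_, Exit.step rfl (Exit.step rfl (Exit.out rfl))⟩
    · exact ⟨_, Exit.step rfl (Exit.out rfl)⟩
    · exact ⟨_, Exit.out rfl⟩
    · exact ⟨_, Exit.out rfl⟩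
    · exact ⟨_, Exit.step rfl (Exit.out rfl)⟩
    · exact ⟨_, Exit.step rfl (Exit.step rfl (Exit.out rfl))⟩

/-- The second triangle identity. -/
theorem Row.ev_coev (a : Row) :
    DeligneGL.comp (tens a.coev (ofIso (Equiv.refl a.P) (Equiv.refl a.N)))
      ((sumCongr (sumAssoc _ _ _) (Equiv.refl _)).trans
        ((tens (ofIso (Equiv.refl a.P) (Equiv.refl a.N)) a.ev).trans
          (sumCongr (Equiv.refl _) (sumAssoc _ _ _).symm))) =
      (ofIso ((emptySum _ _).trans (sumEmpty _ _).symm) ((emptySum _ _).trans (sumEmpty _ _).symm), 0) := by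
  refine Prod.ext ?_ ?_
  · ext1 x
    refine (tr_of_exit _).1 _ _ ?_
    rcases x with (x | x) | (x | x)
    · exact x.elim
    · exact Exit.step rfl (Exit.step rfl (Exit.step rfl (Exit.out rfl)))
    · exact Exit.step rfl (Exit.step rfl (Exit.step rfl (Exit.out rfl)))
    · exact x.elim
  · refine (tr_of_exit _).2 ?_
    rintro (((x | x) | x) | ((x | x) | x))
    · exact ⟨_, Exit.out rfl⟩
    · exact ⟨_, Exit.step rfl (Exit.out rfl)⟩
    · exact ⟨_, Exit.step rfl (Exit.step rfl (Exit.out rfl))⟩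
    · exact ⟨_, Exit.step rfl (Exit.step rfl (Exit.out rfl))⟩
    · exact ⟨_, Exit.step rfl (Exit.out rfl)⟩
    · exact ⟨_, Exit.out rfl⟩

variable {δ : K}

/-- A row and the row with the colours exchanged are dual to each other. -/
@[reducible]
noncomputable def LinRow.exactPairing (a : Row) : ExactPairing (⟨a⟩ : LinRow δ) ⟨a.dual⟩ where
  coevaluation' := (Finsupp.single a.coev 1 : Diagram Row.one (a.tensor a.dual) →₀ K)
  evaluation' := (Finsupp.single a.ev 1 : Diagram (a.dual.tensor a) Row.one →₀ K)
  coevaluation_evaluation' := by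
    change compL δ (a.dual.tensor Row.one) (a.dual.tensor (a.tensor a.dual)) (Row.one.tensor a.dual)
      (tensL a.dual a.dual Row.one (a.tensor a.dual) (isoL (Equiv.refl _) (Equiv.refl _))
        (Finsupp.single a.coev 1))
      (compL δ (a.dual.tensor (a.tensor a.dual)) ((a.dual.tensor a).tensor a.dual) (Row.one.tensor a.dual)
        (isoL (sumAssoc _ _ _).symm (sumAssoc _ _ _).symm)
        (tensL (a.dual.tensor a) Row.one a.dual a.dual (Finsupp.single a.ev 1)
          (isoL (Equiv.refl _) (Equiv.refl _)))) =
      compL δ (a.dual.tensor Row.one) a.dual (Row.one.tensor a.dual)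
        (isoL (sumEmpty _ _) (sumEmpty _ _)) (isoL (emptySum _ _).symm (emptySum _ _).symm)
    rw [iso_comp_iso, iso_compL]
    simp only [isoL, tensL_single, Finsupp.mapDomain_single, mul_one]
    refine (compL_single δ _ _ _ _).trans ?_
    refine (congrArg (fun t => Finsupp.single t.1 (1 * 1 * δ ^ t.2)) (Row.coev_ev a)).trans ?_
    simp only [mul_one, pow_zero]
  evaluation_coevaluation' := by
    change compL δ (Row.one.tensor a) ((a.tensor a.dual).tensor a) (a.tensor Row.one)
      (tensL Row.one (a.tensor a.dual) a a (Finsupp.single a.coev 1)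
        (isoL (Equiv.refl _) (Equiv.refl _)))
      (compL δ ((a.tensor a.dual).tensor a) (a.tensor (a.dual.tensor a)) (a.tensor Row.one)
        (isoL (sumAssoc _ _ _) (sumAssoc _ _ _))
        (tensL a a (a.dual.tensor a) Row.one (isoL (Equiv.refl _) (Equiv.refl _))
          (Finsupp.single a.ev 1))) =
      compL δ (Row.one.tensor a) a (a.tensor Row.one)
        (isoL (emptySum _ _) (emptySum _ _)) (isoL (sumEmpty _ _).symm (sumEmpty _ _).symm)
    rw [iso_comp_iso, iso_compL]
    simp only [isoL, tensL_single, Finsupp.mapDomain_single, mul_one]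
    refine (compL_single δ _ _ _ _).trans ?_
    refine (congrArg (fun t => Finsupp.single t.1 (1 * 1 * δ ^ t.2)) (Row.ev_coev a)).trans ?_
    simp only [mul_one, pow_zero]

/-- The letters `•` and `∘` are dual to each other. -/
@[reducible]
noncomputable def Rep0.exactPairing : ExactPairing (⟨[.black]⟩ : Rep0 δ) ⟨[.white]⟩ :=
  let _ : ExactPairing (Rep0.toLinRow.obj (⟨[.black]⟩ : Rep0 δ))
      (Rep0.toLinRow.obj (⟨[.white]⟩ : Rep0 δ)) :=
    @exactPairingCongrRight _ _ _ _ _ _ (LinRow.exactPairing (wordRow [.black]))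
      (isoOf δ (subtypeEquivRight fun i => by rcases i with _ | i <;> simp)
        (subtypeEquivRight fun i => by rcases i with _ | i <;> simp))
  ExactPairing.ofFullyFaithful Rep0.toLinRow _ _

end RowPairing

/-! ### Fullness on the Karoubi envelope -/

section Surjective

variable {C D : Type*} [Category* C] [Category* D] (F : C ⥤ D)

theorem map_surjective_of_iso {a a' b b' : C} (e : a ≅ a') (e' : b ≅ b')
    (h : Function.Surjective (F.map : (a ⟶ b) → _)) :
    Function.Surjective (F.map : (a' ⟶ b') → _) := fun f => by
  obtain ⟨k, hk⟩ := h (F.map e.hom ≫ f ≫ F.map e'.inv)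
  exact ⟨e.inv ≫ k ≫ e'.hom, by simp [hk]⟩

variable [Preadditive C] [Preadditive D] [F.Additive]

theorem map_surjective_of_sum_left {ι : Type*} (s : Finset ι) {X Y : C} (Z : ι → C) (p : ∀ j, X ⟶ Z j)
    (i : ∀ j, Z j ⟶ X) (hs : ∑ j ∈ s, p j ≫ i j = 𝟙 X)
    (h : ∀ j, Function.Surjective (F.map : (Z j ⟶ Y) → _)) :
    Function.Surjective (F.map : (X ⟶ Y) → _) := fun f => by
  choose k hk using fun j => h j (F.map (i j) ≫ f)
  refine ⟨∑ j ∈ s, p j ≫ k j, ?_⟩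
  simp only [Functor.map_sum, Functor.map_comp, hk]
  simp only [← Category.assoc, ← Functor.map_comp]
  rw [← Preadditive.sum_comp, ← Functor.map_sum, hs, CategoryTheory.Functor.map_id, Category.id_comp]

theorem map_surjective_of_sum_right {ι : Type*} (s : Finset ι) {X Y : C} (Z : ι → C) (p : ∀ j, Y ⟶ Z j)
    (i : ∀ j, Z j ⟶ Y) (hs : ∑ j ∈ s, p j ≫ i j = 𝟙 Y)
    (h : ∀ j, Function.Surjective (F.map : (X ⟶ Z j) → _)) :
    Function.Surjective (F.map : (X ⟶ Y) → _) := fun f => by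
  choose k hk using fun j => h j (f ≫ F.map (p j))
  refine ⟨∑ j ∈ s, k j ≫ i j, ?_⟩
  simp only [Functor.map_sum, Functor.map_comp, hk, Category.assoc]
  simp only [← Functor.map_comp]
  rw [← Preadditive.comp_sum, ← Functor.map_sum, hs, CategoryTheory.Functor.map_id, Category.comp_id]

end Surjective

/-- An additive functor on the Karoubi envelope of the additive envelope is full if its restriction
to the original category is full. -/
theorem full_of_full_incl {K : Type*} [Field K] {δ : K} {T : Type*} [Category* T] [Preadditive T]
    (F : RepGL δ ⥤ T) [F.Additive]
    (h : ∀ a b : Rep0 δ, Function.Surjective ((RepGL.incl δ ⋙ F).map : (a ⟶ b) → _)) : F.Full := by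
  have h0 : ∀ a b : Rep0 δ, Function.Surjective
      (F.map : ((RepGL.incl δ).obj a ⟶ (RepGL.incl δ).obj b) → _) := fun a b f => by
    obtain ⟨k, hk⟩ := h a b f
    exact ⟨(RepGL.incl δ).map k, hk⟩
  -- Objects of the additive envelope are finite sums of words.
  have hM : ∀ M : Mat_ (Rep0 δ), ∑ j : M.ι,
      (Idempotents.toKaroubi _).map (M.isoBiproductEmbedding.hom ≫ Limits.biproduct.π
        (fun i : M.ι => (Mat_.embedding (Rep0 δ)).obj (M.X i)) j) ≫
        (Idempotents.toKaroubi _).map (Limits.biproduct.ι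
        (fun i : M.ι => (Mat_.embedding (Rep0 δ)).obj (M.X i)) j ≫ M.isoBiproductEmbedding.inv) = 𝟙 _ := by
    intro M
    simp only [← Functor.map_comp]
    rw [← Functor.map_sum, ← CategoryTheory.Functor.map_id]
    congr 1
    simp only [Category.assoc]
    rw [← Preadditive.comp_sum]
    simp only [← Category.assoc (Limits.biproduct.π _ _)]
    rw [← Preadditive.sum_comp, Limits.biproduct.total, Category.id_comp, Iso.hom_inv_id]
  have h1 : ∀ (M N : Mat_ (Rep0 δ)), Function.Surjective
      (F.map : ((Idempotents.toKaroubi _).obj M ⟶ (Idempotents.toKaroubi _).obj N) → _) :=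
    fun M N => map_surjective_of_sum_left F _ _ _ _ (hM M) fun i =>
      map_surjective_of_sum_right F _ _ _ _ (hM N) fun j => h0 _ _
  -- Objects of the Karoubi envelope are retracts of those.
  refine ⟨fun {X Y} => ?_⟩
  refine map_surjective_of_sum_left F (ι := Unit) Finset.univ (fun _ => (Idempotents.toKaroubi _).obj X.X)
    (fun _ => X.decompId_i) (fun _ => X.decompId_p) ?_ fun _ =>
    map_surjective_of_sum_right F (ι := Unit) Finset.univ (fun _ => (Idempotents.toKaroubi _).obj Y.X)
    (fun _ => Y.decompId_i) (fun _ => Y.decompId_p) ?_ fun _ => h1 _ _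
  · simp
  · simp

/-! ### Fullness on words -/

section Powers

open Functor.LaxMonoidal Functor.OplaxMonoidal

section

variable {C D : Type*} [Category* C] [Category* D] [MonoidalCategory C] [MonoidalCategory D]
  (G : C ⥤ D)

theorem map_whiskerLeft_comp_δ [G.Monoidal] {b B : C} {U P : D} (ψ : G.obj b ⟶ U) (φ : G.obj B ⟶ P)
    (k : B ⟶ B) (h : P ⟶ P) (hk : G.map k ≫ φ = φ ≫ h) :
    G.map (b ◁ k) ≫ δ G b B ≫ (ψ ⊗ₘ φ) = (δ G b B ≫ (ψ ⊗ₘ φ)) ≫ U ◁ h := by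
  rw [← δ_natural_right_assoc, whiskerLeft_comp_tensorHom, hk, Category.assoc,
    tensorHom_comp_whiskerLeft]

/-- A braided functor is compatible with the braiding of the first two factors of a threefold tensor
product. -/
theorem map_braiding_comp_δ [BraidedCategory C] [BraidedCategory D] [G.Braided] {b B : C} {U P : D}
    (ψ : G.obj b ⟶ U) (φ : G.obj B ⟶ P) :
    G.map ((α_ b b B).inv ≫ (β_ b b).hom ▷ B ≫ (α_ b b B).hom) ≫
        δ G b (b ⊗ B) ≫ (ψ ⊗ₘ (δ G b B ≫ (ψ ⊗ₘ φ))) =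
      (δ G b (b ⊗ B) ≫ (ψ ⊗ₘ (δ G b B ≫ (ψ ⊗ₘ φ)))) ≫
        (α_ U U P).inv ≫ (β_ U U).hom ▷ P ≫ (α_ U U P).hom := by
  have key : G.map (α_ b b B).hom ≫ δ G b (b ⊗ B) ≫ (ψ ⊗ₘ (δ G b B ≫ (ψ ⊗ₘ φ))) =
      δ G (b ⊗ b) B ≫ δ G b b ▷ G.obj B ≫ ((ψ ⊗ₘ ψ) ⊗ₘ φ) ≫ (α_ U U P).hom := by
    rw [← whiskerLeft_comp_tensorHom, ← Functor.OplaxMonoidal.associativity_assoc, associator_naturality]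
  have key' : δ G b (b ⊗ B) ≫ (ψ ⊗ₘ (δ G b B ≫ (ψ ⊗ₘ φ))) = G.map (α_ b b B).inv ≫
      δ G (b ⊗ b) B ≫ δ G b b ▷ G.obj B ≫ ((ψ ⊗ₘ ψ) ⊗ₘ φ) ≫ (α_ U U P).hom := by
    rw [← key, Iso.map_inv_hom_id_assoc]
  have hβ : δ G b b ▷ G.obj B ≫ ((ψ ⊗ₘ ψ) ⊗ₘ φ) ≫ (β_ U U).hom ▷ P =
      G.map (β_ b b).hom ▷ G.obj B ≫ δ G b b ▷ G.obj B ≫ ((ψ ⊗ₘ ψ) ⊗ₘ φ) := by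
    rw [tensorHom_comp_whiskerRight, BraidedCategory.braiding_naturality, ← whiskerRight_comp_tensorHom,
      Functor.map_braiding]
    simp only [comp_whiskerRight, Category.assoc, Functor.Monoidal.whiskerRight_μ_δ_assoc]
  rw [Functor.map_comp, Functor.map_comp, Category.assoc, Category.assoc, key, key']
  simp only [Category.assoc, Iso.hom_inv_id_assoc]
  rw [reassoc_of% hβ, δ_natural_left_assoc]

end

variable {K : Type*} [Field K] {δ : K}

theorem Rep0.nonempty_iso_of_perm {u w : List Letter} (h : u.Perm w) :
    Nonempty ((⟨u⟩ : Rep0 δ) ≅ ⟨w⟩) := by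
  induction h with
  | nil => exact ⟨Iso.refl _⟩
  | @cons x u w _ ih =>
    obtain ⟨e⟩ := ih
    exact ⟨whiskerLeftIso (⟨[x]⟩ : Rep0 δ) e⟩
  | swap x y u =>
    exact ⟨(α_ (⟨[y]⟩ : Rep0 δ) ⟨[x]⟩ ⟨u⟩).symm ≪≫
      whiskerRightIso (β_ (⟨[y]⟩ : Rep0 δ) ⟨[x]⟩) ⟨u⟩ ≪≫ α_ (⟨[x]⟩ : Rep0 δ) ⟨[y]⟩ ⟨u⟩⟩
  | trans _ _ ih ih' =>
    obtain ⟨e⟩ := ih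
    obtain ⟨e'⟩ := ih'
    exact ⟨e ≪≫ e'⟩

variable {T : Type*} [Category* T] [MonoidalCategory T] (G : Rep0 δ ⥤ T)

/-- A monoidal functor sends `c⋯c` to a tensor power. -/
noncomputable def powIso [G.Monoidal] (c : Letter) {U : T} (ψ : G.obj ⟨[c]⟩ ≅ U) :
    ∀ n : ℕ, G.obj ⟨List.replicate n c⟩ ≅ tpow U n
  | 0 => (Functor.Monoidal.εIso G).symm
  | n + 1 => (Functor.Monoidal.μIso G ⟨[c]⟩ ⟨List.replicate n c⟩).symm ≪≫ (ψ ⊗ᵢ powIso c ψ n)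

/-- The braiding of two neighbouring tensor factors lies in the image of the functor. -/
theorem exists_map_comp_powIso_eq_braidAt [BraidedCategory T] [G.Braided] (c : Letter) {U : T}
    (ψ : G.obj ⟨[c]⟩ ≅ U) : ∀ n i : ℕ,
    ∃ k : (⟨List.replicate n c⟩ : Rep0 δ) ⟶ ⟨List.replicate n c⟩,
      G.map k ≫ (powIso G c ψ n).hom = (powIso G c ψ n).hom ≫ braidAt U n i
  | n + 2, 0 => by
    let b : Rep0 δ := ⟨[c]⟩
    let B : Rep0 δ := ⟨List.replicate n c⟩
    exact ⟨((α_ b b B).inv ≫ (β_ b b).hom ▷ B ≫ (α_ b b B).hom : b ⊗ b ⊗ B ⟶ b ⊗ b ⊗ B),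
      map_braiding_comp_δ G ψ.hom (powIso G c ψ n).hom⟩
  | n + 1, i + 1 => by
    obtain ⟨k, hk⟩ := exists_map_comp_powIso_eq_braidAt c ψ n i
    refine ⟨(⟨[c]⟩ : Rep0 δ) ◁ k, ?_⟩
    have hbr : braidAt U (n + 1) (i + 1) = U ◁ braidAt U n i := by
      cases n <;> rfl
    rw [hbr]
    exact map_whiskerLeft_comp_δ G ψ.hom _ k _ hk
  | 0, i => ⟨𝟙 _, by rw [CategoryTheory.Functor.map_id, Category.id_comp]; exact (Category.comp_id _).symm⟩
  | 1, 0 => ⟨𝟙 _, by rw [CategoryTheory.Functor.map_id, Category.id_comp]; exact (Category.comp_id _).symm⟩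

/-- If the braid action on tensor powers of `V` is surjective, then all endomorphisms of the tensor
powers of `V` come from endomorphisms of `•⋯•`. -/
theorem map_surjective_replicate [SymmetricCategory T] [Preadditive T] [Linear K T] [G.Braided]
    [G.Additive] [G.Linear K] (c : Letter) {U : T} (ψ : G.obj ⟨[c]⟩ ≅ U) (p : ℕ)
    (ρ : MonoidAlgebra K (Equiv.Perm (Fin p)) →ₐ[K] End (tpow U p)) (hρ : IsBraidAction U p ρ)
    (hρs : Function.Surjective ρ) :
    Function.Surjective (G.map : ((⟨List.replicate p c⟩ : Rep0 δ) ⟶ ⟨List.replicate p c⟩) → _) := by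
  -- The endomorphisms of the tensor power that lift form a subalgebra.
  let P : End (tpow U p) → Prop := fun h =>
    ∃ k : (⟨List.replicate p c⟩ : Rep0 δ) ⟶ ⟨List.replicate p c⟩,
      G.map k ≫ (powIso G c ψ p).hom = (powIso G c ψ p).hom ≫ h
  have h1 : P 1 := ⟨𝟙 _, by
    rw [CategoryTheory.Functor.map_id, Category.id_comp]; exact (Category.comp_id _).symm⟩
  have hmul : ∀ f g, P f → P g → P (f * g) := by
    rintro f g ⟨k, hk⟩ ⟨k', hk'⟩
    refine ⟨k' ≫ k, ?_⟩
    rw [Functor.map_comp, Category.assoc, hk, ← Category.assoc, hk', Category.assoc]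
    rfl
  have hperm : ∀ σ : Equiv.Perm (Fin p), P (ρ (MonoidAlgebra.of K _ σ)) := by
    cases p with
    | zero =>
      intro σ
      rw [Subsingleton.elim σ 1, map_one, map_one]
      exact h1
    | succ n =>
      intro σ
      have hσ : σ ∈ Submonoid.closure (Set.range fun i : Fin n ↦ Equiv.swap i.castSucc i.succ) := by
        rw [Equiv.Perm.mclosure_swap_castSucc_succ]; trivial
      induction hσ using Submonoid.closure_induction with
      | mem x hx =>
        obtain ⟨i, rfl⟩ := hx
        have := hρ i.1 (by omega)
        obtain ⟨k, hk⟩ := exists_map_comp_powIso_eq_braidAt G c ψ (n + 1) i.1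
        exact ⟨k, hk.trans (congrArg ((powIso G c ψ (n + 1)).hom ≫ ·) this.symm)⟩
      | one => rw [map_one, map_one]; exact h1
      | mul x y _ _ hx hy => rw [map_mul, map_mul]; exact hmul _ _ hx hy
  have hall : ∀ x, P (ρ x) := by
    intro x
    induction x using MonoidAlgebra.induction_on with
    | of σ => exact hperm σ
    | add x y hx hy =>
      obtain ⟨k, hk⟩ := hx
      obtain ⟨k', hk'⟩ := hy
      refine ⟨k + k', ?_⟩
      rw [Functor.map_add, Preadditive.add_comp, hk, hk', map_add]
      exact (Preadditive.comp_add _ _ _ _ _ _).symm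
    | smul r x hx =>
      obtain ⟨k, hk⟩ := hx
      refine ⟨r • k, ?_⟩
      rw [Functor.map_smul, Linear.smul_comp, hk, map_smul]
      exact (Linear.comp_smul _ _ _ _ _ _).symm
  intro f
  obtain ⟨x, hx⟩ := hρs ((powIso G c ψ p).inv ≫ f ≫ (powIso G c ψ p).hom)
  obtain ⟨k, hk⟩ := hall x
  refine ⟨k, ?_⟩
  rw [hx, Iso.hom_inv_id_assoc, cancel_mono] at hk
  exact hk

open scoped Classical in
/-- Fullness on words. The white letters are moved to the other side by duality, which leaves
morphisms between powers of `•`. -/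
theorem map_surjective_words [BraidedCategory T] [G.Braided]
    (h : ∀ p q : ℕ, Function.Surjective
      (G.map : ((⟨List.replicate p .black⟩ : Rep0 δ) ⟶ ⟨List.replicate q .black⟩) → _)) :
    ∀ (n : ℕ) (a b : List Letter), a.count .white + b.count .white = n →
      Function.Surjective (G.map : ((⟨a⟩ : Rep0 δ) ⟶ ⟨b⟩) → _) := by
  intro n
  induction n with
  | zero =>
    intro a b hab
    have key : ∀ w : List Letter, w.count .white = 0 → w = List.replicate w.length .black := by
      intro w hw
      refine List.eq_replicate_of_mem fun x hx => ?_
      cases x with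
      | black => rfl
      | white => exact absurd hx (List.count_eq_zero.1 hw)
    rw [key a (by omega), key b (by omega)]
    exact h _ _
  | succ n ih =>
    intro a b hab
    by_cases ha : Letter.white ∈ a
    · have hp := List.perm_cons_erase ha
      obtain ⟨e⟩ := Rep0.nonempty_iso_of_perm (δ := δ) hp
      have hc := hp.count_eq .white
      rw [List.count_cons_self] at hc
      let _ := Rep0.exactPairing (δ := δ)
      refine map_surjective_of_iso G e.symm (Iso.refl _) ?_
      refine map_surjective_tensorLeft G (Y := ⟨[.black]⟩) (Y' := ⟨[.white]⟩) ⟨a.erase .white⟩ ⟨b⟩ ?_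
      refine ih (a.erase .white) (.black :: b) ?_
      rw [List.count_cons_of_ne (by simp)]
      omega
    · have hb : Letter.white ∈ b := by
        rw [← List.count_pos_iff]
        have := List.count_eq_zero.2 ha
        omega
      have hp := List.perm_cons_erase hb
      obtain ⟨e⟩ := Rep0.nonempty_iso_of_perm (δ := δ) hp
      have hc := hp.count_eq .white
      rw [List.count_cons_self] at hc
      let _ := @BraidedCategory.exactPairing_swap _ _ _ _ _ _ (Rep0.exactPairing (δ := δ))
      refine map_surjective_of_iso G (Iso.refl _) e.symm ?_
      refine map_surjective_tensorLeft_symm G (Y := ⟨[.white]⟩) (Y' := ⟨[.black]⟩) ⟨a⟩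
        ⟨b.erase .white⟩ ?_
      refine ih (.black :: a) (b.erase .white) ?_
      rw [List.count_cons_of_ne (by simp)]
      omega

/-- A braided functor with `• ↦ V` sends `•^r∘^s` to the mixed tensor power of `V`. -/
theorem nonempty_iso_mixedPow [BraidedCategory T] [G.Braided] (V Vd : T) [ExactPairing V Vd]
    (ψ : G.obj ⟨[.black]⟩ ≅ V) (r s : ℕ) : Nonempty (G.obj (mixedObj δ r s) ≅ mixedPow V Vd r s) := by
  let _ := Rep0.exactPairing (δ := δ)
  let ψ' : G.obj ⟨[.white]⟩ ≅ Vd :=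
    rightDualIso (mapExactPairing G ⟨[.black]⟩ ⟨[.white]⟩) (exactPairingCongrLeft ψ)
  exact ⟨(Functor.Monoidal.μIso G ⟨List.replicate r .black⟩ ⟨List.replicate s .white⟩).symm ≪≫
    (powIso G .black ψ r ⊗ᵢ powIso G .white ψ' s)⟩

end Powers

/-! ### Summands in the target category -/

section Summands

variable {T : Type*} [Category* T] [Preadditive T]

/-- Direct summands are carried over along isomorphisms. -/
theorem IsSummand.of_iso {W X Y : T} (h : IsSummand W X) (e : X ≅ Y) : IsSummand W Y := by
  obtain ⟨W', ⟨B⟩⟩ := h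
  refine ⟨W', ⟨⟨B.i₁ ≫ e.hom, B.i₂ ≫ e.hom, e.inv ≫ B.p₁, e.inv ≫ B.p₂, ?_, ?_, ?_, ?_, ?_⟩⟩⟩
  · simp [B.i₁_p₁]
  · simp [B.i₂_p₂]
  · simp [B.i₁_p₂]
  · simp [B.i₂_p₁]
  · have := congrArg (fun t => e.inv ≫ t ≫ e.hom) B.total
    simpa using this

theorem IsSummand.of_iso_left {W W' X : T} (h : IsSummand W X) (e : W ≅ W') : IsSummand W' X := by
  obtain ⟨U, ⟨B⟩⟩ := h
  refine ⟨U, ⟨⟨e.inv ≫ B.i₁, B.i₂, B.p₁ ≫ e.hom, B.p₂, ?_, B.i₂_p₂, ?_, ?_, ?_⟩⟩⟩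
  · simp [reassoc_of% B.i₁_p₁]
  · simp [B.i₁_p₂]
  · simp [reassoc_of% B.i₂_p₁]
  · simp [B.total]

variable {K : Type*} [Field K] {δ : K} (F : RepGL δ ⥤ T) [F.Additive]

theorem imageι_π_eq_zero {w : Rep0 δ} (a b : End w) (ha : a * a = a) (hb : b * b = b) (hab : b * a = 0) :
    imageι (δ := δ) a ha ≫ imageπ (δ := δ) b hb = 0 := by
  have h2 : imageι (δ := δ) a ha ≫ (imageπ (δ := δ) a ha ≫ imageι (δ := δ) a ha) ≫
      (imageπ (δ := δ) b hb ≫ imageι (δ := δ) b hb) ≫ imageπ (δ := δ) b hb = 0 := by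
    rw [imageπ_ι, imageπ_ι, ← Category.assoc ((RepGL.incl δ).map a), ← Functor.map_comp]
    have : (RepGL.incl δ).map (a ≫ b) = 0 := by
      rw [show a ≫ b = 0 from hab, Functor.map_zero]
    rw [this, Limits.zero_comp, Limits.comp_zero]
  simp only [Category.assoc] at h2
  rw [← Category.assoc (imageι _ _) (imageπ _ _), imageι_π, Category.id_comp] at h2
  rwa [imageι_π, Category.comp_id] at h2

theorem isSummand_map_image {w : Rep0 δ} (e : End w) (he : e * e = e) :
    IsSummand (F.obj (RepGL.image (δ := δ) e he)) (F.obj ((RepGL.incl δ).obj w)) := by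
  have he' : (1 - e) * (1 - e) = 1 - e := by
    simp [mul_sub, sub_mul, he]
  refine ⟨F.obj (RepGL.image (δ := δ) (1 - e) he'), ⟨⟨F.map (imageι e he), F.map (imageι _ he'),
    F.map (imageπ e he), F.map (imageπ _ he'), ?_, ?_, ?_, ?_, ?_⟩⟩⟩
  · rw [← Functor.map_comp, imageι_π, CategoryTheory.Functor.map_id]
  · rw [← Functor.map_comp, imageι_π, CategoryTheory.Functor.map_id]
  · rw [← Functor.map_comp, imageι_π_eq_zero _ _ _ _ (by rw [sub_mul, he, one_mul, sub_self]), Functor.map_zero]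
  · rw [← Functor.map_comp, imageι_π_eq_zero _ _ _ _ (by rw [mul_sub, he, mul_one, sub_self]), Functor.map_zero]
  · rw [← Functor.map_comp, ← Functor.map_comp, imageπ_ι, imageπ_ι, ← Functor.map_add,
      ← Functor.map_add]
    have : e + (1 - e) = 1 := by abel
    refine (congrArg (fun t => F.map ((RepGL.incl δ).map t)) this).trans ?_
    refine (congrArg F.map ((RepGL.incl δ).map_id w)).trans (F.map_id _)

/-- An indecomposable summand of the image of a word is the image of a primitive idempotent: the
projection lifts to an idempotent, which is a sum of primitive ones, and all but one of them die. -/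
theorem IsIndecomposable.exists_iso_map_image [F.Full] {W : T} (hW : ¬ Limits.IsZero W)
    (hi : IsIndecomposable W) {w : Rep0 δ} (i : W ⟶ F.obj ((RepGL.incl δ).obj w))
    (p : F.obj ((RepGL.incl δ).obj w) ⟶ W) (hip : i ≫ p = 𝟙 W) :
    ∃ (f : End w) (hf : IsPrimitive f),
      Nonempty (W ≅ F.obj (RepGL.image (δ := δ) f hf.idem)) := by
  let φ : End w →* End (F.obj ((RepGL.incl δ).obj w)) := (RepGL.incl δ ⋙ F).mapEnd w
  obtain ⟨x, hx⟩ := (RepGL.incl δ ⋙ F).map_surjective (p ≫ i)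
  obtain ⟨ε, hε, hεx⟩ := exists_idempotent_lift (K := K) φ x (by
    change (RepGL.incl δ ⋙ F).map x ≫ (RepGL.incl δ ⋙ F).map x = (RepGL.incl δ ⋙ F).map x
    rw [hx, Category.assoc, reassoc_of% hip])
  have hGε : F.map ((RepGL.incl δ).map ε) = p ≫ i := hεx.trans hx
  obtain ⟨k, f, hf, horth, hsum⟩ := exists_primitive_decomposition K ε hε
  have hfε := fun j => (mul_sum_of_orthogonal (fun i => (hf i).idem) horth hsum j).1
  have hεf := fun j => (mul_sum_of_orthogonal (fun i => (hf i).idem) horth hsum j).2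
  have hone : 𝟙 W = ∑ j, i ≫ F.map ((RepGL.incl δ).map (f j)) ≫ p := by
    rw [← Preadditive.comp_sum, ← Preadditive.sum_comp, ← Functor.map_sum, ← Functor.map_sum]
    refine Eq.trans ?_ (congrArg (fun t => i ≫ F.map ((RepGL.incl δ).map t) ≫ p) hsum.symm)
    rw [hGε, Category.assoc, hip, Category.comp_id, hip]
  obtain ⟨j, hj⟩ : ∃ j, i ≫ F.map ((RepGL.incl δ).map (f j)) ≫ p ≠ 0 := by
    by_contra hcon
    push Not at hcon
    rw [Finset.sum_eq_zero fun j _ => hcon j] at hone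
    exact hW ((Limits.IsZero.iff_id_eq_zero _).2 hone)
  -- The complement of the image of `f j` in `W` is the image of `ε - f j`.
  have hg : (ε - f j) * (ε - f j) = ε - f j := by
    rw [mul_sub, sub_mul, sub_mul, hε, hfε, hεf, (hf j).idem, sub_self, sub_zero]
  have hcomp : ∀ (a b : End w) (ha : a * a = a) (hb : b * b = b), ε * a = a →
      (F.map (imageι (δ := δ) a ha) ≫ p) ≫ i ≫ F.map (imageπ (δ := δ) b hb) =
        F.map (imageι (δ := δ) a ha ≫ imageπ (δ := δ) b hb) := by
    intro a b ha hb ha'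
    have h1 : imageι (δ := δ) a ha ≫ (RepGL.incl δ).map ε = imageι (δ := δ) a ha := by
      have h2 : imageι (δ := δ) a ha ≫ (RepGL.incl δ).map a = imageι (δ := δ) a ha := by
        rw [← imageπ_ι a ha, ← Category.assoc, imageι_π, Category.id_comp]
      conv_lhs => rw [← h2]
      rw [Category.assoc, ← Functor.map_comp, show a ≫ ε = a from ha', h2]
    rw [Category.assoc, ← Category.assoc p, ← hGε, ← Functor.map_comp, ← Functor.map_comp,
      ← Category.assoc, h1]
  let B : Biprod W (F.obj (RepGL.image (δ := δ) (f j) (hf j).idem))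
      (F.obj (RepGL.image (δ := δ) (ε - f j) hg)) :=
    { i₁ := F.map (imageι (f j) (hf j).idem) ≫ p
      i₂ := F.map (imageι (ε - f j) hg) ≫ p
      p₁ := i ≫ F.map (imageπ (f j) (hf j).idem)
      p₂ := i ≫ F.map (imageπ (ε - f j) hg)
      i₁_p₁ := by
        rw [hcomp _ _ _ _ (hεf j), imageι_π, CategoryTheory.Functor.map_id]
      i₂_p₂ := by
        rw [hcomp _ _ _ _ (by rw [mul_sub, hε, hεf]), imageι_π, CategoryTheory.Functor.map_id]
      i₁_p₂ := by
        rw [hcomp _ _ _ _ (hεf j), imageι_π_eq_zero _ _ _ _ (by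
          rw [sub_mul, hεf, (hf j).idem, sub_self]), Functor.map_zero]
      i₂_p₁ := by
        rw [hcomp _ _ _ _ (by rw [mul_sub, hε, hεf]), imageι_π_eq_zero _ _ _ _ (by
          rw [mul_sub, hfε, (hf j).idem, sub_self]), Functor.map_zero]
      total := by
        have h1 : ∀ (a : End w) (ha : a * a = a), (i ≫ F.map (imageπ (δ := δ) a ha)) ≫
            F.map (imageι (δ := δ) a ha) ≫ p = i ≫ F.map ((RepGL.incl δ).map a) ≫ p := by
          intro a ha
          rw [← imageπ_ι a ha, Functor.map_comp]
          simp only [Category.assoc]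
        rw [h1, h1, ← Preadditive.comp_add, ← Preadditive.add_comp, ← Functor.map_add,
          ← Functor.map_add]
        refine (congrArg (fun t => i ≫ F.map ((RepGL.incl δ).map t) ≫ p)
          (add_sub_cancel (f j) ε)).trans ?_
        rw [hGε, Category.assoc, hip, Category.comp_id, hip] }
  have hB : B.p₁ ≫ B.i₁ = i ≫ F.map ((RepGL.incl δ).map (f j)) ≫ p := by
    rw [← imageπ_ι (f j) (hf j).idem, Functor.map_comp]
    simp only [B, Category.assoc]
  refine ⟨f j, hf j, ⟨⟨B.p₁, B.i₁, ?_, B.i₁_p₁⟩⟩⟩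
  have ht := B.total
  rwa [(hi _ _ B).resolve_left (hB ▸ hj), add_zero] at ht

end Summands

/-- A full functor reflects isomorphism of local objects that it does not kill: a composite of lifts
of the two inverse isomorphisms is not nilpotent. -/
theorem IsLocalObj.nonempty_iso_of_map {C D : Type*} [Category* C] [Preadditive C] [Category* D]
    [Preadditive D] (F : C ⥤ D) [F.Full] [F.Additive] {X Y : C} (hX : IsLocalObj X) (hY : IsLocalObj Y)
    (h : ¬ Limits.IsZero (F.obj X)) (e : F.obj X ≅ F.obj Y) : Nonempty (X ≅ Y) := by
  obtain ⟨f, hf⟩ := F.map_surjective e.hom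
  obtain ⟨g, hg⟩ := F.map_surjective e.inv
  refine hX.nonempty_iso hY f g ((hX.2 (f ≫ g)).resolve_right ?_)
  rintro ⟨n, hn⟩
  apply h
  rw [Limits.IsZero.iff_id_eq_zero]
  have h1 := congrArg (F.mapEnd X) hn
  rw [map_pow] at h1
  have h2 : F.mapEnd X (f ≫ g) = 1 := by
    change F.map (f ≫ g) = 𝟙 _
    rw [Functor.map_comp, hf, hg, Iso.hom_inv_id]
  rw [h2, one_pow] at h1
  exact h1.trans (F.map_zero _ _)

end DeligneGL

theorem mainTheorem7 {K : Type*} [Field K] [CharZero K] (δ : K)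
    {T : Type*} [Category* T] [Preadditive T] [Linear K T] [MonoidalCategory T]
    [MonoidalPreadditive T] [MonoidalLinear K T] [SymmetricCategory T] [RigidCategory T]
    (hunit : Function.Bijective fun a : K => a • 𝟙 (𝟙_ T))
    (V Vd : T) [ExactPairing V Vd]
    (hdim : η_ V Vd ≫ (β_ V Vd).hom ≫ ε_ V Vd = δ • 𝟙 (𝟙_ T))
    (F : RepGL δ ⥤ T) [F.Additive] [(RepGL.incl δ ⋙ F).Linear K] [(RepGL.incl δ ⋙ F).Braided]
    (hF : Nonempty (F.obj ((RepGL.incl δ).obj ⟨[Letter.black]⟩) ≅ V))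
    (hsurj : ∀ p : ℕ, ∃ ρ : MonoidAlgebra K (Equiv.Perm (Fin p)) →ₐ[K] End (tpow V p),
      IsBraidAction V p ρ ∧ Function.Surjective ρ)
    (hhom : ∀ r s r' s' : ℕ, r + s' ≠ r' + s →
      ∀ f : mixedPow V Vd r s ⟶ mixedPow V Vd r' s', f = 0) :
    F.Full ∧
    (∀ l : Bipartition, ∃ X : RepGL δ, IsL δ l X) ∧
    ∀ L : Bipartition → RepGL δ, (∀ l, IsL δ l (L l)) →
      (∀ l, ¬ Limits.IsZero (F.obj (L l)) →
        IsIndecomposable (F.obj (L l)) ∧ ∃ r s : ℕ, IsSummand (F.obj (L l)) (mixedPow V Vd r s)) ∧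
      (∀ (W : T) (r s : ℕ), ¬ Limits.IsZero W → IsIndecomposable W →
        IsSummand W (mixedPow V Vd r s) →
        ∃ l, ¬ Limits.IsZero (F.obj (L l)) ∧ Nonempty (W ≅ F.obj (L l))) ∧
      (∀ l m, ¬ Limits.IsZero (F.obj (L l)) → ¬ Limits.IsZero (F.obj (L m)) →
        Nonempty (F.obj (L l) ≅ F.obj (L m)) → l = m) := by
  obtain ⟨ψ⟩ := hF
  have hadd : (RepGL.incl δ ⋙ F).Additive := inferInstance
  have hpow : ∀ p q : ℕ, Function.Surjective ((RepGL.incl δ ⋙ F).map :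
      ((⟨List.replicate p .black⟩ : Rep0 δ) ⟶ ⟨List.replicate q .black⟩) → _) := by
    intro p q
    by_cases hpq : p = q
    · subst hpq
      obtain ⟨ρ, hρ, hρs⟩ := hsurj p
      exact map_surjective_replicate (RepGL.incl δ ⋙ F) .black ψ p ρ hρ hρs
    · intro f
      let a : (RepGL.incl δ ⋙ F).obj ⟨List.replicate p .black⟩ ≅ mixedPow V Vd p 0 :=
        powIso (RepGL.incl δ ⋙ F) .black ψ p ≪≫ (ρ_ (tpow V p)).symm
      let b : (RepGL.incl δ ⋙ F).obj ⟨List.replicate q .black⟩ ≅ mixedPow V Vd q 0 :=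
        powIso (RepGL.incl δ ⋙ F) .black ψ q ≪≫ (ρ_ (tpow V q)).symm
      have h0 := hhom p 0 q 0 (by omega) (a.inv ≫ f ≫ b.hom)
      have hf : f = a.hom ≫ (a.inv ≫ f ≫ b.hom) ≫ b.inv := by simp
      have hz : f = 0 := hf.trans ((congrArg (fun t => a.hom ≫ t ≫ b.inv) h0).trans (by
        rw [Limits.zero_comp, Limits.comp_zero]))
      exact ⟨0, (Functor.map_zero _ _ _).trans hz.symm⟩
  have hfull : F.Full := full_of_full_incl F fun a b =>
    map_surjective_words (RepGL.incl δ ⋙ F) hpow _ a.word b.word rfl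
  have hmixed := nonempty_iso_mixedPow (RepGL.incl δ ⋙ F) V Vd ψ
  refine ⟨hfull, exists_isL, fun L hL => ⟨fun l hl => ⟨?_, ?_⟩, fun W r s hW hi hs => ?_,
    fun l m hl hm e => ?_⟩⟩
  · exact ((hL l).isLocalObj.map F hl).isIndecomposable
  · obtain ⟨e, he, ⟨φ⟩⟩ := hL l
    obtain ⟨χ⟩ := hmixed l.1.card l.2.card
    exact ⟨_, _, ((isSummand_map_image F e he.primitive.idem).of_iso_left (F.mapIso φ.symm)).of_iso χ⟩
  · obtain ⟨χ⟩ := hmixed r s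
    obtain ⟨W', ⟨B⟩⟩ := hs.of_iso χ.symm
    obtain ⟨f, hf, ⟨φ⟩⟩ := hi.exists_iso_map_image F hW B.i₁ B.p₁ B.i₁_p₁
    obtain ⟨l, ⟨χ'⟩⟩ := exists_iso_of_retract hL r s _ (isLocalObj_image f hf)
      (imageι f hf.idem) (imageπ f hf.idem) (imageι_π _ _)
    let θ := φ ≪≫ F.mapIso χ'
    exact ⟨l, fun h => hW (h.of_iso θ), ⟨θ⟩⟩
  · obtain ⟨e⟩ := e
    obtain ⟨φ⟩ := (hL l).isLocalObj.nonempty_iso_of_map F (hL m).isLocalObj hl e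
    exact (hL l).eq_of_iso (hL m) φ
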